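/- **Setting.** Let $g\ge 1$ and let $X$ be the compact hyperelliptic Riemann surface of genus $g$ given by $y^2=p(x)$, where $p\in\mathbb C[x]$ has no multiple zeros and degree $n=2g+1$ or $n=2g+2$. Let $T$ be the Virasoro field of central charge $c\in\mathbb C$ and let $\langle\ \rangle$ be a state on $X$ with $\langle 1\rangle\neq 0$. That is, for all $N\ge 0$ and all choices of local coordinates on $X$ one is given the $N$-point function $\langle T(z_1)\cdots T(z_N)\rangle$; these functions are symmetric, and holomorphic at pairwise distinct points; under a change of coordinates $z\mapsto\hat z$ one has, in each argument, $T(z)=\hat T(\hat z)\,[\hat z']^2+\frac{c}{12}S(\hat z)\cdot 1$ with the Schwarzian derivative $S(f)=\frac{f'''}{f'}-\frac32\big(\frac{f''}{f'}\big)^2$; and in every local coordinate and inside every $N$-point function $$T(z)T(w)\mapsto\frac{c/2}{(z-w)^4}\,1+\frac{T(z)+T(w)}{(z-w)^2}+\Phi(w)+O(z-w).$$ Let $T(x)$ be the field in the coordinate $x$, which is a local coordinate where $y\ne 0$. For points $(x_i,y_i)$ of $X$ with $y_i\neq0$, write $p_i=p(x_i)$, $p_i'=p'(x_i)$. The connected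 functions are $\langle T(x_1)\rangle_c=\langle1\rangle^{-1}\langle T(x_1)\rangle$, $\langle T(x_1)T(x_2)\rangle_c=\langle1\rangle^{-1}\langle T(x_1)T(x_2)\rangle-\langle T(x_1)\rangle_c\langle T(x_2)\rangle_c$ and $$\begin{aligned}\langle T(x_1)T(x_2)T(x_3)\rangle_c=\ &\langle1\rangle^{-1}\langle T(x_1)T(x_2)T(x_3)\rangle-\langle T(x_1)T(x_2)\rangle_c\langle T(x_3)\rangle_c-\langle T(x_2)T(x_3)\rangle_c\langle T(x_1)\rangle_c\\&-\langle T(x_3)T(x_1)\rangle_c\langle T(x_2)\rangle_c-\langle T(x_1)\rangle_c\langle T(x_2)\rangle_c\langle T(x_3)\rangle_c.\end{aligned}$$ Put $f_{ij}=\big(\frac{y_i+y_j}{x_i-x_j}\big)^2$. Define $P_i=P(x_i,y_i)$ by $p_i\langle T(x_i)\rangle=\frac{c}{32}\frac{[p_i']^2}{p_i}\langle1\rangle+\frac14P_i$, and $r_{ij}=\langle[T(x_i)T(x_j)]_{\rm reg.}\rangle\,p_ip_j$ by $$\langle T(x_i)T(x_j)\rangle p_ip_j-\langle T(x_i)\rangle_c\langle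 T(x_j)\rangle_c\langle1\rangle p_ip_j=\frac{c}{32}f_{ij}^2\langle1\rangle+\frac{1}{4}f_{ij}\Big\{\langle T(x_i)\rangle p_i-\frac{c}{32}\frac{[p_i']^2}{p_i}\langle1\rangle+\langle T(x_j)\rangle p_j-\frac{c}{32}\frac{[p_j']^2}{p_j}\langle1\rangle\Big\}+r_{ij}.$$ **Theorem.** 1. If $n$ is odd, then for fixed distinct points $(x_2,y_2),(x_3,y_3)$, as $x_1\to\infty$, $$\langle T(x_1)T(x_2)T(x_3)\rangle_c\,p_1p_2p_3=O(x_1^{n-3}).$$ 2. In the region where $x_1,x_2,x_3$ are finite, $$\langle T(x_1)T(x_2)T(x_3)\rangle_c\,p_1p_2p_3=R^{(0)}(x_1,x_2,x_3)+(\text{a polynomial in }x_1,x_2,x_3,y_1,y_2,y_3),$$ where $R^{(0)}$ is the rational function of $x_1,x_2,x_3,y_1,y_2,y_3$, symmetric under permutations of the three points, given by $$\begin{aligned}R^{(0)}=\ &\tfrac{c}{64}f_{12}f_{13}f_{23}+\tfrac1{64}f_{12}f_{13}\langle1\rangle^{-1}(P_2+P_3)+\tfrac1{64}f_{12}f_{23}\langle1\rangle^{-1}(P_1+P_3)+\tfrac1{64}f_{13}f_{23}\langle1\rangle^{-1}(P_1+P_2)\\&+\tfrac14f_{12}\langle1\rangle^{-1}(r_{13}+r_{23})+\tfrac14f_{13}\langle1\rangle^{-1}(r_{12}+r_{23})+\tfrac14f_{23}\langle1\rangle^{-1}(r_{12}+r_{13}).\end{aligned}$$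 3. Let $n$ be odd. For a rational function $Q$ of $x_i,y_i$ (and the other variables), write $Q=Q^{\rm even}+y_iQ^{\rm odd}$, with $Q^{\rm even},Q^{\rm odd}$ independent of $y_i$, and put $$Q_i=\pi_{n-3,i}(Q^{\rm even})+y_i\,\pi_{\frac n2-3,i}(Q^{\rm odd}),$$ where $\pi_{k,i}$ is the projection onto the part of order strictly larger than $k$ in $x_i$ as $x_i\to\infty$; put $Q_{i,j}=[Q_i]_j$, $Q_{i,j,k}=[Q_{i,j}]_k$. These projections exist for $R^{(0)}$, also when iterated over distinct indices; $R^{(0)}_{i,j}=R^{(0)}_{j,i}$ for $i\ne j$, and $R^{(0)}_{i,j,k}$ is the same for all orderings $(i,j,k)$ of $\{1,2,3\}$. There are polynomials $P^{(0)},P^{(i)},P^{(i,j)}$ ($i<j$), $P^{(1,2,3)}$ in $x_1,x_2,x_3$, depending on the state, such that $$\begin{aligned}\langle T(x_1)T(x_2)T(x_3)\rangle_c\,p_1p_2p_3=\ &R^{(0)}-R^{(0)}_1+R^{(0)}_{1,2}-R^{(0)}_2+R^{(0)}_{2,3}-R^{(0)}_3+R^{(0)}_{1,3}-R^{(0)}_{1,2,3}\\&+P^{(0)}+\sum_{i}y_iP^{(i)}+\sum_{i<j}y_iy_jP^{(i,j)}+y_1y_2y_3P^{(1,2,3)}.\end{aligned}$$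 Their degrees (a polynomial with a negative degree bound is zero) are at most: for $P^{(0)}$, $n-3$ in each $x_k$; for $P^{(i)}$, $\frac{n-1}2-3$ in $x_i$ and $n-3$ in the other variables; for $P^{(i,j)}$, $\frac{n-1}2-3$ in $x_i,x_j$ and $n-3$ in the remaining variable; for $P^{(1,2,3)}$, $\frac{n-1}2-3$ in each $x_k$. Moreover $P^{(0)}$, $P^{(1,2,3)}$, $\sum_iy_iP^{(i)}$ and $\sum_{i<j}y_iy_jP^{(i,j)}$ are invariant under permutations of the three points. -/

import Mathlib

open scoped Polynomial Topology
open Filter Asymptotics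

noncomputable section

/-- The data defining a hyperelliptic Riemann surface `y ^ 2 = p x` of genus `g ≥ 1`:
`p` has degree `2g + 1` or `2g + 2` and no multiple zeros. -/
structure HyperellipticSurface where
  g : ℕ
  p : ℂ[X]
  one_le_g : 1 ≤ g
  natDegree_p : p.natDegree = 2 * g + 1 ∨ p.natDegree = 2 * g + 2
  squarefree_p : Squarefree p

namespace HyperellipticSurface

variable (S : HyperellipticSurface)

/-- The degree `n` of `p`. -/
def n : ℕ := S.p.natDegree

/-- The polynomial `q u = u ^ (2g + 2) * p (1 / u)`, which describes the surface near infinity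
as `v ^ 2 = q u`, where `u = 1 / x` and `v = y / x ^ (g + 1)`. -/
def q : ℂ[X] := S.p.reflect (2 * S.g + 2)

/-- The points of the compact surface, obtained by gluing the smooth affine curves
`y ^ 2 = p x` and `v ^ 2 = q u`. There is one point at infinity if the degree of `p` is odd, and
there are two if it is even. -/
inductive Point : Type
  | affine (x y : ℂ) (h : y ^ 2 = S.p.eval x) : Point
  | infinity (v : ℂ) (h : v ^ 2 = S.q.eval 0) : Point

namespace Point

variable {S}

/-- The point lies on the affine curve `y ^ 2 = p x`. -/
def IsFinite : S.Point → Prop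
  | affine _ _ _ => True
  | infinity _ _ => False

/-- The point lies on the affine curve `v ^ 2 = q u`. -/
def IsNonzero : S.Point → Prop
  | affine x _ _ => x ≠ 0
  | infinity _ _ => True

/-- The coordinate function `x` (meaningful at finite points). -/
def x : S.Point → ℂ
  | affine x _ _ => x
  | infinity _ _ => 0

/-- The coordinate function `y` (meaningful at finite points). -/
def y : S.Point → ℂ
  | affine _ y _ => y
  | infinity _ _ => 0

/-- The coordinate function `u = 1 / x` (meaningful at points with `x ≠ 0`). -/
def u : S.Point → ℂ
  | affine x _ _ => x⁻¹
  | infinity _ _ => 0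

/-- The coordinate function `v = y / x ^ (g + 1)` (meaningful at points with `x ≠ 0`). -/
def v : S.Point → ℂ
  | affine x y _ => y / x ^ (S.g + 1)
  | infinity v _ => v

end Point

variable {S} in
/-- A map from the complex plane to the surface is holomorphic at `t`, as seen in one of the two
affine curves that cover the surface. -/
def HolomorphicMapAt (γ : ℂ → S.Point) (t : ℂ) : Prop :=
  ((∀ᶠ s in 𝓝 t, (γ s).IsFinite) ∧
    AnalyticAt ℂ (fun s => (γ s).x) t ∧ AnalyticAt ℂ (fun s => (γ s).y) t) ∨
  ((∀ᶠ s in 𝓝 t, (γ s).IsNonzero) ∧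
    AnalyticAt ℂ (fun s => (γ s).u) t ∧ AnalyticAt ℂ (fun s => (γ s).v) t)

/-- A local coordinate on the surface (a coordinate patch with a complex coordinate on it), given
by its inverse: an injective holomorphic map from an open set of complex numbers to the surface. -/
structure LocalCoordinate where
  domain : Set ℂ
  isOpen_domain : IsOpen domain
  toPoint : ℂ → S.Point
  holomorphic : ∀ t ∈ domain, HolomorphicMapAt toPoint t
  injOn : Set.InjOn toPoint domain

variable {S} in
/-- The coordinate values of `N`-tuples of pairwise distinct points, the `i`-th of which lies in
the `i`-th coordinate patch. -/
def config {N : ℕ} (γ : Fin N → S.LocalCoordinate) : Set (Fin N → ℂ) :=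
  {t | (∀ i, t i ∈ (γ i).domain) ∧ Function.Injective fun i => (γ i).toPoint (t i)}

/-- The points of the affine curve at which `x` is a local coordinate, that is, `y ≠ 0`. -/
@[ext]
structure RegularPoint where
  x : ℂ
  y : ℂ
  eqn : y ^ 2 = S.p.eval x
  y_ne_zero : y ≠ 0

namespace RegularPoint

variable {S}

/-- The Galois conjugate `(x, -y)` of the point `(x, y)`. -/
def conj (z : S.RegularPoint) : S.RegularPoint where
  x := z.x
  y := -z.y
  eqn := by rw [neg_sq]; exact z.eqn
  y_ne_zero := neg_ne_zero.mpr z.y_ne_zero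

/-- The value of `p` at `x`. -/
def p (z : S.RegularPoint) : ℂ := S.p.eval z.x

/-- The value of the derivative of `p` at `x`. -/
def p' (z : S.RegularPoint) : ℂ := S.p.derivative.eval z.x

theorem p_ne_zero (z : S.RegularPoint) : z.p ≠ 0 := by
  unfold p
  rw [← z.eqn]
  exact pow_ne_zero 2 z.y_ne_zero

/-- The holomorphic branch of `y` as a function of `x` around the point `z`. -/
def branch (z : S.RegularPoint) (t : ℂ) : ℂ := z.y * (S.p.eval t / z.p) ^ ((2 : ℕ) : ℂ)⁻¹

theorem branch_sq (z : S.RegularPoint) (t : ℂ) : z.branch t ^ 2 = S.p.eval t := by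
  have h : z.y ^ 2 = z.p := z.eqn
  unfold branch
  rw [mul_pow, Complex.cpow_nat_inv_pow _ two_ne_zero, h, mul_div_cancel₀ _ z.p_ne_zero]

/-- The function `x`, as a local coordinate around the point `z`. -/
def xCoordinate (z : S.RegularPoint) : S.LocalCoordinate where
  domain := {t | S.p.eval t / z.p ∈ Complex.slitPlane}
  isOpen_domain := Complex.isOpen_slitPlane.preimage (by fun_prop)
  toPoint t := Point.affine t (z.branch t) (z.branch_sq t)
  holomorphic := by
    intro t ht
    refine Or.inl ⟨Eventually.of_forall fun _ => trivial, analyticAt_id, ?_⟩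
    have h1 : AnalyticAt ℂ (fun s => S.p.eval s / z.p) t := by
      have : AnalyticAt ℂ (fun s => S.p.eval s) t :=
        (Polynomial.differentiable S.p).analyticAt t
      exact this.div analyticAt_const z.p_ne_zero
    exact analyticAt_const.mul (h1.cpow analyticAt_const ht)
  injOn := by
    intro s _ t _ h
    exact congrArg Point.x h

/-- The filter of neighbourhoods of infinity: `x → ∞` on the surface. -/
def atInfinity : Filter S.RegularPoint := comap x (Bornology.cobounded ℂ)

end RegularPoint

end HyperellipticSurface

/-- The Schwarzian derivative. -/
def schwarzian (h : ℂ → ℂ) (t : ℂ) : ℂ :=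
  iteratedDeriv 3 h t / deriv h t - 3 / 2 * (iteratedDeriv 2 h t / deriv h t) ^ 2

/-- A state on the surface, evaluated on the Virasoro field `T` of central charge `c`: the system
of its `N`-point functions, for all `N` and in all local coordinates. -/
structure VirasoroState (S : HyperellipticSurface) (c : ℂ) where
  /-- `corr N γ t` is the `N`-point function `⟨T ⋯ T⟩`, where the `i`-th field is written in the
  local coordinate `γ i` and evaluated at the value `t i` of this coordinate. -/
  corr : (N : ℕ) → (Fin N → S.LocalCoordinate) → (Fin N → ℂ) → ℂ
  /-- The `N`-point functions are holomorphic away from the partial diagonals. -/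
  holomorphic : ∀ (N : ℕ) (γ : Fin N → S.LocalCoordinate),
    AnalyticOnNhd ℂ (corr N γ) (HyperellipticSurface.config γ)
  /-- The `N`-point functions are symmetric. -/
  symmetric : ∀ (N : ℕ) (γ : Fin N → S.LocalCoordinate) (σ : Equiv.Perm (Fin N)),
    ∀ t ∈ HyperellipticSurface.config γ, corr N (γ ∘ σ) (t ∘ σ) = corr N γ t
  /-- Under a change of coordinates `h`, one has `T = (h') ^ 2 T̂ + c / 12 S(h)`, in each of the
  arguments. -/
  transform : ∀ (N : ℕ) (γ : Fin (N + 1) → S.LocalCoordinate),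
    ∀ t ∈ HyperellipticSurface.config γ,
    ∀ (i : Fin (N + 1)) (δ : S.LocalCoordinate) (h : ℂ → ℂ), AnalyticAt ℂ h (t i) →
      h (t i) ∈ δ.domain → (∀ᶠ s in 𝓝 (t i), δ.toPoint (h s) = (γ i).toPoint s) →
      corr (N + 1) γ t =
        deriv h (t i) ^ 2 *
            corr (N + 1) (Function.update γ i δ) (Function.update t i (h (t i))) +
          c / 12 * schwarzian h (t i) * corr N (i.removeNth γ) (i.removeNth t)
  /-- The Virasoro operator product expansion
  `T(z) T(w) ↦ (c / 2) / (z - w) ^ 4 + (T(z) + T(w)) / (z - w) ^ 2 + Φ(w) + O(z - w)`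
  holds within all `N`-point functions and in every local coordinate. -/
  ope : ∀ (N : ℕ) (δ : S.LocalCoordinate) (γ : Fin N → S.LocalCoordinate) (w : ℂ) (t : Fin N → ℂ),
    (Fin.cons w t : Fin (N + 1) → ℂ) ∈
      HyperellipticSurface.config (Fin.cons δ γ : Fin (N + 1) → S.LocalCoordinate) →
    ∃ Φ : ℂ,
      (fun z : ℂ =>
        corr (N + 2) (Fin.cons δ (Fin.cons δ γ : Fin (N + 1) → S.LocalCoordinate))
            (Fin.cons z (Fin.cons w t : Fin (N + 1) → ℂ)) -
          (c / 2 / (z - w) ^ 4 * corr N γ t +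
            1 / (z - w) ^ 2 *
              (corr (N + 1) (Fin.cons δ γ) (Fin.cons z t) +
                corr (N + 1) (Fin.cons δ γ) (Fin.cons w t)) + Φ))
        =O[𝓝[≠] w] fun z => z - w

namespace VirasoroState

variable {S : HyperellipticSurface} {c : ℂ} (V : VirasoroState S c)

/-- The `N`-point function `⟨T(x₁) ⋯ T(x_N)⟩` in the coordinate `x`, as a function of the points
`(x_i, y_i)` of the curve. -/
def npoint {N : ℕ} (z : Fin N → S.RegularPoint) : ℂ :=
  V.corr N (fun i => (z i).xCoordinate) (fun i => (z i).x)

/-- The zero-point function `⟨1⟩`. -/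
def one : ℂ := V.npoint (N := 0) ![]

/-- The connected one-point function. -/
def conn1 (z₁ : S.RegularPoint) : ℂ := V.one⁻¹ * V.npoint ![z₁]

/-- The connected two-point function. -/
def conn2 (z₁ z₂ : S.RegularPoint) : ℂ :=
  V.one⁻¹ * V.npoint ![z₁, z₂] - V.conn1 z₁ * V.conn1 z₂

/-- The connected three-point function: the sum over all partitions of `{1, 2, 3}` of the products
of the connected functions of the blocks is `⟨1⟩⁻¹ ⟨T(x₁) T(x₂) T(x₃)⟩`. -/
def conn3 (z₁ z₂ z₃ : S.RegularPoint) : ℂ :=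
  V.one⁻¹ * V.npoint ![z₁, z₂, z₃] - V.conn2 z₁ z₂ * V.conn1 z₃ - V.conn2 z₂ z₃ * V.conn1 z₁ -
    V.conn2 z₃ z₁ * V.conn1 z₂ - V.conn1 z₁ * V.conn1 z₂ * V.conn1 z₃

/-- The product `⟨T(x₁) T(x₂) T(x₃)⟩_c p₁ p₂ p₃`. -/
def G3 (z : Fin 3 → S.RegularPoint) : ℂ :=
  V.conn3 (z 0) (z 1) (z 2) * ((z 0).p * (z 1).p * (z 2).p)

/-- The function `P`, defined by `p ⟨T(x)⟩ = (c / 32) (p' ^ 2 / p) ⟨1⟩ + P / 4`. -/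
def P (z : S.RegularPoint) : ℂ :=
  4 * (z.p * V.npoint ![z] - c / 32 * (z.p' ^ 2 / z.p) * V.one)

/-- The square of `(y₁ + y₂) / (x₁ - x₂)`. -/
def f (z₁ z₂ : S.RegularPoint) : ℂ := ((z₁.y + z₂.y) / (z₁.x - z₂.x)) ^ 2

/-- The regular part `⟨[T(x₁) T(x₂)]_reg⟩ p₁ p₂` of the two-point function, defined by
`⟨T(x₁) T(x₂)⟩ p₁ p₂ - ⟨T(x₁)⟩_c ⟨T(x₂)⟩_c ⟨1⟩ p₁ p₂ = (c / 32) f ^ 2 ⟨1⟩`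
`+ (f / 4) (⟨T(x₁)⟩ p₁ - (c / 32) (p₁' ^ 2 / p₁) ⟨1⟩ + ⟨T(x₂)⟩ p₂ - (c / 32) (p₂' ^ 2 / p₂) ⟨1⟩)`
`+ ⟨[T(x₁) T(x₂)]_reg⟩ p₁ p₂`. -/
def reg (z₁ z₂ : S.RegularPoint) : ℂ :=
  V.npoint ![z₁, z₂] * (z₁.p * z₂.p) - V.conn1 z₁ * V.conn1 z₂ * V.one * (z₁.p * z₂.p) -
    c / 32 * f z₁ z₂ ^ 2 * V.one -
    1 / 4 * f z₁ z₂ *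
      (V.npoint ![z₁] * z₁.p - c / 32 * (z₁.p' ^ 2 / z₁.p) * V.one +
        (V.npoint ![z₂] * z₂.p - c / 32 * (z₂.p' ^ 2 / z₂.p) * V.one))

/-- The function `R⁽⁰⁾` of three points. -/
def R0 (z : Fin 3 → S.RegularPoint) : ℂ :=
  c / 64 * f (z 0) (z 1) * f (z 0) (z 2) * f (z 1) (z 2) +
  1 / 64 * f (z 0) (z 1) * f (z 0) (z 2) * (V.one⁻¹ * (V.P (z 1) + V.P (z 2))) +
  1 / 64 * f (z 0) (z 1) * f (z 1) (z 2) * (V.one⁻¹ * (V.P (z 0) + V.P (z 2))) +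
  1 / 64 * f (z 0) (z 2) * f (z 1) (z 2) * (V.one⁻¹ * (V.P (z 0) + V.P (z 1))) +
  1 / 4 * f (z 0) (z 1) *
    (V.one⁻¹ * V.reg (z 0) (z 2) + V.one⁻¹ * V.reg (z 1) (z 2)) +
  1 / 4 * f (z 0) (z 2) *
    (V.one⁻¹ * V.reg (z 0) (z 1) + V.one⁻¹ * V.reg (z 1) (z 2)) +
  1 / 4 * f (z 1) (z 2) *
    (V.one⁻¹ * V.reg (z 0) (z 1) + V.one⁻¹ * V.reg (z 0) (z 2))

end VirasoroState

namespace HyperellipticSurface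

variable {S : HyperellipticSurface}

/-- Three points whose `x`-coordinates are pairwise distinct. -/
def Generic (z : Fin 3 → S.RegularPoint) : Prop := Function.Injective fun i => (z i).x

/-- The value at `x` of the Laurent polynomial with coefficients `h`. -/
def laurentEval (h : ℤ →₀ ℂ) (x : ℂ) : ℂ := h.sum fun m a => a * x ^ m

/-- The Laurent polynomial `h` is the part of order strictly larger than `k` of the function `E`
as `x → ∞`. -/
def IsHighPart (k : ℝ) (E : S.RegularPoint → ℂ) (h : ℤ →₀ ℂ) : Prop :=
  (∀ m ∈ h.support, k < (m : ℝ)) ∧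
    (fun w => E w - laurentEval h w.x) =O[RegularPoint.atInfinity] fun w => ‖w.x‖ ^ k

open Classical in
/-- The part of order strictly larger than `k` of the function `E` as `x → ∞`, if there is one
(it is unique then). -/
def highPart (k : ℝ) (E : S.RegularPoint → ℂ) : ℤ →₀ ℂ :=
  if h : ∃ h, IsHighPart k E h then h.choose else 0

/-- The Galois-even part of `Q` with respect to the `i`-th point, as a function of that point. -/
def evenPart (i : Fin 3) (Q : (Fin 3 → S.RegularPoint) → ℂ) (z : Fin 3 → S.RegularPoint)
    (w : S.RegularPoint) : ℂ :=
  (Q (Function.update z i w) + Q (Function.update z i w.conj)) / 2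

/-- The Galois-odd part of `Q` with respect to the `i`-th point, as a function of that point:
`Q` is the sum of the even part and of `y` times the odd part. -/
def oddPart (i : Fin 3) (Q : (Fin 3 → S.RegularPoint) → ℂ) (z : Fin 3 → S.RegularPoint)
    (w : S.RegularPoint) : ℂ :=
  (Q (Function.update z i w) - Q (Function.update z i w.conj)) / (2 * w.y)

/-- The Galois-even and the Galois-odd part of `Q` with respect to the `i`-th point have parts of
order larger than `n - 3` and `n / 2 - 3`, respectively, as that point tends to infinity. -/
def HasProj (i : Fin 3) (Q : (Fin 3 → S.RegularPoint) → ℂ) : Prop :=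
  ∀ z, Generic z →
    (∃ h, IsHighPart ((S.n : ℝ) - 3) (evenPart i Q z) h) ∧
    (∃ h, IsHighPart ((S.n : ℝ) / 2 - 3) (oddPart i Q z) h)

/-- The projection `Q_i` of `Q`: the part of the Galois-even part of order larger than `n - 3`,
plus `y` times the part of the Galois-odd part of order larger than `n / 2 - 3`. -/
def proj (i : Fin 3) (Q : (Fin 3 → S.RegularPoint) → ℂ) (z : Fin 3 → S.RegularPoint) : ℂ :=
  laurentEval (highPart ((S.n : ℝ) - 3) (evenPart i Q z)) (z i).x +
    (z i).y * laurentEval (highPart ((S.n : ℝ) / 2 - 3) (oddPart i Q z)) (z i).x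

/-- The value of a polynomial in `x₁, x₂, x₃`. -/
def evalX (F : MvPolynomial (Fin 3) ℂ) (z : Fin 3 → S.RegularPoint) : ℂ :=
  MvPolynomial.eval (fun i => (z i).x) F

/-- The value of a polynomial in `x₁, x₂, x₃` (the left variables) and `y₁, y₂, y₃` (the right
ones). -/
def evalXY (F : MvPolynomial (Fin 3 ⊕ Fin 3) ℂ) (z : Fin 3 → S.RegularPoint) : ℂ :=
  MvPolynomial.eval (Sum.elim (fun i => (z i).x) (fun i => (z i).y)) F

/-- The sum, over all sets `s` of `k` indices, of the products of the `y_i` with `i` in `s`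
and of the polynomial `F s`. -/
def galoisSum (F : Finset (Fin 3) → MvPolynomial (Fin 3) ℂ) (k : ℕ)
    (z : Fin 3 → S.RegularPoint) : ℂ :=
  ∑ s ∈ Finset.powersetCard k Finset.univ, (∏ i ∈ s, (z i).y) * evalX (F s) z

end HyperellipticSurface

end

/-! ### Polynomials from growth bounds and removable singularities -/

noncomputable section

/-! Fix all points but the first. As a function of that point a correlation function is a quadratic
differential up to `c / 12` times the Schwarzian derivative times the function with one field fewer.
In the connected two- and three-point functions these anomalies cancel (`isXField_conn2`,
`isXField_conn3`), so both are genuine quadratic differentials. Passing from `x` to a local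
coordinate at a branch point or at infinity then shows that `p` times the field is bounded at the
branch points, and that the field is `O(x ^ (-3))` at infinity when `n` is odd. Multiplication by
`p` gives the estimate at infinity.

In the finite region one compares poles. By the OPE the connected three-point function has only a
double pole as two points collide (`exists_conn3_lift_eq`), its coefficient being a sum of connected
two-point functions. `R0` has the same principal part (`nR_eq`, `double_pole_cancel`); this uses
that `reg` is bounded at coinciding points (`isBigO_nreg_lift`), where the fourth-order pole has to
cancel as well. On the conjugate sheet nothing is singular, since there `y₁ + y₂` vanishes together
with `x₁ - x₂`. Hence `G3 - R0` is bounded near all exceptional points and grows polynomially, and a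
Liouville argument on the curve puts it in the form `F x₁ + y₁ G x₁` (`exists_polynomials`). By
symmetry this holds in each variable, and Lagrange interpolation turns separate into joint
polynomiality (`IsSeparatelyPoly.isPolyFun`).

For odd `n` the estimate at infinity says that every projection of `G3` vanishes (`hasProjTo_G3`).
So the projections of `R0` are minus those of the polynomial `G3 - R0`, where a projection merely
keeps or deletes each monomial. Existence and commutation are then evident, and the formula is
inclusion-exclusion over the three conditions of being high in one variable
(`partialSum_inclusion_exclusion`). The remaining monomials are low in every variable, which is the
degree bound. Averaging the coefficients over the permutations makes the remainder invariant. -/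

/-- Induction on the degree starting from Liouville's theorem: the difference quotient `(E t - E 0)
/ t` is again entire and grows one power slower. -/
theorem Differentiable.exists_polynomial_of_isBigO {D : ℕ} : ∀ {E : ℂ → ℂ}, Differentiable ℂ E →
    E =O[Bornology.cobounded ℂ] (fun t => t ^ D) →
    ∃ A : ℂ[X], A.natDegree ≤ D ∧ ∀ t, E t = A.eval t := by
  induction D with
  | zero =>
    intro E hE hO
    simp only [pow_zero] at hO
    obtain ⟨M, hM⟩ := hO.bound
    have hb : Bornology.IsBounded (Set.range E) := by
      have h1 : Bornology.IsBounded {t | ¬ ‖E t‖ ≤ M * ‖(1 : ℂ)‖} := by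
        rw [Bornology.isBounded_def]
        simpa [Set.compl_def, Filter.Eventually] using hM
      obtain ⟨R, hR⟩ := h1.subset_closedBall 0
      have h2 := ((isCompact_closedBall (0 : ℂ) R).image hE.continuous).isBounded
      obtain ⟨R', hR'⟩ := h2.subset_closedBall 0
      refine (Metric.isBounded_closedBall (x := (0 : ℂ)) (r := max M R')).subset ?_
      rintro _ ⟨t, rfl⟩
      rw [mem_closedBall_zero_iff]
      by_cases ht : ‖E t‖ ≤ M * ‖(1 : ℂ)‖
      · exact le_max_of_le_left (by simpa using ht)
      · exact le_max_of_le_right (by simpa using hR' ⟨t, hR ht, rfl⟩)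
    obtain ⟨c, hc⟩ := hE.exists_const_forall_eq_of_bounded hb
    exact ⟨Polynomial.C c, by simp, by simpa using hc⟩
  | succ D ih =>
    intro E hE hO
    have h1 : Differentiable ℂ (dslope E 0) := by
      rw [← differentiableOn_univ]
      exact (Complex.differentiableOn_dslope univ_mem).2 hE.differentiableOn
    have hne : ∀ᶠ t : ℂ in Bornology.cobounded ℂ, t ≠ 0 := by
      exact Bornology.eventually_ne_cobounded 0
    have h2 : dslope E 0 =O[Bornology.cobounded ℂ] (fun t => t ^ D) := by
      have h3 : (fun t => E t - E 0) =O[Bornology.cobounded ℂ] (fun t => t ^ (D + 1)) := by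
        refine hO.sub ?_
        refine IsBigO.trans (isBigO_const_one ℂ (E 0) _) ?_
        refine IsBigO.of_bound 1 ?_
        filter_upwards [(tendsto_norm_cobounded_atTop (E := ℂ)).eventually_ge_atTop 1] with t ht
        simpa using one_le_pow₀ ht
      have h4 := (isBigO_refl (fun t : ℂ => t⁻¹) (Bornology.cobounded ℂ)).mul h3
      refine h4.congr' ?_ ?_
      · filter_upwards [hne] with t ht
        rw [dslope_of_ne _ ht, slope_def_field]
        field_simp
        ring
      · filter_upwards [hne] with t ht
        field_simp
        ring
    obtain ⟨A, hA, hA'⟩ := ih h1 h2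
    refine ⟨Polynomial.X * A + Polynomial.C (E 0), ?_, fun t => ?_⟩
    · refine (Polynomial.natDegree_add_le _ _).trans (max_le ?_ (by simp))
      refine Polynomial.natDegree_mul_le.trans ?_
      have := Polynomial.natDegree_X_le (R := ℂ)
      omega
    · have := sub_smul_dslope E 0 t
      rw [hA'] at this
      simp only [sub_zero, smul_eq_mul] at this
      simp [this]

/-- A function holomorphic off a finite set, at whose points it has at most removable
singularities, and of polynomial growth, is a polynomial. -/
theorem exists_polynomial_of_finite_removable {D : ℕ} (C : Finset ℂ) : ∀ {E : ℂ → ℂ},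
    (∀ t ∉ C, DifferentiableAt ℂ E t) →
    (∀ a ∈ C, E =o[𝓝[≠] a] fun t => (t - a)⁻¹) →
    E =O[Bornology.cobounded ℂ] (fun t => t ^ D) →
    ∃ A : ℂ[X], A.natDegree ≤ D ∧ ∀ t ∉ C, E t = A.eval t := by
  classical
  induction C using Finset.induction_on with
  | empty =>
    intro E h1 _ h3
    obtain ⟨A, hA, hA'⟩ := Differentiable.exists_polynomial_of_isBigO (fun t => h1 t (by simp)) h3
    exact ⟨A, hA, fun t _ => hA' t⟩
  | insert a C ha ih =>
    intro E h1 h2 h3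
    -- Only the value at `a` is repaired, by the limit there; the other points of `C` are left to
    -- the induction hypothesis.
    set E' := Function.update E a (limUnder (𝓝[≠] a) E) with hE'
    have hev : ∀ t, t ≠ a → E' =ᶠ[𝓝 t] E := by
      intro t ht
      filter_upwards [isOpen_ne.mem_nhds ht] with s hs
      exact Function.update_of_ne hs _ _
    have hd : ∀ t ∉ C, DifferentiableAt ℂ E' t := by
      intro t ht
      by_cases hta : t = a
      · subst hta
        have hU : ((C : Set ℂ)ᶜ) ∈ 𝓝 t :=
          (C.finite_toSet.isClosed.isOpen_compl).mem_nhds (by simpa using ht)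
        refine (Complex.differentiableOn_update_limUnder_of_isLittleO hU ?_ ?_).differentiableAt hU
        · intro s hs
          refine (h1 s ?_).differentiableWithinAt
          simp only [Finset.mem_insert, not_or]
          exact ⟨hs.2, by simpa using hs.1⟩
        · refine (h2 t (by simp)).sub ?_
          refine (isBigO_const_one ℂ (E t) _).trans_isLittleO ?_
          rw [isLittleO_one_left_iff]
          have : Tendsto (fun s => ‖s - t‖) (𝓝[≠] t) (𝓝[>] 0) := tendsto_norm_sub_self_nhdsNE t
          exact this.inv_tendsto_nhdsGT_zero.congr fun s => by simp
      · exact (h1 t (by simp [ht, hta])).congr_of_eventuallyEq (hev t hta)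
    obtain ⟨A, hA, hA'⟩ : ∃ A : ℂ[X], A.natDegree ≤ D ∧ ∀ t ∉ C, E' t = A.eval t := by
      refine ih hd (fun b hb => ?_) (h3.congr' ?_ EventuallyEq.rfl)
      · have hba : b ≠ a := fun h => ha (h ▸ hb)
        exact (h2 b (by simp [hb])).congr' ((hev b hba).symm.filter_mono nhdsWithin_le_nhds)
          EventuallyEq.rfl
      · filter_upwards [Bornology.eventually_ne_cobounded a] with t ht
        exact (Function.update_of_ne ht _ _).symm
    refine ⟨A, hA, fun t ht => ?_⟩
    simp only [Finset.mem_insert, not_or] at ht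
    rw [← hA' t ht.2, hE', Function.update_of_ne ht.1]

/-- Two continuous square roots of the same function that agree at a point where they do not
vanish agree near this point. -/
theorem eventuallyEq_of_sq_eventuallyEq {f g : ℂ → ℂ} {t : ℂ} (hf : ContinuousAt f t)
    (hg : ContinuousAt g t) (h : ∀ᶠ s in 𝓝 t, f s ^ 2 = g s ^ 2) (ht : f t = g t)
    (h0 : f t ≠ 0) : f =ᶠ[𝓝 t] g := by
  have h1 : ∀ᶠ s in 𝓝 t, f s + g s ≠ 0 := by
    refine (hf.add hg).eventually_ne ?_
    rw [Pi.add_apply, ← ht, ← two_mul]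
    exact mul_ne_zero two_ne_zero h0
  filter_upwards [h, h1] with s hs hs'
  have : (f s + g s) * (f s - g s) = 0 := by linear_combination hs
  exact sub_eq_zero.1 ((mul_eq_zero.1 this).resolve_left hs')

/-! ### Sheets, lifts and functions on the affine curve -/

namespace HyperellipticSurface

variable {S : HyperellipticSurface}

theorem p_ne_zero (S : HyperellipticSurface) : S.p ≠ 0 := S.squarefree_p.ne_zero

theorem eval_derivative_ne_zero {a : ℂ} (ha : S.p.eval a = 0) : S.p.derivative.eval a ≠ 0 := by
  have hsep : S.p.Separable := PerfectField.separable_iff_squarefree.2 S.squarefree_p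
  exact hsep.eval₂_derivative_ne_zero (RingHom.id ℂ) ha

namespace RegularPoint

theorem branch_self (z : S.RegularPoint) : z.branch z.x = z.y := by
  have : S.p.eval z.x / z.p = 1 := div_self z.p_ne_zero
  simp [branch, this]

theorem mem_xCoordinate_domain (z : S.RegularPoint) : z.x ∈ z.xCoordinate.domain := by
  have : S.p.eval z.x / z.p = 1 := div_self z.p_ne_zero
  simp [xCoordinate, this]

theorem analyticAt_branch (z : S.RegularPoint) : AnalyticAt ℂ z.branch z.x := by
  have h1 : AnalyticAt ℂ (fun s => S.p.eval s / z.p) z.x :=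
    ((Polynomial.differentiable S.p).analyticAt _).div analyticAt_const z.p_ne_zero
  exact analyticAt_const.mul (h1.cpow analyticAt_const z.mem_xCoordinate_domain)

/-- A regular point over a number that is not a zero of `p`. -/
theorem exists_x_eq {t : ℂ} (ht : S.p.eval t ≠ 0) : ∃ w : S.RegularPoint, w.x = t := by
  obtain ⟨y, hy⟩ := IsAlgClosed.exists_pow_nat_eq (S.p.eval t) (n := 2) (by norm_num)
  exact ⟨⟨t, y, hy, by rintro rfl; exact ht (by simpa using hy.symm)⟩, rfl⟩

theorem eq_or_eq_conj {z w : S.RegularPoint} (h : w.x = z.x) : w = z ∨ w = z.conj := by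
  have : w.y ^ 2 = z.y ^ 2 := by rw [w.eqn, z.eqn, h]
  rcases sq_eq_sq_iff_eq_or_eq_neg.1 this with h' | h'
  · exact Or.inl (RegularPoint.ext h h')
  · exact Or.inr (RegularPoint.ext h h')

@[simp] theorem conj_x (z : S.RegularPoint) : z.conj.x = z.x := rfl
@[simp] theorem conj_y (z : S.RegularPoint) : z.conj.y = -z.y := rfl
@[simp] theorem conj_conj (z : S.RegularPoint) : z.conj.conj = z := by
  ext <;> simp

theorem p_eq (z : S.RegularPoint) : z.p = z.y ^ 2 := z.eqn.symm

/-- The point over `t` on the branch of `z`. -/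
def lift (z : S.RegularPoint) (t : ℂ) : S.RegularPoint :=
  -- No regular point lies over a zero of `p`. The default `z` only makes the lift total; it does
  -- not occur for `t` close to `z.x`.
  if h : S.p.eval t = 0 then z else
    ⟨t, z.branch t, z.branch_sq t, fun h' => h (by rw [← z.branch_sq t, h']; simp)⟩

theorem lift_x {z : S.RegularPoint} {t : ℂ} (h : S.p.eval t ≠ 0) : (z.lift t).x = t := by
  simp [lift, h]

theorem lift_y {z : S.RegularPoint} {t : ℂ} (h : S.p.eval t ≠ 0) :
    (z.lift t).y = z.branch t := by
  simp [lift, h]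

@[simp] theorem lift_self (z : S.RegularPoint) : z.lift z.x = z := by
  ext
  · exact lift_x z.p_ne_zero
  · rw [lift_y z.p_ne_zero, z.branch_self]

theorem eventually_eval_ne_zero (z : S.RegularPoint) : ∀ᶠ t in 𝓝 z.x, S.p.eval t ≠ 0 :=
  S.p.continuous.continuousAt.eventually_ne z.p_ne_zero

theorem lift_x_eventuallyEq (z : S.RegularPoint) : (fun t => (z.lift t).x) =ᶠ[𝓝 z.x] id := by
  filter_upwards [z.eventually_eval_ne_zero] with t ht using lift_x ht

theorem lift_y_eventuallyEq (z : S.RegularPoint) :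
    (fun t => (z.lift t).y) =ᶠ[𝓝 z.x] z.branch := by
  filter_upwards [z.eventually_eval_ne_zero] with t ht using lift_y ht

theorem conj_lift (z : S.RegularPoint) {t : ℂ} (h : S.p.eval t ≠ 0) :
    (z.lift t).conj = z.conj.lift t := by
  ext
  · rw [conj_x, lift_x h, lift_x h]
  · rw [conj_y, lift_y h, lift_y h]
    simp [branch, p]

instance : (atInfinity (S := S)).NeBot := by
  refine comap_neBot fun s hs => ?_
  have h1 : {t | S.p.eval t = 0}.Finite :=
    (S.p.roots.toFinset.finite_toSet).subset fun t ht => by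
      simpa [S.p_ne_zero] using ht
  have h2 : ∀ᶠ t in Bornology.cobounded ℂ, S.p.eval t ≠ 0 := by
    have := h1.isBounded
    rwa [Bornology.isBounded_def] at this
  obtain ⟨t, ht, ht'⟩ := ((show ∀ᶠ t in Bornology.cobounded ℂ, t ∈ s from hs).and h2).exists
  obtain ⟨w, rfl⟩ := exists_x_eq ht'
  exact ⟨w, ht⟩

theorem tendsto_x_atInfinity : Tendsto (x (S := S)) atInfinity (Bornology.cobounded ℂ) :=
  tendsto_comap

theorem eventually_atInfinity {P : ℂ → Prop} (h : ∀ᶠ t in Bornology.cobounded ℂ, P t) :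
    ∀ᶠ w : S.RegularPoint in atInfinity, P w.x :=
  tendsto_x_atInfinity.eventually h

theorem tendsto_conj_atInfinity : Tendsto (conj (S := S)) atInfinity atInfinity :=
  tendsto_comap_iff.2 tendsto_x_atInfinity

/-- The filter of regular points whose `x`-coordinate tends to `a`, without being `a`. -/
def near (a : ℂ) : Filter S.RegularPoint := comap x (𝓝[≠] a)

theorem tendsto_x_near (a : ℂ) : Tendsto (x (S := S)) (near a) (𝓝[≠] a) := tendsto_comap

theorem tendsto_conj_near (a : ℂ) : Tendsto (conj (S := S)) (near a) (near a) :=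
  tendsto_comap_iff.2 (tendsto_x_near a)

/-- The filter `near` sees both sheets, and every regular point over a neighbouring `x` is on the
branch of `z` or on that of its conjugate. -/
theorem isBigO_near_of_lift {Q : S.RegularPoint → ℂ} (z : S.RegularPoint)
    (h : (fun t => Q (z.lift t)) =O[𝓝[≠] z.x] fun _ => (1 : ℂ))
    (h' : (fun t => Q (z.conj.lift t)) =O[𝓝[≠] z.x] fun _ => (1 : ℂ)) :
    Q =O[near z.x] fun _ => (1 : ℂ) := by
  obtain ⟨M, hM⟩ := h.bound
  obtain ⟨M', hM'⟩ := h'.bound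
  refine IsBigO.of_bound (max M M') ?_
  filter_upwards [(tendsto_x_near z.x).eventually (hM.and hM')] with w hw
  simp only [norm_one, mul_one] at hw ⊢
  have hp : S.p.eval w.x ≠ 0 := w.p_ne_zero
  rcases eq_or_eq_conj (z := z.lift w.x) (w := w) (lift_x hp).symm with h | h
  · refine le_max_of_le_left ?_
    rw [h]; exact hw.1
  · refine le_max_of_le_right ?_
    rw [h, conj_lift _ hp]; exact hw.2

theorem finite_eval_eq_zero (S : HyperellipticSurface) : {t | S.p.eval t = 0}.Finite :=
  (S.p.roots.toFinset.finite_toSet).subset fun t ht => by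
    simpa [S.p_ne_zero] using ht

/-- The zeros of `p` are simple, so `(x - a) ^ 2 / p x` tends to `0`. This lets the Galois-odd part
be divided by `y` without losing removability of the singularity at a branch point. -/
theorem tendsto_sub_div_y (a : ℂ) :
    Tendsto (fun w : S.RegularPoint => (w.x - a) / w.y) (near a) (𝓝 0) := by
  have h1 : Tendsto (fun t => (t - a) ^ 2 / S.p.eval t) (𝓝[≠] a) (𝓝 0) := by
    by_cases ha : S.p.eval a = 0
    · have hd : Tendsto (slope (fun t => S.p.eval t) a) (𝓝[≠] a) (𝓝 (S.p.derivative.eval a)) :=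
        (S.p.hasDerivAt a).tendsto_slope
      have h2 : Tendsto (fun t => (t - a) * (slope (fun t => S.p.eval t) a t)⁻¹) (𝓝[≠] a)
          (𝓝 ((a - a) * (S.p.derivative.eval a)⁻¹)) := by
        refine Tendsto.mul ?_ (hd.inv₀ (eval_derivative_ne_zero ha))
        exact (tendsto_nhdsWithin_of_tendsto_nhds tendsto_id).sub_const _
      simp only [sub_self, zero_mul] at h2
      refine h2.congr' ?_
      filter_upwards [self_mem_nhdsWithin] with t ht
      have : t - a ≠ 0 := sub_ne_zero.2 ht
      rw [slope_def_field, ha, sub_zero, inv_div]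
      field_simp
    · have : ContinuousAt (fun t => (t - a) ^ 2 / S.p.eval t) a :=
        ContinuousAt.div (by fun_prop) (by fun_prop) ha
      have h2 := this.tendsto
      simp only [sub_self, ne_eq, OfNat.ofNat_ne_zero, not_false_eq_true, zero_pow,
        zero_div] at h2
      exact tendsto_nhdsWithin_of_tendsto_nhds h2
  have h2 := (h1.comp (tendsto_x_near (S := S) a)).norm.sqrt
  rw [tendsto_zero_iff_norm_tendsto_zero]
  simp only [norm_zero, Real.sqrt_zero] at h2
  refine h2.congr fun w => ?_
  simp only [Function.comp]
  rw [← w.eqn, ← div_pow, norm_pow, Real.sqrt_sq (norm_nonneg _)]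

theorem eventually_one_le_norm_y : ∀ᶠ w : S.RegularPoint in atInfinity, 1 ≤ ‖w.y‖ := by
  have h0 : 0 < S.p.degree := by
    rw [← Polynomial.natDegree_pos_iff_degree_pos]
    have := S.natDegree_p; omega
  have h1 := (S.p.tendsto_norm_atTop h0 (z := fun w : S.RegularPoint => w.x) (l := atInfinity)
    (tendsto_norm_cobounded_atTop.comp tendsto_x_atInfinity))
  filter_upwards [h1.eventually_ge_atTop 1] with w hw
  rw [← w.eqn, norm_pow] at hw
  exact (one_le_sq_iff₀ (norm_nonneg _)).1 hw

/-- A function on the curve that is holomorphic off a finite set, locally bounded and of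
polynomial growth has the form `A x + y B x` with polynomials `A` and `B`. -/
theorem exists_polynomials {D : ℕ} (B : Finset ℂ) {Q : S.RegularPoint → ℂ}
    (hol : ∀ z : S.RegularPoint, z.x ∉ B → AnalyticAt ℂ (fun t => Q (z.lift t)) z.x)
    (bdd : ∀ a, a ∈ B ∨ S.p.eval a = 0 → Q =O[near a] fun _ => (1 : ℂ))
    (growth : Q =O[atInfinity] fun w => w.x ^ D) :
    ∃ F G : ℂ[X], F.natDegree ≤ D ∧ G.natDegree ≤ D ∧
      ∀ w, w.x ∉ B → Q w = F.eval w.x + w.y * G.eval w.x := by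
  classical
  set C : Finset ℂ := B ∪ S.p.roots.toFinset with hC
  have hmem : ∀ {a}, a ∈ C ↔ a ∈ B ∨ S.p.eval a = 0 := by
    intro a; simp [hC, S.p_ne_zero]
  -- A function invariant under conjugation descends to a function of `x` alone, to which the planar
  -- statement applies. It is used for the even part of `Q` and for the odd part divided by `y`.
  have key : ∀ {R : S.RegularPoint → ℂ}, (∀ w, R w.conj = R w) →
      (∀ z : S.RegularPoint, z.x ∉ B → DifferentiableAt ℂ (fun t => R (z.lift t)) z.x) →
      (∀ a ∈ C, R =o[near a] fun w => (w.x - a)⁻¹) →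
      (R =O[atInfinity] fun w => w.x ^ D) →
      ∃ F : ℂ[X], F.natDegree ≤ D ∧ ∀ w, w.x ∉ B → R w = F.eval w.x := by
    intro R hconj hdiff hbdd hgr
    -- The value `0` is chosen where there is no regular point over `t`. Such `t` are zeros of `p`
    -- and lie in `C`.
    have hex : ∀ t, ∃ v : ℂ, ∀ w : S.RegularPoint, w.x = t → R w = v := by
      intro t
      by_cases h : ∃ w : S.RegularPoint, w.x = t
      · obtain ⟨w, rfl⟩ := h
        refine ⟨R w, fun w' hw' => ?_⟩
        rcases eq_or_eq_conj hw' with h | h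
        · rw [h]
        · rw [h, hconj]
      · exact ⟨0, fun w hw => absurd ⟨w, hw⟩ h⟩
    choose E hE using hex
    have hE' : ∀ w, R w = E w.x := fun w => hE _ w rfl
    -- Estimates along the regular points transfer to estimates in the plane, because nearby values
    -- of `x` are all attained by regular points.
    have htr : ∀ {l : Filter ℂ} {g : ℂ → ℂ}, (∀ᶠ t in l, S.p.eval t ≠ 0) →
        ∀ {M : ℝ}, (∀ᶠ w in comap (x (S := S)) l, ‖R w‖ ≤ M * ‖g w.x‖) →
        ∀ᶠ t in l, ‖E t‖ ≤ M * ‖g t‖ := by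
      intro l g hl M hM
      rw [eventually_comap] at hM
      filter_upwards [hM, hl] with t h1 h2
      obtain ⟨w, hw⟩ := exists_x_eq h2
      have := h1 w hw
      rwa [hE', hw] at this
    have hp1 : ∀ a, ∀ᶠ t in 𝓝[≠] a, S.p.eval t ≠ 0 := by
      intro a
      have := ((finite_eval_eq_zero S).subset (Set.sdiff_subset (t := {a}))).isClosed.isOpen_compl.mem_nhds
        (show a ∈ ({t | S.p.eval t = 0} \ {a})ᶜ by simp)
      filter_upwards [nhdsWithin_le_nhds this, self_mem_nhdsWithin] with t ht hta h0
      exact ht ⟨h0, hta⟩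
    have hp2 : ∀ᶠ t in Bornology.cobounded ℂ, S.p.eval t ≠ 0 := by
      have := (finite_eval_eq_zero S).isBounded
      rwa [Bornology.isBounded_def] at this
    obtain ⟨F, hF, hF'⟩ : ∃ F : ℂ[X], F.natDegree ≤ D ∧ ∀ t ∉ C, E t = F.eval t := by
      refine exists_polynomial_of_finite_removable C ?_ ?_ ?_
      · intro t ht
        rw [hmem, not_or] at ht
        obtain ⟨z, rfl⟩ := exists_x_eq ht.2
        refine (hdiff z ht.1).congr_of_eventuallyEq ?_
        filter_upwards [z.eventually_eval_ne_zero] with s hs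
        rw [hE', lift_x hs]
      · intro a ha
        rw [isLittleO_iff]
        intro M hM
        exact htr (hp1 a) ((hbdd a ha).bound hM)
      · obtain ⟨M, hM⟩ := hgr.bound
        exact IsBigO.of_bound M (htr (g := fun t => t ^ D) hp2 hM)
    refine ⟨F, hF, fun w hw => ?_⟩
    rw [hE', hF']
    rw [hmem]
    rintro (h | h)
    · exact hw h
    · exact w.p_ne_zero h
  have hlift : ∀ z : S.RegularPoint, z.x ∉ B →
      DifferentiableAt ℂ (fun t => Q (z.lift t)) z.x ∧
      DifferentiableAt ℂ (fun t => Q (z.lift t).conj) z.x := by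
    intro z hz
    refine ⟨(hol z hz).differentiableAt, ?_⟩
    refine (hol z.conj hz).differentiableAt.congr_of_eventuallyEq ?_
    filter_upwards [z.eventually_eval_ne_zero] with s hs
    rw [conj_lift _ hs]
  obtain ⟨F, hF, hF'⟩ : ∃ F : ℂ[X], F.natDegree ≤ D ∧
      ∀ w : S.RegularPoint, w.x ∉ B → (Q w + Q w.conj) / 2 = F.eval w.x := by
    refine key ?_ ?_ ?_ ?_
    · intro w; simp [add_comm]
    · intro z hz
      exact ((hlift z hz).1.add (hlift z hz).2).div_const 2
    · intro a ha
      have h1 := bdd a (hmem.1 ha)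
      have h2 : (fun w : S.RegularPoint => Q w + Q w.conj) =O[near a] fun _ => (1 : ℂ) :=
        h1.add (h1.comp_tendsto (tendsto_conj_near a))
      have h3 : (fun _ => 1 : S.RegularPoint → ℂ) =o[near a] fun w => (w.x - a)⁻¹ := by
        rw [isLittleO_one_left_iff]
        have : Tendsto (fun s => ‖s - a‖) (𝓝[≠] a) (𝓝[>] 0) := tendsto_norm_sub_self_nhdsNE a
        simpa [Function.comp_def] using this.inv_tendsto_nhdsGT_zero.comp (tendsto_x_near (S := S) a)
      simpa [div_eq_inv_mul] using (h2.const_mul_left (1 / 2)).trans_isLittleO h3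
    · have h2 : (fun w : S.RegularPoint => Q w + Q w.conj) =O[atInfinity] fun w => w.x ^ D :=
        growth.add (growth.comp_tendsto tendsto_conj_atInfinity)
      simpa [div_eq_inv_mul] using h2.const_mul_left (1 / 2)
  obtain ⟨G, hG, hG'⟩ : ∃ F : ℂ[X], F.natDegree ≤ D ∧
      ∀ w : S.RegularPoint, w.x ∉ B → (Q w - Q w.conj) / (2 * w.y) = F.eval w.x := by
    refine key ?_ ?_ ?_ ?_
    · intro w
      have := w.y_ne_zero
      simp only [conj_conj, conj_y]
      field_simp
      ring
    · intro z hz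
      refine ((hlift z hz).1.sub (hlift z hz).2).div ?_ ?_
      · refine (differentiableAt_const _).mul ?_
        exact z.analyticAt_branch.differentiableAt.congr_of_eventuallyEq z.lift_y_eventuallyEq
      · simpa using z.y_ne_zero
    · intro a ha
      have h1 := bdd a (hmem.1 ha)
      have h2 : (fun w : S.RegularPoint => Q w - Q w.conj) =O[near a] fun _ => (1 : ℂ) :=
        h1.sub (h1.comp_tendsto (tendsto_conj_near a))
      -- The odd part divided by `y` may be unbounded at a branch point, but `1 / y` is `o(1 / (x -
      -- a))`, which suffices for removability.
      have h3 := (isLittleO_one_iff ℂ).2 (tendsto_sub_div_y (S := S) a)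
      have h4 := (h3.mul_isBigO h2).const_mul_left (1 / 2)
      have h5 := (isBigO_refl (fun w : S.RegularPoint => (w.x - a)⁻¹) (near a)).mul_isLittleO h4
      refine h5.congr' ?_ (by simp)
      filter_upwards [(tendsto_x_near (S := S) a).eventually self_mem_nhdsWithin] with w hw
      have h0 : w.x - a ≠ 0 := sub_ne_zero.2 hw
      have := w.y_ne_zero
      field_simp
    · have h2 : (fun w : S.RegularPoint => Q w - Q w.conj) =O[atInfinity] fun w => w.x ^ D :=
        growth.sub (growth.comp_tendsto tendsto_conj_atInfinity)
      have h3 : (fun w : S.RegularPoint => (2 * w.y)⁻¹) =O[atInfinity] fun _ => (1 : ℂ) := by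
        refine IsBigO.of_bound 1 ?_
        filter_upwards [eventually_one_le_norm_y (S := S)] with w hw
        rw [norm_inv, norm_mul, norm_one, mul_one]
        refine inv_le_one_of_one_le₀ ?_
        have : ‖(2 : ℂ)‖ = 2 := by simp
        rw [this]; linarith
      simpa [div_eq_mul_inv] using h2.mul h3
  refine ⟨F, G, hF, hG, fun w hw => ?_⟩
  rw [← hF' w hw, ← hG' w hw]
  have := w.y_ne_zero
  field_simp
  ring

end RegularPoint

end HyperellipticSurface

end

/-! ### Schwarzian derivatives of power functions and local square roots -/

noncomputable section

theorem Set.Finite.eventually_notMem_nhdsNE {F : Set ℂ} (hF : F.Finite) (a : ℂ) :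
    ∀ᶠ t in 𝓝[≠] a, t ∉ F := by
  have := (hF.subset (Set.sdiff_subset (t := {a}))).isClosed.isOpen_compl.mem_nhds
    (show a ∈ (F \ {a})ᶜ by simp)
  filter_upwards [nhdsWithin_le_nhds this, self_mem_nhdsWithin] with t ht hta h0
  exact ht ⟨h0, hta⟩

theorem Set.Finite.eventually_notMem_cobounded {F : Set ℂ} (hF : F.Finite) :
    ∀ᶠ t in Bornology.cobounded ℂ, t ∉ F := by
  have := hF.isBounded
  rwa [Bornology.isBounded_def] at this

section Schwarzian

/-- The differential equation makes `h` a multiple of a branch of `(s - a) ^ α`, so `f` behaves like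
the power `α - k`. Working with the equation avoids choosing a branch. -/
theorem deriv_eventuallyEq_of_deriv_eq_mul_div {h f : ℂ → ℂ} {t a α β : ℂ} (k : ℕ)
    (ha : AnalyticAt ℂ h t) (hta : t ≠ a)
    (hd : ∀ᶠ s in 𝓝 t, deriv h s = α * h s / (s - a))
    (hf : ∀ᶠ s in 𝓝 t, f s = β * h s / (s - a) ^ k) :
    ∀ᶠ s in 𝓝 t, deriv f s = β * (α - k) * h s / (s - a) ^ (k + 1) := by
  filter_upwards [ha.eventually_analyticAt, hd, hf.eventually_nhds, isOpen_ne.mem_nhds hta]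
    with s h1 h2 h3 h4
  have h5 : s - a ≠ 0 := sub_ne_zero.2 h4
  have h3' : f =ᶠ[𝓝 s] fun s => β * h s / (s - a) ^ k := h3
  rw [h3'.deriv_eq]
  have h6 : HasDerivAt (fun s => (s - a) ^ k) (k * (s - a) ^ (k - 1) * 1) s :=
    ((hasDerivAt_id s).sub_const a).pow k
  have h7 := (h1.differentiableAt.hasDerivAt.const_mul β).div h6 (pow_ne_zero k h5)
  rw [show (fun s => β * h s / (s - a) ^ k) = (fun s => β * h s) / fun s => (s - a) ^ k from rfl,
    h7.deriv, h2]
  rcases k with _ | k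
  · simp
    field_simp
  · simp only [Nat.add_sub_cancel]
    field_simp
    push_cast
    ring

/-- This is the Schwarzian derivative of `(s - a) ^ α`. The exponents needed are `1 / 2` at a finite
branch point, `-1 / 2` at a branch point at infinity, and `-1` at the two unramified points at
infinity. -/
theorem schwarzian_of_deriv_eq_mul_div {h : ℂ → ℂ} {t a α : ℂ} (ha : AnalyticAt ℂ h t)
    (hta : t ≠ a) (h0 : h t ≠ 0) (hα : α ≠ 0)
    (hd : ∀ᶠ s in 𝓝 t, deriv h s = α * h s / (s - a)) :
    schwarzian h t = (1 - α ^ 2) / (2 * (t - a) ^ 2) := by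
  have h5 : t - a ≠ 0 := sub_ne_zero.2 hta
  have d1 : ∀ᶠ s in 𝓝 t, deriv h s = α * h s / (s - a) ^ 1 := by simpa using hd
  have d2 := deriv_eventuallyEq_of_deriv_eq_mul_div 1 ha hta hd d1
  have d3 := deriv_eventuallyEq_of_deriv_eq_mul_div 2 ha hta hd d2
  have e2 : iteratedDeriv 2 h = deriv (deriv h) := by
    simp [iteratedDeriv_succ, iteratedDeriv_zero]
  have e3 : iteratedDeriv 3 h = deriv (deriv (deriv h)) := by
    simp [iteratedDeriv_succ, iteratedDeriv_zero]
  unfold schwarzian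
  rw [e2, e3, d3.self_of_nhds, d2.self_of_nhds, hd.self_of_nhds]
  push_cast
  field_simp
  ring

theorem schwarzian_id (t : ℂ) : schwarzian id t = 0 := by
  have e : deriv (id : ℂ → ℂ) = fun _ => 1 := funext fun x => deriv_id x
  simp [schwarzian, iteratedDeriv_succ, iteratedDeriv_zero, e]

theorem deriv_eq_mul_div_of_sq {h : ℂ → ℂ} {t a : ℂ} (hd : DifferentiableAt ℂ h t) (hta : t ≠ a)
    (hs : ∀ᶠ s in 𝓝 t, h s ^ 2 = s - a) : deriv h t = 1 / 2 * h t / (t - a) := by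
  have h5 : t - a ≠ 0 := sub_ne_zero.2 hta
  have hs' : (h ^ 2) =ᶠ[𝓝 t] fun s => s - a := hs
  have h1 := hs'.deriv_eq
  have h2 : HasDerivAt (h ^ 2) _ t := hd.hasDerivAt.pow 2
  rw [h2.deriv] at h1
  simp only [deriv_sub_const_fun, deriv_id''] at h1
  have h3 := hs.self_of_nhds
  have h0 : h t ≠ 0 := by
    intro h0; rw [h0] at h3; apply h5; rw [← h3]; simp
  rw [← h3]
  push_cast at h1
  field_simp
  linear_combination h1

theorem deriv_eq_mul_div_of_sq_inv {h : ℂ → ℂ} {t : ℂ} (hd : DifferentiableAt ℂ h t) (ht : t ≠ 0)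
    (hs : ∀ᶠ s in 𝓝 t, h s ^ 2 = s⁻¹) : deriv h t = -1 / 2 * h t / (t - 0) := by
  have hs' : (h ^ 2) =ᶠ[𝓝 t] fun s => s⁻¹ := hs
  have h1 := hs'.deriv_eq
  have h2 : HasDerivAt (h ^ 2) _ t := hd.hasDerivAt.pow 2
  rw [h2.deriv] at h1
  rw [deriv_inv] at h1
  have h3 := hs.self_of_nhds
  have h0 : h t ≠ 0 := by
    intro h0; rw [h0] at h3; apply inv_ne_zero ht; rw [← h3]; simp
  have h4 : t = (h t ^ 2)⁻¹ := by rw [h3, inv_inv]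
  push_cast at h1
  have h6 : deriv h t * 2 * h t = -(h t ^ 2) ^ 2 := by
    rw [h3]
    rw [inv_pow]
    linear_combination h1
  rw [sub_zero]
  have h7 : h t ^ 2 * t = 1 := by rw [h3]; exact inv_mul_cancel₀ ht
  field_simp
  apply mul_left_cancel₀ h0
  linear_combination t * h6 - h t ^ 2 * h7

end Schwarzian

/-- A holomorphic square root of the polynomial `r` near a point `a` with `r a ≠ 0`. -/
def sqrtNear (r : ℂ[X]) (a t : ℂ) : ℂ :=
  (r.eval a) ^ ((2 : ℕ) : ℂ)⁻¹ * (r.eval t / r.eval a) ^ ((2 : ℕ) : ℂ)⁻¹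

theorem sqrtNear_sq {r : ℂ[X]} {a : ℂ} (ha : r.eval a ≠ 0) (t : ℂ) :
    sqrtNear r a t ^ 2 = r.eval t := by
  unfold sqrtNear
  rw [mul_pow, Complex.cpow_nat_inv_pow _ two_ne_zero, Complex.cpow_nat_inv_pow _ two_ne_zero,
    mul_div_cancel₀ _ ha]

theorem analyticAt_sqrtNear {r : ℂ[X]} {a t : ℂ} (ha : r.eval a ≠ 0)
    (ht : r.eval t / r.eval a ∈ Complex.slitPlane) : AnalyticAt ℂ (sqrtNear r a) t := by
  have h1 : AnalyticAt ℂ (fun s => r.eval s / r.eval a) t :=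
    ((Polynomial.differentiable r).analyticAt _).div analyticAt_const ha
  exact analyticAt_const.mul (h1.cpow analyticAt_const ht)

theorem sqrtNear_ne_zero {r : ℂ[X]} {a t : ℂ} (ha : r.eval a ≠ 0)
    (ht : r.eval t / r.eval a ∈ Complex.slitPlane) : sqrtNear r a t ≠ 0 := by
  intro h
  have := sqrtNear_sq ha t
  rw [h] at this
  rw [← this] at ht
  simp at ht

theorem eventually_mem_slitPlane {r : ℂ[X]} {a : ℂ} (ha : r.eval a ≠ 0) :
    ∀ᶠ t in 𝓝 a, r.eval t / r.eval a ∈ Complex.slitPlane := by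
  have h : ContinuousAt (fun t => r.eval t / r.eval a) a := by fun_prop
  refine h.eventually_mem (Complex.isOpen_slitPlane.mem_nhds ?_)
  simp [div_self ha]

/-! ### Fields with a quadratic transformation law, and their behaviour at branch points -/

namespace HyperellipticSurface

variable {S : HyperellipticSurface}

namespace RegularPoint

/-- The point of the surface underlying a regular point. -/
def toPoint (z : S.RegularPoint) : S.Point := Point.affine z.x z.y z.eqn

theorem toPoint_injective : Function.Injective (toPoint (S := S)) := by
  intro z w h
  simp only [toPoint, Point.affine.injEq] at h
  exact RegularPoint.ext h.1 h.2

theorem xCoordinate_toPoint (z : S.RegularPoint) (t : ℂ) :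
    z.xCoordinate.toPoint t = Point.affine t (z.branch t) (z.branch_sq t) := rfl

@[simp] theorem xCoordinate_toPoint_self (z : S.RegularPoint) :
    z.xCoordinate.toPoint z.x = z.toPoint := by
  simp [xCoordinate_toPoint, toPoint, branch_self]

theorem analyticAt_branch_of_mem (z : S.RegularPoint) {t : ℂ} (ht : t ∈ z.xCoordinate.domain) :
    AnalyticAt ℂ z.branch t := by
  have h1 : AnalyticAt ℂ (fun s => S.p.eval s / z.p) t :=
    ((Polynomial.differentiable S.p).analyticAt _).div analyticAt_const z.p_ne_zero
  exact analyticAt_const.mul (h1.cpow analyticAt_const ht)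

theorem eventually_toPoint_notMem_near {Z : Set S.Point} (hZ : Z.Finite) (a : ℂ) :
    ∀ᶠ w : S.RegularPoint in near a, w.toPoint ∉ Z := by
  filter_upwards [(tendsto_x_near (S := S) a).eventually
    ((hZ.image Point.x).eventually_notMem_nhdsNE a)] with w hw h
  exact hw ⟨_, h, rfl⟩

theorem eventually_toPoint_notMem_atInfinity {Z : Set S.Point} (hZ : Z.Finite) :
    ∀ᶠ w : S.RegularPoint in atInfinity, w.toPoint ∉ Z := by
  filter_upwards [eventually_atInfinity (S := S)
    (hZ.image Point.x).eventually_notMem_cobounded] with w hw h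
  exact hw ⟨_, h, rfl⟩

end RegularPoint

open RegularPoint

/-- A field on the surface, holomorphic off the finite set `Z`, which transforms like a quadratic
differential up to `A` times the Schwarzian derivative. -/
structure IsQuadratic (Z : Set S.Point) (A : ℂ) (Ψ : S.LocalCoordinate → ℂ → ℂ) : Prop where
  finite : Z.Finite
  analyticAt : ∀ (δ : S.LocalCoordinate), ∀ t ∈ δ.domain, δ.toPoint t ∉ Z → AnalyticAt ℂ (Ψ δ) t
  transform : ∀ (γ δ : S.LocalCoordinate) (t : ℂ) (h : ℂ → ℂ), t ∈ γ.domain → γ.toPoint t ∉ Z →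
    AnalyticAt ℂ h t → h t ∈ δ.domain → (∀ᶠ s in 𝓝 t, δ.toPoint (h s) = γ.toPoint s) →
    Ψ γ t = deriv h t ^ 2 * Ψ δ (h t) + A * schwarzian h t

/-- A field, written in the coordinate `x`. -/
def atX (Ψ : S.LocalCoordinate → ℂ → ℂ) (w : S.RegularPoint) : ℂ := Ψ w.xCoordinate w.x

namespace IsQuadratic

variable {Z : Set S.Point} {A : ℂ} {Ψ : S.LocalCoordinate → ℂ → ℂ}

theorem add {A' : ℂ} {Ψ' : S.LocalCoordinate → ℂ → ℂ} (hΨ : IsQuadratic Z A Ψ)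
    (hΨ' : IsQuadratic Z A' Ψ') : IsQuadratic Z (A + A') fun δ t => Ψ δ t + Ψ' δ t where
  finite := hΨ.finite
  analyticAt δ t h1 h2 := (hΨ.analyticAt δ t h1 h2).add (hΨ'.analyticAt δ t h1 h2)
  transform γ δ t h h1 h2 h3 h4 h5 := by
    rw [hΨ.transform γ δ t h h1 h2 h3 h4 h5, hΨ'.transform γ δ t h h1 h2 h3 h4 h5]
    ring

theorem const_mul (c : ℂ) (hΨ : IsQuadratic Z A Ψ) :
    IsQuadratic Z (c * A) fun δ t => c * Ψ δ t where
  finite := hΨ.finite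
  analyticAt δ t h1 h2 := analyticAt_const.mul (hΨ.analyticAt δ t h1 h2)
  transform γ δ t h h1 h2 h3 h4 h5 := by
    rw [hΨ.transform γ δ t h h1 h2 h3 h4 h5]
    ring

theorem mono {Z' : Set S.Point} (hΨ : IsQuadratic Z A Ψ) (hZ : Z ⊆ Z') (hf : Z'.Finite) :
    IsQuadratic Z' A Ψ where
  finite := hf
  analyticAt δ t h1 h2 := hΨ.analyticAt δ t h1 fun h => h2 (hZ h)
  transform γ δ t h h1 h2 h3 h4 h5 := hΨ.transform γ δ t h h1 (fun h => h2 (hZ h)) h3 h4 h5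

/-- `atX` uses a different `xCoordinate` at each point, whose branch of `y` is normalised there.
Neighbouring choices differ by the identity change of coordinates, whose Schwarzian vanishes. The
base point itself needs no transformation, hence it may belong to `Z`. -/
theorem atX_lift_eventuallyEq (hΨ : IsQuadratic Z A Ψ) (z : S.RegularPoint) :
    (fun t => atX Ψ (z.lift t)) =ᶠ[𝓝 z.x] Ψ z.xCoordinate := by
  have h1 : ∀ᶠ t in 𝓝 z.x, t ≠ z.x → t ∉ Point.x '' Z :=
    eventually_nhdsWithin_iff.1 ((hΨ.finite.image Point.x).eventually_notMem_nhdsNE z.x)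
  filter_upwards [h1, z.eventually_eval_ne_zero,
    z.xCoordinate.isOpen_domain.mem_nhds z.mem_xCoordinate_domain] with t ht hp hd
  rcases eq_or_ne t z.x with rfl | hne
  · simp [atX]
  have hx : (z.lift t).x = t := lift_x hp
  have h2 : (z.lift t).branch =ᶠ[𝓝 t] z.branch := by
    refine eventuallyEq_of_sq_eventuallyEq ?_ (z.analyticAt_branch_of_mem hd).continuousAt ?_ ?_ ?_
    · have := (z.lift t).analyticAt_branch.continuousAt
      rwa [hx] at this
    · exact Eventually.of_forall fun s => by rw [branch_sq, branch_sq]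
    · have := (z.lift t).branch_self
      rw [hx, lift_y hp] at this
      exact this
    · have h3 := (z.lift t).branch_self
      rw [hx] at h3
      rw [h3]; exact (z.lift t).y_ne_zero
  have := hΨ.transform (z.lift t).xCoordinate z.xCoordinate t id ?_ ?_ analyticAt_id hd ?_
  · simpa [atX, hx, schwarzian_id] using this
  · simpa [hx] using (z.lift t).mem_xCoordinate_domain
  · intro hmem
    exact ht hne ⟨_, hmem, rfl⟩
  · filter_upwards [h2] with s hs
    simp [xCoordinate_toPoint, hs]

theorem analyticAt_atX_lift (hΨ : IsQuadratic Z A Ψ) {z : S.RegularPoint} (hz : z.toPoint ∉ Z) :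
    AnalyticAt ℂ (fun t => atX Ψ (z.lift t)) z.x :=
  (hΨ.analyticAt z.xCoordinate z.x z.mem_xCoordinate_domain (by simpa using hz)).congr
    (hΨ.atX_lift_eventuallyEq z).symm

/-- In a coordinate `δ` around a point outside `Z` the field is bounded. Passing back to `x`
contributes the factor `(h') ^ 2` and the anomaly, both explicit because `h` behaves like a power of
`x - a`. -/
theorem exists_bounded (hΨ : IsQuadratic Z A Ψ) {l : Filter S.RegularPoint}
    (hl : ∀ᶠ w in l, w.toPoint ∉ Z) {δ : S.LocalCoordinate} {s₀ : ℂ} (hs : s₀ ∈ δ.domain)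
    (hs' : δ.toPoint s₀ ∉ Z) {h : S.RegularPoint → ℂ → ℂ} {α a : ℂ} (hα : α ≠ 0)
    (hh : ∀ᶠ w : S.RegularPoint in l, AnalyticAt ℂ (h w) w.x ∧ h w w.x ≠ 0 ∧ w.x ≠ a ∧
      (∀ᶠ s in 𝓝 w.x, δ.toPoint (h w s) = w.xCoordinate.toPoint s) ∧
      (∀ᶠ s in 𝓝 w.x, deriv (h w) s = α * h w s / (s - a)))
    (ht : Tendsto (fun w => h w w.x) l (𝓝 s₀)) :
    ∃ b : S.RegularPoint → ℂ, b =O[l] (fun _ => (1 : ℂ)) ∧ ∀ᶠ w in l,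
      atX Ψ w = α ^ 2 * h w w.x ^ 2 / (w.x - a) ^ 2 * b w +
        A * ((1 - α ^ 2) / (2 * (w.x - a) ^ 2)) := by
  refine ⟨fun w => Ψ δ (h w w.x), ?_, ?_⟩
  · exact ((hΨ.analyticAt δ s₀ hs hs').continuousAt.tendsto.comp ht).isBigO_one ℂ
  · filter_upwards [hh, hl, ht.eventually (δ.isOpen_domain.mem_nhds hs)]
      with w ⟨h1, h2, h3, h4, h5⟩ h6 h7
    have := hΨ.transform w.xCoordinate δ w.x (h w) w.mem_xCoordinate_domain (by simpa using h6)
      h1 h7 h4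
    rw [atX, this, schwarzian_of_deriv_eq_mul_div h1 h3 h2 hα h5, h5.self_of_nhds, div_pow,
      mul_pow]

end IsQuadratic

section Branch

theorem exists_eq_mul {a : ℂ} (ha : S.p.eval a = 0) :
    ∃ r : ℂ[X], S.p = (Polynomial.X - Polynomial.C a) * r ∧ r.eval a ≠ 0 := by
  obtain ⟨r, hr⟩ := Polynomial.dvd_iff_isRoot.2 ha
  refine ⟨r, hr, ?_⟩
  have := eval_derivative_ne_zero ha
  rw [hr] at this
  simpa using this

/-- The local coordinate `s` with `x = a + s ^ 2` around a zero `a` of `p`. -/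
def branchCoordinate {a : ℂ} {r : ℂ[X]} (hr : S.p = (Polynomial.X - Polynomial.C a) * r)
    (hra : r.eval a ≠ 0) : S.LocalCoordinate where
  domain := {s | r.eval (a + s ^ 2) / r.eval a ∈ Complex.slitPlane}
  isOpen_domain := Complex.isOpen_slitPlane.preimage (by fun_prop)
  toPoint s := Point.affine (a + s ^ 2) (s * sqrtNear r a (a + s ^ 2)) (by
    rw [mul_pow, sqrtNear_sq hra, hr]; simp)
  holomorphic := by
    intro s hs
    have h1 : AnalyticAt ℂ (fun s : ℂ => a + s ^ 2) s := by fun_prop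
    refine Or.inl ⟨Eventually.of_forall fun _ => trivial, h1, ?_⟩
    have h2 : AnalyticAt ℂ (sqrtNear r a) (a + s ^ 2) := analyticAt_sqrtNear hra hs
    exact analyticAt_id.mul (AnalyticAt.comp (g := sqrtNear r a) (f := fun s => a + s ^ 2) h2 h1)
  injOn := by
    intro s hs t _ h
    simp only [Point.affine.injEq] at h
    obtain ⟨h1, h2⟩ := h
    rw [h1] at h2
    rw [Set.mem_ofPred_eq, h1] at hs
    exact mul_right_cancel₀ (sqrtNear_ne_zero hra hs) h2

theorem isBigO_one_of_continuousAt {a : ℂ} {g : ℂ → ℂ} (hg : ContinuousAt g a) :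
    (fun w : S.RegularPoint => g w.x) =O[near a] fun _ => (1 : ℂ) :=
  (hg.tendsto.comp ((tendsto_x_near a).mono_right nhdsWithin_le_nhds)).isBigO_one ℂ

/-- In the coordinate `s` with `s ^ 2 = x - a`, the factor `(ds/dx) ^ 2 = 1 / (4 (x - a))` is
compensated by the simple zero of `p`, and the Schwarzian is `3 / 8 / (x - a) ^ 2`. For `A = c / 12`
the subtracted term has the coefficient `c / 32` of the definition of `P`. -/
theorem IsQuadratic.isBigO_near_of_eval_eq_zero {Z : Set S.Point} {A : ℂ}
    {Ψ : S.LocalCoordinate → ℂ → ℂ} (hΨ : IsQuadratic Z A Ψ) {a : ℂ} (ha : S.p.eval a = 0)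
    (hZ : ∀ P ∈ Z, ∃ z : S.RegularPoint, P = z.toPoint) :
    (fun w : S.RegularPoint => w.p * atX Ψ w - 3 / 8 * A * (w.p' ^ 2 / w.p)) =O[near a]
      fun _ => (1 : ℂ) := by
  obtain ⟨r, hr, hra⟩ := exists_eq_mul ha
  have hpe : ∀ s, S.p.eval s = (s - a) * r.eval s := by intro s; rw [hr]; simp
  have hslit : ∀ᶠ w : S.RegularPoint in near a, r.eval w.x / r.eval a ∈ Complex.slitPlane :=
    (tendsto_x_near a).eventually (nhdsWithin_le_nhds (eventually_mem_slitPlane hra))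
  have hsq : ∀ (w : S.RegularPoint) (s : ℂ), r.eval s / r.eval a ∈ Complex.slitPlane →
      (w.branch s / sqrtNear r a s) ^ 2 = s - a := by
    intro w s hs
    have h0 := sqrtNear_ne_zero hra hs
    rw [div_pow, branch_sq, hpe, sqrtNear_sq hra, mul_div_assoc, div_self, mul_one]
    rw [← sqrtNear_sq hra]; exact pow_ne_zero 2 h0
  have hopen : IsOpen {s | r.eval s / r.eval a ∈ Complex.slitPlane} :=
    Complex.isOpen_slitPlane.preimage (by fun_prop)
  have hne : ∀ᶠ w : S.RegularPoint in near a, w.x ≠ a :=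
    (tendsto_x_near a).eventually self_mem_nhdsWithin
  obtain ⟨b, hb, hb'⟩ : ∃ b : S.RegularPoint → ℂ, b =O[near a] (fun _ => (1 : ℂ)) ∧
      ∀ᶠ w in near a, atX Ψ w =
        (1 / 2) ^ 2 * (w.branch w.x / sqrtNear r a w.x) ^ 2 / (w.x - a) ^ 2 * b w +
          A * ((1 - (1 / 2) ^ 2) / (2 * (w.x - a) ^ 2)) := by
    refine hΨ.exists_bounded (eventually_toPoint_notMem_near hΨ.finite a)
      (δ := branchCoordinate hr hra) (s₀ := 0)
      (show r.eval (a + 0 ^ 2) / r.eval a ∈ Complex.slitPlane by simp [div_self hra])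
      -- The centre of the coordinate is the branch point, where `y = 0`, so it cannot be one of the
      -- regular points in `Z`.
      (fun h => by
        obtain ⟨z, hz⟩ := hZ _ h
        have h2 := congrArg Point.y hz
        refine z.y_ne_zero (h2.symm.trans ?_)
        show (0 : ℂ) * _ = 0
        simp)
      (h := fun w s => w.branch s / sqrtNear r a s) (α := 1 / 2) (a := a) (by norm_num) ?_ ?_
    · filter_upwards [hne, hslit] with w h2 h3
      have h4 : w.x - a ≠ 0 := sub_ne_zero.2 h2
      have hev : ∀ᶠ s in 𝓝 w.x, r.eval s / r.eval a ∈ Complex.slitPlane := hopen.mem_nhds h3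
      have han : AnalyticAt ℂ (fun s => w.branch s / sqrtNear r a s) w.x :=
        w.analyticAt_branch.div (analyticAt_sqrtNear hra h3) (sqrtNear_ne_zero hra h3)
      refine ⟨han, ?_, h2, ?_, ?_⟩
      · intro h0
        apply h4
        rw [← hsq w _ h3, h0]; simp
      · filter_upwards [hev] with s hs
        have h5 := hsq w s hs
        have h0 := sqrtNear_ne_zero hra hs
        simp only [branchCoordinate, xCoordinate_toPoint, Point.affine.injEq]
        rw [h5, add_sub_cancel]
        exact ⟨rfl, div_mul_cancel₀ _ h0⟩
      · filter_upwards [hev.eventually_nhds, isOpen_ne.mem_nhds h2, han.eventually_analyticAt]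
          with s hs hsa hsan
        refine deriv_eq_mul_div_of_sq hsan.differentiableAt hsa ?_
        filter_upwards [hs] with s' hs' using hsq w s' hs'
    · rw [tendsto_zero_iff_norm_tendsto_zero]
      have h1 : Tendsto (fun w : S.RegularPoint => Real.sqrt ‖w.x - a‖) (near a)
          (𝓝 (Real.sqrt ‖a - a‖)) := by
        refine (Tendsto.norm ?_).sqrt
        exact ((tendsto_x_near a).mono_right nhdsWithin_le_nhds).sub_const a
      simp only [sub_self, norm_zero, Real.sqrt_zero] at h1
      refine h1.congr' ?_
      filter_upwards [hslit] with w h3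
      rw [← hsq w _ h3, norm_pow, Real.sqrt_sq (norm_nonneg _)]
  have hA : (fun w : S.RegularPoint => r.eval w.x * b w) =O[near a] fun _ => (1 : ℂ) := by
    simpa using (isBigO_one_of_continuousAt (S := S) (a := a) r.continuous.continuousAt).mul hb
  -- This is `p' ^ 2 / p - p / (x - a) ^ 2`: both terms have the polar part `r / (x - a)`, which
  -- cancels.
  have hB : (fun w : S.RegularPoint => 2 * r.derivative.eval w.x +
      (w.x - a) * r.derivative.eval w.x ^ 2 / r.eval w.x) =O[near a] fun _ => (1 : ℂ) := by
    refine isBigO_one_of_continuousAt (S := S) (a := a)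
      (g := fun t => 2 * r.derivative.eval t + (t - a) * r.derivative.eval t ^ 2 / r.eval t) ?_
    exact ContinuousAt.add (by fun_prop) (ContinuousAt.div (by fun_prop) (by fun_prop) hra)
  refine ((hA.const_mul_left (1 / 4)).sub (hB.const_mul_left (3 / 8 * A))).congr' ?_
    EventuallyEq.rfl
  filter_upwards [hb', hne, hslit] with w h1 h2 h3
  have h4 : w.x - a ≠ 0 := sub_ne_zero.2 h2
  have h5 : r.eval w.x ≠ 0 := by
    rw [← sqrtNear_sq hra]; exact pow_ne_zero 2 (sqrtNear_ne_zero hra h3)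
  have h6 : w.p = (w.x - a) * r.eval w.x := hpe w.x
  have h7 : w.p' = r.eval w.x + (w.x - a) * r.derivative.eval w.x := by
    rw [p', hr]; simp
  rw [h1, hsq w _ h3, h6, h7]
  field_simp
  ring

end Branch

end HyperellipticSurface

end

/-! ### The surface near infinity, and the decay of fields there -/

noncomputable section

namespace HyperellipticSurface

variable {S : HyperellipticSurface}

open RegularPoint

theorem natDegree_p_le (S : HyperellipticSurface) : S.p.natDegree ≤ 2 * S.g + 2 := by
  have := S.natDegree_p; omega

theorem eval_q {u : ℂ} (hu : u ≠ 0) : S.q.eval u = u ^ (2 * S.g + 2) * S.p.eval u⁻¹ := by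
  have hinv : u⁻¹ ≠ 0 := inv_ne_zero hu
  let _ : Invertible u⁻¹ := invertibleOfNonzero hinv
  have h := Polynomial.eval₂_reflect_mul_pow (RingHom.id ℂ) u⁻¹ (2 * S.g + 2) S.p S.natDegree_p_le
  have h1 : ⅟(u⁻¹) = u := by simp [invOf_eq_inv]
  rw [h1] at h
  change S.q.eval u * u⁻¹ ^ (2 * S.g + 2) = S.p.eval u⁻¹ at h
  rw [← h, inv_pow, mul_comm, mul_assoc, inv_mul_cancel₀ (pow_ne_zero _ hu), mul_one]

theorem eval_p_div_sq {s : ℂ} (hs : s ≠ 0) :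
    S.p.eval s / (s ^ (S.g + 1)) ^ 2 = S.q.eval s⁻¹ := by
  rw [eval_q (inv_ne_zero hs), inv_inv, inv_pow, ← pow_mul,
    show (S.g + 1) * 2 = 2 * S.g + 2 by ring, div_eq_inv_mul]

theorem eval_zero_q : S.q.eval 0 = S.p.coeff (2 * S.g + 2) := by
  rw [← Polynomial.coeff_zero_eq_eval_zero, q, Polynomial.coeff_reflect]
  simp [Polynomial.revAt_le]

theorem coeff_one_q : S.q.coeff 1 = S.p.coeff (2 * S.g + 1) := by
  rw [q, Polynomial.coeff_reflect]
  rw [Polynomial.revAt_le (by omega)]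
  rfl

theorem eval_zero_q_of_odd (hn : S.p.natDegree = 2 * S.g + 1) : S.q.eval 0 = 0 := by
  rw [eval_zero_q, Polynomial.coeff_eq_zero_of_natDegree_lt]; omega

theorem coeff_one_q_of_odd (hn : S.p.natDegree = 2 * S.g + 1) : S.q.coeff 1 ≠ 0 := by
  rw [coeff_one_q, ← hn]
  exact Polynomial.leadingCoeff_ne_zero.2 S.p_ne_zero

theorem eval_zero_q_of_even (hn : S.p.natDegree = 2 * S.g + 2) : S.q.eval 0 ≠ 0 := by
  rw [eval_zero_q, ← hn]
  exact Polynomial.leadingCoeff_ne_zero.2 S.p_ne_zero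

/-- The point with coordinates `(u, v)` on the affine curve `v ^ 2 = q u`. -/
def Point.ofUV (u v : ℂ) (h : v ^ 2 = S.q.eval u) : S.Point :=
  if hu : u = 0 then Point.infinity v (by rw [h, hu])
  else Point.affine u⁻¹ (v / u ^ (S.g + 1)) (by
    rw [div_pow, h, eval_q hu, ← pow_mul, show (S.g + 1) * 2 = 2 * S.g + 2 by ring,
      mul_div_cancel_left₀ _ (pow_ne_zero _ hu)])

theorem Point.ofUV_isNonzero (u v : ℂ) (h : v ^ 2 = S.q.eval u) : (ofUV u v h).IsNonzero := by
  unfold ofUV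
  split_ifs with hu
  · trivial
  · exact inv_ne_zero hu

theorem Point.u_ofUV (u v : ℂ) (h : v ^ 2 = S.q.eval u) : (ofUV u v h).u = u := by
  unfold ofUV
  split_ifs with hu
  · exact hu.symm
  · exact inv_inv u

theorem Point.v_ofUV (u v : ℂ) (h : v ^ 2 = S.q.eval u) : (ofUV u v h).v = v := by
  unfold ofUV
  split_ifs with hu
  · rfl
  · show v / u ^ (S.g + 1) / u⁻¹ ^ (S.g + 1) = v
    rw [inv_pow, div_inv_eq_mul, div_mul_cancel₀ _ (pow_ne_zero _ hu)]

theorem Point.ofUV_eq_affine {u v x y : ℂ} (h : v ^ 2 = S.q.eval u) (h' : y ^ 2 = S.p.eval x)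
    (hx : x ≠ 0) (hu : u = x⁻¹) (hv : v = y / x ^ (S.g + 1)) : ofUV u v h = affine x y h' := by
  subst hu hv
  unfold ofUV
  rw [dif_neg (inv_ne_zero hx)]
  simp only [affine.injEq, inv_inv, true_and]
  rw [inv_pow, div_inv_eq_mul, div_mul_cancel₀ _ (pow_ne_zero _ hx)]

/-- A local coordinate on the affine curve `v ^ 2 = q u`. -/
def uvCoordinate (D : Set ℂ) (hD : IsOpen D) (U W : ℂ → ℂ) (h : ∀ s, W s ^ 2 = S.q.eval (U s))
    (hU : ∀ s ∈ D, AnalyticAt ℂ U s) (hW : ∀ s ∈ D, AnalyticAt ℂ W s)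
    (hinj : ∀ s ∈ D, ∀ t ∈ D, U s = U t → W s = W t → s = t) : S.LocalCoordinate where
  domain := D
  isOpen_domain := hD
  toPoint s := Point.ofUV (U s) (W s) (h s)
  holomorphic := by
    intro t ht
    refine Or.inr ⟨Eventually.of_forall fun s => Point.ofUV_isNonzero _ _ _, ?_, ?_⟩
    · simpa only [Point.u_ofUV] using hU t ht
    · simpa only [Point.v_ofUV] using hW t ht
  injOn := by
    intro s hs t ht hst
    refine hinj s hs t ht ?_ ?_
    · simpa only [Point.u_ofUV] using congrArg Point.u hst
    · simpa only [Point.v_ofUV] using congrArg Point.v hst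

theorem tendsto_inv_x_atInfinity :
    Tendsto (fun w : S.RegularPoint => w.x⁻¹) atInfinity (𝓝 0) :=
  (tendsto_inv₀_cobounded (α := ℂ)).comp tendsto_x_atInfinity

theorem eventually_x_ne_zero : ∀ᶠ w : S.RegularPoint in atInfinity, w.x ≠ 0 :=
  eventually_atInfinity (Bornology.eventually_ne_cobounded 0)

theorem infinity_ne_toPoint (z : S.RegularPoint) {u v : ℂ} (h : v ^ 2 = S.q.eval u) (hu : u = 0) :
    Point.ofUV u v h ≠ z.toPoint := by
  subst hu
  simp [Point.ofUV, toPoint]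

/-- For odd degree `q u = u * r u` with `r 0 ≠ 0`, so `s = v / √(r u)` is a coordinate at the single
point at infinity and `s ^ 2 = 1 / x`. With exponent `-1 / 2` the square of `ds/dx` is `x ^ (-3) /
4`, and the Schwarzian is `3 / 8 * x ^ (-2)`. -/
theorem IsQuadratic.exists_bounded_atInfinity_of_odd {Z : Set S.Point} {A : ℂ}
    {Ψ : S.LocalCoordinate → ℂ → ℂ} (hΨ : IsQuadratic Z A Ψ) (hn : S.p.natDegree = 2 * S.g + 1)
    (hZ : ∀ P ∈ Z, ∃ z : S.RegularPoint, P = z.toPoint) :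
    ∃ b : S.RegularPoint → ℂ, b =O[atInfinity] (fun _ => (1 : ℂ)) ∧
      ∀ᶠ w in atInfinity, atX Ψ w = 1 / 4 * w.x⁻¹ ^ 3 * b w + A * (3 / 8 * w.x⁻¹ ^ 2) := by
  set r : ℂ[X] := S.q.divX with hr
  have hqe : ∀ u, S.q.eval u = u * r.eval u := by
    intro u
    have h1 := congrArg (Polynomial.eval u) (Polynomial.divX_mul_X_add S.q)
    have h2 : S.q.coeff 0 = 0 := by
      rw [Polynomial.coeff_zero_eq_eval_zero, eval_zero_q_of_odd hn]
    simp only [h2, Polynomial.eval_mul, Polynomial.eval_X, map_zero, add_zero] at h1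
    rw [← h1, mul_comm]
  have hra : r.eval 0 ≠ 0 := by
    rw [← Polynomial.coeff_zero_eq_eval_zero, hr, Polynomial.coeff_divX]
    exact coeff_one_q_of_odd hn
  have hev0 := eventually_mem_slitPlane hra
  have hslit : ∀ᶠ w : S.RegularPoint in atInfinity,
      r.eval w.x⁻¹ / r.eval 0 ∈ Complex.slitPlane :=
    tendsto_inv_x_atInfinity.eventually hev0
  have hsq : ∀ (w : S.RegularPoint) (s : ℂ), s ≠ 0 → r.eval s⁻¹ / r.eval 0 ∈ Complex.slitPlane →
      (w.branch s / s ^ (S.g + 1) / sqrtNear r 0 s⁻¹) ^ 2 = s⁻¹ := by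
    intro w s hs0 hs
    have h0 := sqrtNear_ne_zero hra hs
    have h2 : r.eval s⁻¹ ≠ 0 := by rw [← sqrtNear_sq hra]; exact pow_ne_zero 2 h0
    rw [div_pow, div_pow, branch_sq, sqrtNear_sq hra, div_eq_iff h2, eval_p_div_sq hs0, hqe]
  have hopen : IsOpen {s : ℂ | r.eval s / r.eval 0 ∈ Complex.slitPlane} :=
    Complex.isOpen_slitPlane.preimage (by fun_prop)
  have hUW : ∀ s : ℂ, (s * sqrtNear r 0 (s ^ 2)) ^ 2 = S.q.eval (s ^ 2) := fun s => by
    rw [mul_pow, sqrtNear_sq hra, hqe]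
  let δ : S.LocalCoordinate := uvCoordinate
    {s : ℂ | r.eval (s ^ 2) / r.eval 0 ∈ Complex.slitPlane}
    (Complex.isOpen_slitPlane.preimage (by fun_prop))
    (fun s => s ^ 2) (fun s => s * sqrtNear r 0 (s ^ 2))
    hUW
    (fun s _ => by fun_prop)
    (fun s hs => analyticAt_id.mul (AnalyticAt.comp (g := sqrtNear r 0) (f := fun s => s ^ 2)
      (analyticAt_sqrtNear hra hs) (by fun_prop)))
    (fun s hs t _ h1 h2 => by
      rw [h1] at h2
      rw [Set.mem_ofPred_eq, h1] at hs
      exact mul_right_cancel₀ (sqrtNear_ne_zero hra hs) h2)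
  obtain ⟨b, hb, hb'⟩ : ∃ b : S.RegularPoint → ℂ, b =O[atInfinity] (fun _ => (1 : ℂ)) ∧
      ∀ᶠ w in atInfinity, atX Ψ w =
        (-1 / 2) ^ 2 * (w.branch w.x / w.x ^ (S.g + 1) / sqrtNear r 0 w.x⁻¹) ^ 2 /
          (w.x - 0) ^ 2 * b w + A * ((1 - (-1 / 2) ^ 2) / (2 * (w.x - 0) ^ 2)) := by
    refine hΨ.exists_bounded (eventually_toPoint_notMem_atInfinity hΨ.finite)
      (δ := δ) (s₀ := 0)
      (show r.eval (0 ^ 2) / r.eval 0 ∈ Complex.slitPlane by simp [div_self hra])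
      (fun h => by
        obtain ⟨z, hz⟩ := hZ _ h
        exact infinity_ne_toPoint z (hUW 0) (by simp) hz)
      (h := fun w s => w.branch s / s ^ (S.g + 1) / sqrtNear r 0 s⁻¹) (by norm_num) ?_ ?_
    · filter_upwards [eventually_x_ne_zero, hslit] with w h2 h3
      have hev : ∀ᶠ s in 𝓝 w.x, r.eval s⁻¹ / r.eval 0 ∈ Complex.slitPlane :=
        (continuousAt_inv₀ h2).eventually (hopen.mem_nhds h3)
      have hne : ∀ᶠ s in 𝓝 w.x, s ≠ 0 := isOpen_ne.mem_nhds h2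
      have han : AnalyticAt ℂ (fun s => w.branch s / s ^ (S.g + 1) / sqrtNear r 0 s⁻¹) w.x := by
        refine (w.analyticAt_branch.div (analyticAt_id.pow _) (pow_ne_zero _ h2)).div ?_
          (sqrtNear_ne_zero hra h3)
        exact AnalyticAt.comp (g := sqrtNear r 0) (f := fun s => s⁻¹)
          (analyticAt_sqrtNear hra h3) (analyticAt_inv h2)
      refine ⟨han, ?_, h2, ?_, ?_⟩
      · intro h0
        apply inv_ne_zero h2
        rw [← hsq w _ h2 h3, h0]; simp
      · filter_upwards [hev, hne] with s hs hs0
        have h5 := hsq w s hs0 hs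
        have h0 := sqrtNear_ne_zero hra hs
        refine Point.ofUV_eq_affine (hUW _) (w.branch_sq s) hs0 h5 ?_
        rw [h5, div_mul_cancel₀ _ h0]
      · filter_upwards [hev.eventually_nhds, hne.eventually_nhds, han.eventually_analyticAt]
          with s hs hs0 hsan
        refine deriv_eq_mul_div_of_sq_inv hsan.differentiableAt hs0.self_of_nhds ?_
        filter_upwards [hs, hs0] with s' h1 h2 using hsq w s' h2 h1
    · rw [tendsto_zero_iff_norm_tendsto_zero]
      have h1 := (tendsto_inv_x_atInfinity (S := S)).norm.sqrt
      simp only [norm_zero, Real.sqrt_zero] at h1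
      refine h1.congr' ?_
      filter_upwards [hslit, eventually_x_ne_zero] with w h3 h2
      have h4 := congrArg norm (hsq w _ h2 h3)
      rw [norm_pow] at h4
      rw [← h4, Real.sqrt_sq (norm_nonneg _)]
  refine ⟨b, hb, ?_⟩
  filter_upwards [hb', hslit, eventually_x_ne_zero] with w h1 h2 h3
  rw [h1, hsq w _ h3 h2]
  field_simp
  ring

/-- For even degree `u = 1 / x` is itself a coordinate at each of the two points at infinity, and
its Schwarzian in `x` is zero. The field decays like `x ^ (-4)`; the weaker bound stated is all that
is needed. -/
theorem IsQuadratic.exists_bounded_atInfinity_of_even {Z : Set S.Point} {A : ℂ}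
    {Ψ : S.LocalCoordinate → ℂ → ℂ} (hΨ : IsQuadratic Z A Ψ) (hn : S.p.natDegree = 2 * S.g + 2)
    (hZ : ∀ P ∈ Z, ∃ z : S.RegularPoint, P = z.toPoint) :
    (fun w => atX Ψ w) =O[atInfinity] fun w => w.x⁻¹ ^ 2 := by
  have hra : S.q.eval 0 ≠ 0 := eval_zero_q_of_even hn
  have hev0 := eventually_mem_slitPlane hra
  have hslit : ∀ᶠ w : S.RegularPoint in atInfinity,
      S.q.eval w.x⁻¹ / S.q.eval 0 ∈ Complex.slitPlane :=
    tendsto_inv_x_atInfinity.eventually hev0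
  have hopen : IsOpen {s : ℂ | S.q.eval s / S.q.eval 0 ∈ Complex.slitPlane} :=
    Complex.isOpen_slitPlane.preimage (by fun_prop)
  -- The sign `ε` singles out one of the two sheets at infinity by comparing `v = y / x ^ (g + 1)`
  -- with a fixed square root of `q (1 / x)`. The two restricted filters cover `atInfinity`.
  have key : ∀ ε : ℂ, ε ^ 2 = 1 → (fun w => atX Ψ w)
      =O[atInfinity ⊓ 𝓟 {w | w.y / w.x ^ (S.g + 1) = ε * sqrtNear S.q 0 w.x⁻¹}]
      fun w => w.x⁻¹ ^ 2 := by
    intro ε hε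
    set l := atInfinity ⊓ 𝓟 {w : S.RegularPoint | w.y / w.x ^ (S.g + 1) =
      ε * sqrtNear S.q 0 w.x⁻¹} with hl
    have hle : l ≤ atInfinity := inf_le_left
    have hUW : ∀ s : ℂ, (ε * sqrtNear S.q 0 s) ^ 2 = S.q.eval s := fun s => by
      rw [mul_pow, sqrtNear_sq hra, hε, one_mul]
    let δ : S.LocalCoordinate := uvCoordinate
      {s : ℂ | S.q.eval s / S.q.eval 0 ∈ Complex.slitPlane} hopen
      (fun s => s) (fun s => ε * sqrtNear S.q 0 s)
      hUW
      (fun s _ => by fun_prop)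
      (fun s hs => analyticAt_const.mul (analyticAt_sqrtNear hra hs))
      (fun s _ t _ h1 _ => h1)
    obtain ⟨b, hb, hb'⟩ : ∃ b : S.RegularPoint → ℂ, b =O[l] (fun _ => (1 : ℂ)) ∧
        ∀ᶠ w in l, atX Ψ w =
          (-1) ^ 2 * w.x⁻¹ ^ 2 /
            (w.x - 0) ^ 2 * b w + A * ((1 - (-1) ^ 2) / (2 * (w.x - 0) ^ 2)) := by
      refine hΨ.exists_bounded ((eventually_toPoint_notMem_atInfinity hΨ.finite).filter_mono hle)
        (δ := δ) (s₀ := 0)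
        (show S.q.eval 0 / S.q.eval 0 ∈ Complex.slitPlane by simp [div_self hra])
        (fun h => by
          obtain ⟨z, hz⟩ := hZ _ h
          exact infinity_ne_toPoint z (hUW 0) rfl hz)
        (h := fun w s => s⁻¹) (by norm_num) ?_ (tendsto_inv_x_atInfinity.mono_left hle)
      have hmem : ∀ᶠ w : S.RegularPoint in l,
          w.y / w.x ^ (S.g + 1) = ε * sqrtNear S.q 0 w.x⁻¹ := by
        rw [hl]; exact mem_inf_of_right (mem_principal_self _)
      filter_upwards [hle eventually_x_ne_zero, hle hslit, hmem] with w h2 h3 h4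
      have h2' : w.x ≠ 0 := h2
      refine ⟨analyticAt_inv h2, inv_ne_zero h2, h2, ?_, ?_⟩
      · have hne : ∀ᶠ s in 𝓝 w.x, s ≠ 0 := isOpen_ne.mem_nhds h2
        -- Both sides are continuous square roots of `q (1 / s)` that agree at `w.x`, so the
        -- coordinate of the sheet `ε` parametrises the branch through `w`.
        have h5 : (fun s => w.branch s / s ^ (S.g + 1)) =ᶠ[𝓝 w.x]
            fun s => ε * sqrtNear S.q 0 s⁻¹ := by
          refine eventuallyEq_of_sq_eventuallyEq ?_ ?_ ?_ ?_ ?_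
          · exact w.analyticAt_branch.continuousAt.div (by fun_prop) (pow_ne_zero _ h2)
          · refine continuousAt_const.mul ?_
            exact ContinuousAt.comp (g := sqrtNear S.q 0) (f := fun s => s⁻¹)
              (analyticAt_sqrtNear hra h3).continuousAt (continuousAt_inv₀ h2)
          · filter_upwards [hne] with s hs
            rw [mul_pow, sqrtNear_sq hra, hε, one_mul, div_pow, branch_sq, eval_p_div_sq hs]
          · rw [branch_self]; exact h4
          · rw [branch_self]; exact div_ne_zero w.y_ne_zero (pow_ne_zero _ h2)
        filter_upwards [hne, h5] with s hs h6
        exact Point.ofUV_eq_affine (hUW _) (w.branch_sq s) hs rfl h6.symm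
      · have hne : ∀ᶠ s in 𝓝 w.x, s ≠ 0 := isOpen_ne.mem_nhds h2
        filter_upwards [hne] with s hs
        rw [deriv_inv]
        field_simp
        simp
    have h1 : (fun w : S.RegularPoint => w.x⁻¹ ^ 2) =O[l] fun _ => (1 : ℂ) := by
      have := ((tendsto_inv_x_atInfinity (S := S)).pow 2).mono_left hle
      exact this.isBigO_one ℂ
    have h2 := (isBigO_refl (fun w : S.RegularPoint => w.x⁻¹ ^ 2) l).mul (h1.mul hb)
    refine h2.congr' ?_ ?_
    · filter_upwards [hb'] with w hw
      rw [hw]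
      simp [div_eq_mul_inv]
      ring
    · simp
  have hsup : (atInfinity : Filter S.RegularPoint) ≤
      (atInfinity ⊓ 𝓟 {w | w.y / w.x ^ (S.g + 1) = 1 * sqrtNear S.q 0 w.x⁻¹}) ⊔
      (atInfinity ⊓ 𝓟 {w | w.y / w.x ^ (S.g + 1) = -1 * sqrtNear S.q 0 w.x⁻¹}) := by
    rw [← inf_sup_left, le_inf_iff]
    refine ⟨le_rfl, ?_⟩
    rw [sup_principal, le_principal_iff]
    filter_upwards [eventually_x_ne_zero] with w hw
    have h1 : (w.y / w.x ^ (S.g + 1)) ^ 2 = sqrtNear S.q 0 w.x⁻¹ ^ 2 := by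
      rw [sqrtNear_sq hra, div_pow, w.eqn, eval_p_div_sq hw]
    rcases sq_eq_sq_iff_eq_or_eq_neg.1 h1 with h | h
    · left; simpa using h
    · right; simpa using h
  exact ((key 1 (by norm_num)).sup (key (-1) (by norm_num))).mono hsup

theorem isBigO_inv_x (k : ℕ) : (fun w : S.RegularPoint => w.x⁻¹ ^ k) =O[atInfinity]
    fun _ => (1 : ℂ) :=
  ((tendsto_inv_x_atInfinity (S := S)).pow k).isBigO_one ℂ

theorem IsQuadratic.isBigO_atInfinity {Z : Set S.Point} {A : ℂ}
    {Ψ : S.LocalCoordinate → ℂ → ℂ} (hΨ : IsQuadratic Z A Ψ)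
    (hZ : ∀ P ∈ Z, ∃ z : S.RegularPoint, P = z.toPoint) :
    (fun w => atX Ψ w) =O[atInfinity] fun _ => (1 : ℂ) := by
  rcases S.natDegree_p with hn | hn
  · obtain ⟨b, hb, hb'⟩ := hΨ.exists_bounded_atInfinity_of_odd hn hZ
    have h1 := ((((isBigO_inv_x (S := S) 3).mul hb).const_mul_left (1 / 4)).add
      (((isBigO_inv_x (S := S) 2).const_mul_left (A * (3 / 8))).congr_right (g₂ := fun _ => 1 * 1)
        (by simp)))
    refine h1.congr' ?_ (by simp)
    filter_upwards [hb'] with w hw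
    rw [hw]; ring
  · exact (hΨ.exists_bounded_atInfinity_of_even hn hZ).trans (isBigO_inv_x 2)

/-- Without anomaly the `x ^ (-2)` term disappears; the better decay is the source of the exponent
`n - 3`. -/
theorem IsQuadratic.isBigO_atInfinity_of_odd {Z : Set S.Point}
    {Ψ : S.LocalCoordinate → ℂ → ℂ} (hΨ : IsQuadratic Z 0 Ψ) (hn : S.p.natDegree = 2 * S.g + 1)
    (hZ : ∀ P ∈ Z, ∃ z : S.RegularPoint, P = z.toPoint) :
    (fun w => atX Ψ w) =O[atInfinity] fun w => w.x⁻¹ ^ 3 := by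
  obtain ⟨b, hb, hb'⟩ := hΨ.exists_bounded_atInfinity_of_odd hn hZ
  have h1 := (((isBigO_refl (fun w : S.RegularPoint => w.x⁻¹ ^ 3) atInfinity).mul
    hb).const_mul_left (1 / 4))
  refine h1.congr' ?_ (by simp)
  filter_upwards [hb'] with w hw
  rw [hw]; ring

end HyperellipticSurface

end

/-! ### Correlation functions as fields in one argument; cancellation of anomalies -/

noncomputable section

open HyperellipticSurface RegularPoint

namespace HyperellipticSurface

variable {S : HyperellipticSurface}

/-- A function on the curve which is a field in the coordinate `x`, holomorphic off `Z`, and which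
transforms like a quadratic differential up to `A` times the Schwarzian derivative. -/
def IsXField (Z : Set S.RegularPoint) (A : ℂ) (F : S.RegularPoint → ℂ) : Prop :=
  ∃ Ψ, IsQuadratic (toPoint '' Z) A Ψ ∧ ∀ w, F w = atX Ψ w

namespace IsXField

variable {Z : Set S.RegularPoint} {A A' : ℂ} {F F' : S.RegularPoint → ℂ}

theorem add (h : IsXField Z A F) (h' : IsXField Z A' F') :
    IsXField Z (A + A') fun w => F w + F' w := by
  obtain ⟨Ψ, h1, h2⟩ := h
  obtain ⟨Ψ', h1', h2'⟩ := h'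
  exact ⟨_, h1.add h1', fun w => by simp only [h2, h2']; rfl⟩

theorem const_mul (c : ℂ) (h : IsXField Z A F) : IsXField Z (c * A) fun w => c * F w := by
  obtain ⟨Ψ, h1, h2⟩ := h
  exact ⟨_, h1.const_mul c, fun w => by simp only [h2]; rfl⟩

theorem mono {Z' : Set S.RegularPoint} (h : IsXField Z A F) (hZ : Z ⊆ Z') (hf : Z'.Finite) :
    IsXField Z' A F := by
  obtain ⟨Ψ, h1, h2⟩ := h
  exact ⟨Ψ, h1.mono (Set.image_mono hZ) (hf.image _), h2⟩

theorem congr (h : IsXField Z A F) (hA : A = A') (hF : ∀ w, F' w = F w) : IsXField Z A' F' := by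
  obtain ⟨Ψ, h1, h2⟩ := h
  exact ⟨Ψ, hA ▸ h1, fun w => (hF w).trans (h2 w)⟩

theorem analyticAt_lift (h : IsXField Z A F) {z : S.RegularPoint} (hz : z ∉ Z) :
    AnalyticAt ℂ (fun t => F (z.lift t)) z.x := by
  obtain ⟨Ψ, h1, h2⟩ := h
  simp only [h2]
  refine h1.analyticAt_atX_lift ?_
  rwa [toPoint_injective.mem_set_image]

theorem isBigO_near_of_eval_eq_zero (h : IsXField Z A F) {a : ℂ} (ha : S.p.eval a = 0) :
    (fun w : S.RegularPoint => w.p * F w - 3 / 8 * A * (w.p' ^ 2 / w.p)) =O[near a]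
      fun _ => (1 : ℂ) := by
  obtain ⟨Ψ, h1, h2⟩ := h
  simp only [h2]
  exact h1.isBigO_near_of_eval_eq_zero ha fun P ⟨z, _, hz⟩ => ⟨z, hz.symm⟩

theorem isBigO_atInfinity (h : IsXField Z A F) : F =O[atInfinity] fun _ => (1 : ℂ) := by
  obtain ⟨Ψ, h1, h2⟩ := h
  refine (h1.isBigO_atInfinity fun P ⟨z, _, hz⟩ => ⟨z, hz.symm⟩).congr_left fun w => (h2 w).symm

theorem isBigO_atInfinity_of_odd (h : IsXField Z 0 F) (hn : S.p.natDegree = 2 * S.g + 1) :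
    F =O[atInfinity] fun w => w.x⁻¹ ^ 3 := by
  obtain ⟨Ψ, h1, h2⟩ := h
  exact (h1.isBigO_atInfinity_of_odd hn fun P ⟨z, _, hz⟩ => ⟨z, hz.symm⟩).congr_left
    fun w => (h2 w).symm

end IsXField

end HyperellipticSurface

namespace VirasoroState

variable {S : HyperellipticSurface} {c : ℂ} (V : VirasoroState S c)

/-- The `(N + 1)`-point function with the first field in the coordinate `δ` and all others in the
coordinate `x`. -/
def insertion {N : ℕ} (z : Fin N → S.RegularPoint) (δ : S.LocalCoordinate) (t : ℂ) : ℂ :=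
  V.corr (N + 1) (Fin.cons δ fun i => (z i).xCoordinate) (Fin.cons t fun i => (z i).x)

theorem npoint_cons {N : ℕ} (w : S.RegularPoint) (z : Fin N → S.RegularPoint) :
    V.npoint (Fin.cons w z : Fin (N + 1) → S.RegularPoint) = atX (V.insertion z) w := by
  unfold npoint atX insertion
  congr 1
  · funext i
    refine Fin.cases rfl (fun _ => rfl) i
  · funext i
    refine Fin.cases rfl (fun _ => rfl) i

theorem cons_mem_config {N : ℕ} {z : Fin N → S.RegularPoint} (hz : Function.Injective z)
    {δ : S.LocalCoordinate} {t : ℂ} (ht : t ∈ δ.domain)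
    (ht' : δ.toPoint t ∉ Set.range fun i => (z i).toPoint) :
    (Fin.cons t (fun i => (z i).x) : Fin (N + 1) → ℂ) ∈
      config (Fin.cons δ (fun i => (z i).xCoordinate) : Fin (N + 1) → S.LocalCoordinate) := by
  refine ⟨fun i => ?_, ?_⟩
  · refine Fin.cases ?_ (fun j => ?_) i
    · exact ht
    · exact (z j).mem_xCoordinate_domain
  · have : (fun i => ((Fin.cons δ (fun i => (z i).xCoordinate) : Fin (N + 1) → S.LocalCoordinate)
        i).toPoint ((Fin.cons t (fun i => (z i).x) : Fin (N + 1) → ℂ) i)) =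
        Fin.cons (δ.toPoint t) fun i => (z i).toPoint := by
      funext i
      refine Fin.cases ?_ (fun j => ?_) i
      · rfl
      · exact (z j).xCoordinate_toPoint_self
    rw [this, Fin.cons_injective_iff]
    exact ⟨ht', toPoint_injective.comp hz⟩

theorem mem_config {N : ℕ} {z : Fin N → S.RegularPoint} (hz : Function.Injective z) :
    (fun i => (z i).x) ∈ config fun i => (z i).xCoordinate := by
  refine ⟨fun i => (z i).mem_xCoordinate_domain, ?_⟩
  simp only [xCoordinate_toPoint_self]
  exact toPoint_injective.comp hz

theorem npoint_comp_perm {N : ℕ} {z : Fin N → S.RegularPoint} (hz : Function.Injective z)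
    (σ : Equiv.Perm (Fin N)) : V.npoint (z ∘ σ) = V.npoint z :=
  V.symmetric N _ σ _ (mem_config hz)

/-- The anomaly of an inserted field is `c / 12` times the correlation function of the other fields.
This exact coefficient makes the cancellations in the connected functions possible. -/
theorem isQuadratic_insertion {N : ℕ} {z : Fin N → S.RegularPoint} (hz : Function.Injective z) :
    IsQuadratic (toPoint '' Set.range z) (c / 12 * V.npoint z) (V.insertion z) where
  finite := (Set.finite_range z).image _
  analyticAt δ t ht ht' := by
    rw [← Set.range_comp] at ht'
    have h1 := V.holomorphic _ _ _ (cons_mem_config hz ht ht')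
    have h2 : AnalyticAt ℂ (fun t : ℂ => (Fin.cons t (fun i => (z i).x) : Fin (N + 1) → ℂ)) t := by
      rw [analyticAt_pi_iff]
      intro i
      refine Fin.cases ?_ (fun j => ?_) i
      · exact analyticAt_id
      · exact analyticAt_const
    exact AnalyticAt.comp (f := fun t : ℂ => (Fin.cons t (fun i => (z i).x) : Fin (N + 1) → ℂ))
      h1 h2
  transform γ δ t h ht ht' hh hδ heq := by
    rw [← Set.range_comp] at ht'
    have := V.transform N _ _ (cons_mem_config hz ht ht') 0 δ h hh hδ heq
    rw [Fin.cons_zero, Fin.update_cons_zero, Fin.update_cons_zero, Fin.removeNth_zero,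
      Fin.removeNth_zero, Fin.tail_cons, Fin.tail_cons] at this
    unfold insertion
    rw [this]
    unfold npoint
    ring

theorem isXField_npoint {N : ℕ} {z : Fin N → S.RegularPoint} (hz : Function.Injective z) :
    IsXField (Set.range z) (c / 12 * V.npoint z)
      fun w => V.npoint (Fin.cons w z : Fin (N + 1) → S.RegularPoint) :=
  ⟨_, V.isQuadratic_insertion hz, fun w => V.npoint_cons w z⟩

/-- The OPE is given in a single coordinate `δ`; `atX_lift_eventuallyEq` transfers it to `npoint`,
whose coordinate moves with the point. The constant `Φ` and the error term are merged into one
bounded remainder. -/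
theorem isBigO_ope {N : ℕ} {z : S.RegularPoint} {z' : Fin N → S.RegularPoint}
    (hz : Function.Injective (Fin.cons z z' : Fin (N + 1) → S.RegularPoint)) :
    (fun t => V.npoint (Fin.cons (z.lift t) (Fin.cons z z' : Fin (N + 1) → S.RegularPoint) :
        Fin (N + 2) → S.RegularPoint) -
      (c / 2 / (t - z.x) ^ 4 * V.npoint z' + 1 / (t - z.x) ^ 2 *
        (V.npoint (Fin.cons (z.lift t) z' : Fin (N + 1) → S.RegularPoint) +
          V.npoint (Fin.cons z z' : Fin (N + 1) → S.RegularPoint))))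
      =O[𝓝[≠] z.x] fun _ => (1 : ℂ) := by
  have hz' := (Fin.cons_injective_iff.1 hz).2
  have e1 := ((V.isQuadratic_insertion hz).atX_lift_eventuallyEq z).filter_mono
    (nhdsWithin_le_nhds (s := {z.x}ᶜ))
  have e2 := ((V.isQuadratic_insertion hz').atX_lift_eventuallyEq z).filter_mono
    (nhdsWithin_le_nhds (s := {z.x}ᶜ))
  have hmem := cons_mem_config hz' z.mem_xCoordinate_domain (by
    rw [xCoordinate_toPoint_self]
    rintro ⟨i, hi⟩
    exact (Fin.cons_injective_iff.1 hz).1 ⟨i, toPoint_injective hi⟩)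
  obtain ⟨Φ, hΦ⟩ := V.ope N z.xCoordinate (fun i => (z' i).xCoordinate) z.x (fun i => (z' i).x) hmem
  have h1 : (fun t : ℂ => t - z.x) =O[𝓝[≠] z.x] fun _ => (1 : ℂ) := by
    have : ContinuousAt (fun t : ℂ => t - z.x) z.x := by fun_prop
    exact (this.tendsto.mono_left nhdsWithin_le_nhds).isBigO_one ℂ
  refine ((hΦ.trans h1).add (isBigO_const_one ℂ Φ _)).congr' ?_ EventuallyEq.rfl
  filter_upwards [e1, e2] with t ht1 ht2
  rw [V.npoint_cons, V.npoint_cons, V.npoint_cons, ht1, ht2]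
  have e3 : (Fin.cons z.xCoordinate (Fin.cons z.xCoordinate fun i => (z' i).xCoordinate :
      Fin (N + 1) → S.LocalCoordinate) : Fin (N + 2) → S.LocalCoordinate) =
      Fin.cons z.xCoordinate fun i => ((Fin.cons z z' : Fin (N + 1) → S.RegularPoint)
        i).xCoordinate := by
    congr 1
    funext i
    refine Fin.cases rfl (fun _ => rfl) i
  have e4 : (Fin.cons t (Fin.cons z.x fun i => (z' i).x :
      Fin (N + 1) → ℂ) : Fin (N + 2) → ℂ) =
      Fin.cons t fun i => ((Fin.cons z z' : Fin (N + 1) → S.RegularPoint) i).x := by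
    congr 1
    funext i
    refine Fin.cases rfl (fun _ => rfl) i
  rw [e3, e4]
  unfold insertion atX npoint
  ring

theorem isXField_conn1 (hV : V.one ≠ 0) : IsXField ∅ (c / 12) fun w => V.conn1 w := by
  have h := (V.isXField_npoint (z := ![]) (Function.injective_of_subsingleton _)).const_mul V.one⁻¹
  rw [Set.range_eq_empty] at h
  refine h.congr ?_ fun w => rfl
  rw [show V.npoint ![] = V.one from rfl]
  field_simp

/-- The anomaly `c / 12 * conn1 z` of the normalised two-point function equals that of the
subtracted product `conn1 w * conn1 z`. -/
theorem isXField_conn2 (hV : V.one ≠ 0) (z : S.RegularPoint) :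
    IsXField {z} 0 fun w => V.conn2 w z := by
  have h := (V.isXField_npoint (z := ![z]) (Function.injective_of_subsingleton _)).const_mul V.one⁻¹
  have h1 := ((V.isXField_conn1 hV).mono (Set.empty_subset {z})
    (Set.finite_singleton z)).const_mul (-V.conn1 z)
  rw [show Set.range ![z] = {z} by simp] at h
  refine (h.add h1).congr ?_ fun w => ?_
  · rw [conn1]; ring
  · show _ = V.one⁻¹ * V.npoint ![w, z] + _
    rw [conn2]; ring

theorem npoint_two_comm {z₁ z₂ : S.RegularPoint} (h : z₁ ≠ z₂) :
    V.npoint ![z₁, z₂] = V.npoint ![z₂, z₁] := by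
  have := V.npoint_comp_perm (z := ![z₂, z₁]) (by
    intro i j; fin_cases i <;> fin_cases j <;> simp [h, h.symm]) (Equiv.swap 0 1)
  rw [← this]
  congr 1
  funext i
  fin_cases i <;> simp

theorem injective_three {z₁ z₂ z₃ : S.RegularPoint} (h12 : z₁ ≠ z₂) (h13 : z₁ ≠ z₃)
    (h23 : z₂ ≠ z₃) : Function.Injective ![z₁, z₂, z₃] := by
  intro i j
  fin_cases i <;> fin_cases j <;> simp [h12, h13, h23, h12.symm, h13.symm, h23.symm]

theorem npoint_three_comm {z₁ z₂ z₃ : S.RegularPoint} (h12 : z₁ ≠ z₂) (h13 : z₁ ≠ z₃)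
    (h23 : z₂ ≠ z₃) : V.npoint ![z₁, z₂, z₃] = V.npoint ![z₂, z₁, z₃] := by
  have := V.npoint_comp_perm (injective_three h12.symm h23 h13) (Equiv.swap 0 1)
  rw [← this]
  congr 1
  funext i
  fin_cases i <;> simp [Equiv.swap_apply_def]

theorem npoint_three_comm' {z₁ z₂ z₃ : S.RegularPoint} (h12 : z₁ ≠ z₂) (h13 : z₁ ≠ z₃)
    (h23 : z₂ ≠ z₃) : V.npoint ![z₁, z₂, z₃] = V.npoint ![z₁, z₃, z₂] := by
  have := V.npoint_comp_perm (injective_three h13 h12 h23.symm) (Equiv.swap 1 2)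
  rw [← this]
  congr 1
  funext i
  fin_cases i <;> simp [Equiv.swap_apply_def]

theorem conn2_comm {z₁ z₂ : S.RegularPoint} (h : z₁ ≠ z₂) : V.conn2 z₁ z₂ = V.conn2 z₂ z₁ := by
  rw [conn2, conn2, V.npoint_two_comm h]; ring

theorem conn3_comm {z₁ z₂ z₃ : S.RegularPoint} (h12 : z₁ ≠ z₂) (h13 : z₁ ≠ z₃)
    (h23 : z₂ ≠ z₃) : V.conn3 z₁ z₂ z₃ = V.conn3 z₂ z₁ z₃ := by
  rw [conn3, conn3, V.npoint_three_comm h12 h13 h23, V.conn2_comm h12, V.conn2_comm h23,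
    V.conn2_comm h13.symm]
  ring

theorem conn3_comm' {z₁ z₂ z₃ : S.RegularPoint} (h12 : z₁ ≠ z₂) (h13 : z₁ ≠ z₃)
    (h23 : z₂ ≠ z₃) : V.conn3 z₁ z₂ z₃ = V.conn3 z₁ z₃ z₂ := by
  rw [conn3, conn3, V.npoint_three_comm' h12 h13 h23, V.conn2_comm h12, V.conn2_comm h23,
    V.conn2_comm h13.symm]
  ring

/-- The anomalies of the three-point function and of the terms containing `conn1 w` cancel by the
definition of `conn2 z₂ z₃`. The argument `w` stands first in every term, since `conn2` is symmetric
only at distinct points; the expression agrees with `conn3` for `w ≠ z₃`. -/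
theorem isXField_conn3 (hV : V.one ≠ 0) {z₂ z₃ : S.RegularPoint} (h : z₂ ≠ z₃) :
    IsXField {z₂, z₃} 0 fun w => V.one⁻¹ * V.npoint ![w, z₂, z₃] - V.conn2 w z₂ * V.conn1 z₃ -
      V.conn2 z₂ z₃ * V.conn1 w - V.conn2 w z₃ * V.conn1 z₂ -
      V.conn1 w * V.conn1 z₂ * V.conn1 z₃ := by
  have hfin : ({z₂, z₃} : Set S.RegularPoint).Finite := by simp
  have h3 := (V.isXField_npoint (z := ![z₂, z₃]) (by
    intro i j; fin_cases i <;> fin_cases j <;> simp [h, h.symm])).const_mul V.one⁻¹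
  rw [show Set.range ![z₂, z₃] = {z₂, z₃} by simp [Set.pair_comm]] at h3
  have h2 := ((V.isXField_conn2 hV z₂).mono (Z' := {z₂, z₃}) (by simp) hfin).const_mul
    (-V.conn1 z₃)
  have h2' := ((V.isXField_conn2 hV z₃).mono (Z' := {z₂, z₃}) (by simp) hfin).const_mul
    (-V.conn1 z₂)
  have h1 := ((V.isXField_conn1 hV).mono (Z' := {z₂, z₃}) (by simp) hfin).const_mul
    (-V.conn2 z₂ z₃ - V.conn1 z₂ * V.conn1 z₃)
  refine (((h3.add h2).add h2').add h1).congr ?_ fun w => ?_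
  · rw [conn2]; ring
  · show _ = V.one⁻¹ * V.npoint ![w, z₂, z₃] + _ + _ + _
    ring

theorem conn3_eq {w z₂ z₃ : S.RegularPoint} (h : w ≠ z₃) :
    V.conn3 w z₂ z₃ = V.one⁻¹ * V.npoint ![w, z₂, z₃] - V.conn2 w z₂ * V.conn1 z₃ -
      V.conn2 z₂ z₃ * V.conn1 w - V.conn2 w z₃ * V.conn1 z₂ -
      V.conn1 w * V.conn1 z₂ * V.conn1 z₃ := by
  rw [conn3, V.conn2_comm h]

end VirasoroState

end

/-! ### The operator product expansion and the regular part of the two-point function -/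

noncomputable section

open HyperellipticSurface RegularPoint

theorem AnalyticAt.exists_eq_add_mul {g : ℂ → ℂ} {b : ℂ} (hg : AnalyticAt ℂ g b) :
    ∃ g₁ : ℂ → ℂ, AnalyticAt ℂ g₁ b ∧ ∀ t, g t = g b + (t - b) * g₁ t := by
  obtain ⟨p, hp⟩ := hg
  refine ⟨dslope g b, hp.has_fpower_series_dslope_fslope.analyticAt, fun t => ?_⟩
  have := sub_smul_dslope g b t
  rw [smul_eq_mul] at this
  rw [this]; ring

theorem ContinuousAt.isBigO_one_nhdsNE {g : ℂ → ℂ} {b : ℂ} (hg : ContinuousAt g b) :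
    g =O[𝓝[≠] b] fun _ => (1 : ℂ) :=
  (hg.tendsto.mono_left nhdsWithin_le_nhds).isBigO_one ℂ

theorem Asymptotics.IsBigO.mul_one_one {α : Type*} {l : Filter α} {F G : α → ℂ}
    (hF : F =O[l] fun _ => (1 : ℂ)) (hG : G =O[l] fun _ => (1 : ℂ)) :
    (fun x => F x * G x) =O[l] fun _ => (1 : ℂ) := by
  simpa using hF.mul hG

namespace HyperellipticSurface

variable {S : HyperellipticSurface}

namespace RegularPoint

theorem eval_derivative_eq (z : S.RegularPoint) {t : ℂ} (h : DifferentiableAt ℂ z.branch t) :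
    S.p.derivative.eval t = 2 * z.branch t * deriv z.branch t := by
  have h1 : HasDerivAt (z.branch ^ 2) _ t := h.hasDerivAt.pow 2
  have h2 : z.branch ^ 2 = fun s => S.p.eval s := funext z.branch_sq
  rw [h2] at h1
  rw [(S.p.hasDerivAt t).unique h1]
  push_cast
  ring

theorem analyticAt_lift_y (z : S.RegularPoint) : AnalyticAt ℂ (fun t => (z.lift t).y) z.x :=
  z.analyticAt_branch.congr z.lift_y_eventuallyEq.symm

theorem analyticAt_lift_x (z : S.RegularPoint) : AnalyticAt ℂ (fun t => (z.lift t).x) z.x :=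
  analyticAt_id.congr z.lift_x_eventuallyEq.symm

theorem analyticAt_lift_eval (z : S.RegularPoint) (r : ℂ[X]) :
    AnalyticAt ℂ (fun t => r.eval (z.lift t).x) z.x := by
  refine ((Polynomial.differentiable r).analyticAt z.x).congr ?_
  filter_upwards [z.lift_x_eventuallyEq] with t ht
  rw [ht]; rfl

theorem lift_p {z : S.RegularPoint} {t : ℂ} (h : S.p.eval t ≠ 0) :
    (z.lift t).p = z.branch t ^ 2 := by
  rw [p_eq, lift_y h]

/-- The second order Taylor expansion of the branch of `y`. -/
theorem exists_branch_expansion (z : S.RegularPoint) : ∃ (β : ℂ) (u : ℂ → ℂ),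
    AnalyticAt ℂ u z.x ∧ (∀ t, z.branch t = z.y + (t - z.x) * (β + (t - z.x) * u t)) ∧
    deriv z.branch z.x = β ∧
    ∀ᶠ t in 𝓝 z.x, deriv z.branch t =
      β + 2 * (t - z.x) * u t + (t - z.x) ^ 2 * deriv u t := by
  obtain ⟨v, hv, hv'⟩ := z.analyticAt_branch.exists_eq_add_mul
  obtain ⟨u, hu, hu'⟩ := hv.exists_eq_add_mul
  have h1 : ∀ t, z.branch t = z.y + (t - z.x) * (v z.x + (t - z.x) * u t) := by
    intro t; rw [hv' t, hu' t, branch_self]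
  have h2 : ∀ᶠ t in 𝓝 z.x, deriv z.branch t =
      v z.x + 2 * (t - z.x) * u t + (t - z.x) ^ 2 * deriv u t := by
    filter_upwards [hu.eventually_analyticAt] with t ht
    have h3 : HasDerivAt (fun t : ℂ => t - z.x) 1 t := (hasDerivAt_id t).sub_const _
    have h4 := (h3.mul ((h3.mul ht.differentiableAt.hasDerivAt).const_add (v z.x))).const_add z.y
    rw [funext h1]
    refine h4.deriv.trans ?_
    simp only [Pi.mul_apply]
    ring
  refine ⟨v z.x, u, hu, h1, ?_, h2⟩
  rw [h2.self_of_nhds]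
  ring

theorem ne_lift_of_ne {z w : S.RegularPoint} : ∀ᶠ t in 𝓝[≠] z.x, z.lift t ≠ w := by
  filter_upwards [(Set.finite_singleton w.x).eventually_notMem_nhdsNE z.x,
    nhdsWithin_le_nhds z.eventually_eval_ne_zero] with t ht hp h
  exact ht (by rw [Set.mem_singleton_iff, ← h, lift_x hp])

theorem ne_conj (z : S.RegularPoint) : z.conj ≠ z := by
  intro h
  have := congrArg RegularPoint.y h
  rw [conj_y, neg_eq_self] at this
  exact z.y_ne_zero this

end RegularPoint

/-- `F` is holomorphic off the points with `x`-coordinate in `B`, it is bounded near the branch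
points and it is `O(x ^ D)` at infinity. -/
structure IsTame (B : Set ℂ) (D : ℕ) (F : S.RegularPoint → ℂ) : Prop where
  analyticAt : ∀ z : S.RegularPoint, z.x ∉ B → AnalyticAt ℂ (fun t => F (z.lift t)) z.x
  near_branch : ∀ a, S.p.eval a = 0 → F =O[near a] fun _ => (1 : ℂ)
  atInfinity : F =O[atInfinity] fun w => w.x ^ D

theorem eventually_one_le_norm_x : ∀ᶠ w : S.RegularPoint in atInfinity, 1 ≤ ‖w.x‖ :=
  eventually_atInfinity ((tendsto_norm_cobounded_atTop (E := ℂ)).eventually_ge_atTop 1)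

theorem isBigO_x_pow {m k : ℕ} (h : m ≤ k) :
    (fun w : S.RegularPoint => w.x ^ m) =O[atInfinity] fun w => w.x ^ k := by
  refine IsBigO.of_bound 1 ?_
  filter_upwards [eventually_one_le_norm_x] with w hw
  rw [norm_pow, norm_pow, one_mul]
  exact pow_le_pow_right₀ hw h

theorem isBigO_eval (r : ℂ[X]) {k : ℕ} (h : r.natDegree ≤ k) :
    (fun w : S.RegularPoint => r.eval w.x) =O[atInfinity] fun w => w.x ^ k := by
  simp only [Polynomial.eval_eq_sum_range]
  refine IsBigO.fun_sum fun i hi => ?_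
  refine (isBigO_x_pow ?_).const_mul_left _
  exact (Nat.lt_succ_iff.1 (Finset.mem_range.1 hi)).trans h

namespace IsTame

variable {B B' : Set ℂ} {D D' : ℕ} {F G : S.RegularPoint → ℂ}

theorem mono (h : IsTame B D F) (hB : B ⊆ B') (hD : D ≤ D') : IsTame B' D' F where
  analyticAt z hz := h.analyticAt z fun h' => hz (hB h')
  near_branch := h.near_branch
  atInfinity := h.atInfinity.trans (isBigO_x_pow hD)

theorem add (hF : IsTame B D F) (hG : IsTame B D G) : IsTame B D fun w => F w + G w where
  analyticAt z hz := (hF.analyticAt z hz).add (hG.analyticAt z hz)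
  near_branch a ha := (hF.near_branch a ha).add (hG.near_branch a ha)
  atInfinity := hF.atInfinity.add hG.atInfinity

theorem const_mul (k : ℂ) (hF : IsTame B D F) : IsTame B D fun w => k * F w where
  analyticAt z hz := analyticAt_const.mul (hF.analyticAt z hz)
  near_branch a ha := (hF.near_branch a ha).const_mul_left k
  atInfinity := hF.atInfinity.const_mul_left k

theorem sub (hF : IsTame B D F) (hG : IsTame B D G) : IsTame B D fun w => F w - G w where
  analyticAt z hz := (hF.analyticAt z hz).sub (hG.analyticAt z hz)
  near_branch a ha := (hF.near_branch a ha).sub (hG.near_branch a ha)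
  atInfinity := hF.atInfinity.sub hG.atInfinity

theorem const (k : ℂ) : IsTame B D fun _ : S.RegularPoint => k where
  analyticAt _ _ := analyticAt_const
  near_branch _ _ := isBigO_const_one ℂ k _
  atInfinity := by
    have h : (fun w : S.RegularPoint => k * w.x ^ 0) =O[RegularPoint.atInfinity]
        fun w => w.x ^ D := (isBigO_x_pow (Nat.zero_le D)).const_mul_left k
    simpa using h

theorem mul (hF : IsTame B D F) (hG : IsTame B D' G) :
    IsTame B (D + D') fun w => F w * G w where
  analyticAt z hz := (hF.analyticAt z hz).mul (hG.analyticAt z hz)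
  near_branch a ha := (hF.near_branch a ha).mul_one_one (hG.near_branch a ha)
  atInfinity := by simpa only [pow_add] using hF.atInfinity.mul hG.atInfinity

theorem congr (hF : IsTame B D F) (h : ∀ w, G w = F w) : IsTame B D G := by
  rwa [show G = F from funext h]

theorem eval (r : ℂ[X]) {k : ℕ} (h : r.natDegree ≤ k) :
    IsTame ∅ k fun w : S.RegularPoint => r.eval w.x where
  analyticAt z _ := z.analyticAt_lift_eval r
  near_branch _ _ := isBigO_one_of_continuousAt r.continuous.continuousAt
  atInfinity := isBigO_eval r h

end IsTame

theorem isTame_p : IsTame ∅ S.n fun w : S.RegularPoint => w.p := IsTame.eval S.p le_rfl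

/-- The crude comparison `‖y‖ ≤ ‖y‖ ^ 2 = ‖p‖` is enough: separate polynomiality needs only some
polynomial bound on the growth. -/
theorem isBigO_y_atInfinity : (fun w : S.RegularPoint => w.y) =O[atInfinity] fun w => w.x ^ S.n := by
  refine IsBigO.trans ?_ (isTame_p (S := S)).atInfinity
  refine IsBigO.of_bound 1 ?_
  filter_upwards [eventually_one_le_norm_y] with w hw
  rw [p_eq, norm_pow, one_mul, sq]
  exact le_mul_of_one_le_left (norm_nonneg _) hw

theorem isTame_y : IsTame ∅ S.n fun w : S.RegularPoint => w.y where
  analyticAt z _ := z.analyticAt_lift_y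
  near_branch a ha := by
    have h1 : Tendsto (fun w : S.RegularPoint => w.p) (near a) (𝓝 (S.p.eval a)) :=
      (S.p.continuous.tendsto a).comp ((tendsto_x_near a).mono_right nhdsWithin_le_nhds)
    have h2 : (fun w : S.RegularPoint => w.p) =O[near a] fun _ => (1 : ℂ) := h1.isBigO_one ℂ
    obtain ⟨M, hM⟩ := h2.bound
    refine IsBigO.of_bound (M + 1) ?_
    filter_upwards [hM] with w hw
    rw [p_eq, norm_pow] at hw
    simp only [norm_one, mul_one] at hw ⊢
    nlinarith [norm_nonneg w.y, sq_nonneg (‖w.y‖ - 1)]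
  atInfinity := isBigO_y_atInfinity

theorem isTame_inv_sub (b : ℂ) (hb : S.p.eval b ≠ 0) :
    IsTame {b} 0 fun w : S.RegularPoint => (w.x - b)⁻¹ where
  analyticAt z hz := by
    refine (z.analyticAt_lift_x.sub analyticAt_const).inv ?_
    simpa [sub_ne_zero] using hz
  near_branch a ha := by
    have hab : a ≠ b := by rintro rfl; exact hb ha
    refine isBigO_one_of_continuousAt (g := fun t => (t - b)⁻¹) ?_
    exact ContinuousAt.inv₀ (by fun_prop) (sub_ne_zero.2 hab)
  atInfinity := by
    have h1 : Tendsto (fun t : ℂ => (t - b)⁻¹) (Bornology.cobounded ℂ) (𝓝 0) :=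
      tendsto_inv₀_cobounded.comp (tendsto_sub_const_cobounded b)
    simpa using (h1.comp (tendsto_x_atInfinity (S := S))).isBigO_one ℂ

end HyperellipticSurface

namespace VirasoroState

variable {S : HyperellipticSurface} {c : ℂ} (V : VirasoroState S c)

theorem isTame_f (z : S.RegularPoint) : IsTame {z.x} (2 * S.n) fun w => f w z := by
  have h1 := ((isTame_y (S := S)).add (IsTame.const z.y)).mono (Set.empty_subset {z.x}) le_rfl
  have h2 := h1.mul (isTame_inv_sub z.x z.p_ne_zero)
  refine ((h2.mul h2).mono le_rfl (by omega)).congr fun w => ?_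
  rw [f, div_eq_mul_inv, sq]

theorem f_comm (z w : S.RegularPoint) : f z w = f w z := by
  unfold f
  rw [div_pow, div_pow]
  congr 1 <;> ring

/-- The function `P`, divided by `⟨1⟩`. -/
def nP (z : S.RegularPoint) : ℂ := V.one⁻¹ * V.P z

/-- The regular part of the two-point function, divided by `⟨1⟩`. -/
def nreg (z w : S.RegularPoint) : ℂ := V.one⁻¹ * V.reg z w

theorem nP_eq (hV : V.one ≠ 0) (z : S.RegularPoint) :
    V.nP z = 4 * (z.p * V.conn1 z - c / 32 * (z.p' ^ 2 / z.p)) := by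
  rw [nP, P, conn1]
  field_simp

theorem nreg_eq (hV : V.one ≠ 0) (z w : S.RegularPoint) :
    V.nreg z w = z.p * w.p * V.conn2 z w - c / 32 * f z w ^ 2 -
      1 / 16 * f z w * (V.nP z + V.nP w) := by
  rw [nreg, reg, nP_eq V hV, nP_eq V hV, conn2, conn1, conn1]
  field_simp
  ring

theorem nreg_comm (hV : V.one ≠ 0) {z w : S.RegularPoint} (h : z ≠ w) :
    V.nreg z w = V.nreg w z := by
  rw [nreg_eq V hV, nreg_eq V hV, V.conn2_comm h, f_comm]
  ring

/-- At a branch point the Schwarzian anomaly `c / 12` produces exactly the singular term `(c / 32)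
p' ^ 2 / p`, which the definition of `P` removes. -/
theorem isTame_nP (hV : V.one ≠ 0) : IsTame ∅ (2 * S.n) fun w => V.nP w := by
  have hC := V.isXField_conn1 hV
  have hp := isTame_p (S := S)
  have hp' : IsTame ∅ S.n fun w : S.RegularPoint => w.p' :=
    IsTame.eval S.p.derivative ((Polynomial.natDegree_derivative_le _).trans (Nat.sub_le _ _))
  refine ⟨fun z _ => ?_, fun a ha => ?_, ?_⟩
  · simp only [nP_eq V hV]
    have h1 := hC.analyticAt_lift (Set.notMem_empty z)
    have h2 := hp.analyticAt z (Set.notMem_empty _)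
    have h3 := hp'.analyticAt z (Set.notMem_empty _)
    refine analyticAt_const.mul ((h2.mul h1).sub (analyticAt_const.mul ((h3.pow 2).div h2 ?_)))
    exact p_ne_zero _
  · refine ((hC.isBigO_near_of_eval_eq_zero ha).const_mul_left 4).congr_left fun w => ?_
    rw [nP_eq V hV]; ring
  · have h1 : (fun w : S.RegularPoint => w.p * V.conn1 w) =O[RegularPoint.atInfinity]
        fun w => w.x ^ (2 * S.n) := by
      have := hp.atInfinity.mul hC.isBigO_atInfinity
      simp only [mul_one] at this
      exact this.trans (isBigO_x_pow (by omega))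
    have h2 : (fun w : S.RegularPoint => w.p' ^ 2 / w.p) =O[RegularPoint.atInfinity]
        fun w => w.x ^ (2 * S.n) := by
      have h3 : (fun w : S.RegularPoint => w.p⁻¹) =O[RegularPoint.atInfinity] fun _ => (1 : ℂ) := by
        refine IsBigO.of_bound 1 ?_
        filter_upwards [eventually_one_le_norm_y (S := S)] with w hw
        rw [p_eq, norm_inv, norm_pow, norm_one, mul_one]
        exact inv_le_one_of_one_le₀ (one_le_pow₀ hw)
      have := (hp'.atInfinity.pow 2).mul h3
      simp only [mul_one, ← pow_mul, ← div_eq_mul_inv] at this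
      rwa [mul_comm S.n 2] at this
    refine ((h1.sub (h2.const_mul_left (c / 32))).const_mul_left 4).congr_left fun w => ?_
    rw [nP_eq V hV]

theorem isTame_p_mul {Z : Set S.RegularPoint} {B : Set ℂ} {F : S.RegularPoint → ℂ}
    (h : IsXField Z 0 F) (hB : ∀ z ∈ Z, z.x ∈ B) : IsTame B S.n fun w => w.p * F w where
  analyticAt z hz := ((isTame_p (S := S)).analyticAt z (Set.notMem_empty _)).mul
    (h.analyticAt_lift fun hz' => hz (hB z hz'))
  near_branch a ha := (h.isBigO_near_of_eval_eq_zero ha).congr_left fun w => by simp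
  atInfinity := by
    simpa using (isTame_p (S := S)).atInfinity.mul h.isBigO_atInfinity

theorem isTame_nreg (hV : V.one ≠ 0) (z : S.RegularPoint) :
    IsTame {z.x} (4 * S.n) fun w => V.nreg w z := by
  have h1 := (isTame_p_mul (B := {z.x}) (V.isXField_conn2 hV z) (by simp)).const_mul z.p
  have hf := isTame_f (S := S) z
  have h3 := hf.mul (((V.isTame_nP hV).add (IsTame.const (V.nP z))).mono
    (Set.empty_subset {z.x}) le_rfl)
  refine (((h1.mono le_rfl (by omega)).sub (((hf.mul hf).const_mul (c / 32)).mono le_rfl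
    (by omega))).sub ((h3.const_mul (1 / 16)).mono le_rfl (by omega))).congr fun w => ?_
  rw [nreg_eq V hV]; ring

theorem exists_conn2_lift_eq (hV : V.one ≠ 0) (z : S.RegularPoint) :
    ∃ E : ℂ → ℂ, E =O[𝓝[≠] z.x] (fun _ => (1 : ℂ)) ∧ ∀ t, V.conn2 (z.lift t) z =
      c / 2 / (t - z.x) ^ 4 + 1 / (t - z.x) ^ 2 * (V.conn1 (z.lift t) + V.conn1 z) + E t := by
  have h := V.isBigO_ope (z := z) (z' := ![])
    fun i j _ => Subsingleton.elim (α := Fin 1) i j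
  have h1 := ((V.isXField_conn1 hV).analyticAt_lift (Set.notMem_empty z)).continuousAt.isBigO_one_nhdsNE
  refine ⟨_, (h.const_mul_left V.one⁻¹).sub (h1.const_mul_left (V.conn1 z)), fun t => ?_⟩
  change _ = _ + _ + (V.one⁻¹ * (V.npoint ![z.lift t, z] - (_ * V.one + _ * (V.npoint ![z.lift t] +
    V.npoint ![z]))) - _)
  rw [conn2, conn1, conn1, mul_sub, mul_add V.one⁻¹,
    show ∀ a, V.one⁻¹ * (a * V.one) = a from fun a => by field_simp]
  ring

/-- The fourth-order pole and the disconnected part of the double pole are those of `conn2 (z.lift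
t) z * conn1 w`, which `conn3` subtracts. What remains is a double pole whose coefficient is built
from connected two-point functions. -/
theorem exists_conn3_lift_eq (hV : V.one ≠ 0) {z w : S.RegularPoint} (hzw : z ≠ w) :
    ∃ E : ℂ → ℂ, E =O[𝓝[≠] z.x] (fun _ => (1 : ℂ)) ∧ ∀ᶠ t in 𝓝[≠] z.x,
      V.conn3 (z.lift t) z w =
        1 / (t - z.x) ^ 2 * (V.conn2 (z.lift t) w + V.conn2 z w) + E t := by
  have h := V.isBigO_ope (z := z) (z' := ![w]) (by
    rw [Fin.cons_injective_iff]
    exact ⟨by simpa using hzw, Function.injective_of_subsingleton _⟩)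
  obtain ⟨E₂, hE₂, hE₂'⟩ := V.exists_conn2_lift_eq hV z
  have h1 := ((V.isXField_conn1 hV).analyticAt_lift (Set.notMem_empty z)).continuousAt.isBigO_one_nhdsNE
  have h2 := ((V.isXField_conn2 hV w).analyticAt_lift (z := z)
    (by simpa using hzw)).continuousAt.isBigO_one_nhdsNE
  refine ⟨_, ((((h.const_mul_left V.one⁻¹).sub (hE₂.const_mul_left (V.conn1 w))).sub
    (h1.const_mul_left (V.conn2 z w))).sub (h2.const_mul_left (V.conn1 z))).sub
    (h1.const_mul_left (V.conn1 z * V.conn1 w)), ?_⟩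
  filter_upwards [ne_lift_of_ne (z := z) (w := w)] with t ht
  change _ = _ + (V.one⁻¹ * (V.npoint ![z.lift t, z, w] - (_ * V.npoint ![w] + _ *
    (V.npoint ![z.lift t, w] + V.npoint ![z, w]))) - _ - _ - _ - _)
  rw [V.conn3_eq ht, hE₂' t, conn2, conn2, conn1, conn1, conn1]
  ring

/-- With `Y` and `α` the values of `y` at the two points, the left side is the OPE double pole,
multiplied by `p₁ p₂`, minus its version in terms of `f`. It is regular because `(Y + α) ^ 2 = 4 Y α
+ δ ^ 2 v ^ 2`, and the rest contains the two factors `Y - α` and `Y K - α κ`, each divisible by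
`δ`. It serves with `K = conn1` and with `K = conn2 · w`. -/
theorem double_pole_cancel {Y α v K κ κ₁ δ : ℂ} (hδ : δ ≠ 0) (hY : Y = α + δ * v)
    (hK : K = κ + δ * κ₁) :
    Y ^ 2 * α ^ 2 * (1 / δ ^ 2 * (K + κ)) -
      ((Y + α) / δ) ^ 2 / 4 * (Y ^ 2 * K + α ^ 2 * κ) =
    -v ^ 2 / 4 * (Y ^ 2 * K + α ^ 2 * κ) - Y * α * v * (v * K + α * κ₁) := by
  subst hY hK
  field_simp
  ring

/-- Since `16 Y² α² - (Y + α)⁴ = -2 (Y + α)² (Y - α)² + (Y - α)⁴`, a double pole in `δ` survives. It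
is absorbed by the `p' ^ 2 / p = 4 (y') ^ 2` terms: the mean of the squared derivatives at both ends
equals the squared difference quotient up to `O(δ ^ 2)`, which requires the second-order expansion
of `Y`. -/
theorem fourth_order_pole_cancel {Y Y' α β v u u' δ : ℂ} (hδ : δ ≠ 0) (hv : v = β + δ * u)
    (hY : Y = α + δ * v) (hY' : Y' = β + 2 * δ * u + δ ^ 2 * u') :
    16 * (Y ^ 2 * α ^ 2) / δ ^ 4 - ((Y + α) / δ) ^ 4 +
      ((Y + α) / δ) ^ 2 * (Y' ^ 2 + β ^ 2) =
    (Y + α) ^ 2 * (2 * u ^ 2 + 2 * (β + 2 * δ * u) * u' + δ ^ 2 * u' ^ 2) + v ^ 4 := by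
  have h1 : δ ^ 2 * (Y' ^ 2 + β ^ 2) - 2 * (δ * v) ^ 2 =
      δ ^ 4 * (2 * u ^ 2 + 2 * (β + 2 * δ * u) * u' + δ ^ 2 * u' ^ 2) := by
    subst hv hY'; ring
  have h2 : δ * v = Y - α := by rw [hY]; ring
  have h3 : v = (Y - α) / δ := by rw [← h2]; field_simp
  rw [h2] at h1
  rw [h3]
  field_simp
  linear_combination (Y + α) ^ 2 * h1

/-- The `conn1` part of the singularity cancels by `double_pole_cancel`, and the part proportional
to `c` by `fourth_order_pole_cancel`; the remaining functions are continuous at `z.x`, apart from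
the bounded OPE remainder. -/
theorem isBigO_nreg_lift (hV : V.one ≠ 0) (z : S.RegularPoint) :
    (fun t => V.nreg (z.lift t) z) =O[𝓝[≠] z.x] fun _ => (1 : ℂ) := by
  obtain ⟨E, hE, hE'⟩ := V.exists_conn2_lift_eq hV z
  obtain ⟨β, u, hu, hY, hβ, hY'⟩ := z.exists_branch_expansion
  have hC := (V.isXField_conn1 hV).analyticAt_lift (Set.notMem_empty z)
  obtain ⟨κ, hκ, hκ'⟩ := hC.exists_eq_add_mul
  have hb := z.analyticAt_branch
  have hu' := hu.deriv
  have cC := hC.continuousAt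
  have cκ := hκ.continuousAt
  have cb := hb.continuousAt
  have cu := hu.continuousAt
  have cu' := hu'.continuousAt
  have h1 : ContinuousAt (fun t =>
      (-(β + (t - z.x) * u t) ^ 2 / 4 * (z.branch t ^ 2 * V.conn1 (z.lift t) +
          z.y ^ 2 * V.conn1 z) -
        z.branch t * z.y * (β + (t - z.x) * u t) *
          ((β + (t - z.x) * u t) * V.conn1 (z.lift t) + z.y * κ t)) +
      c / 32 * ((z.branch t + z.y) ^ 2 * (2 * u t ^ 2 + 2 * (β + 2 * (t - z.x) * u t) * deriv u t +
        (t - z.x) ^ 2 * deriv u t ^ 2) + (β + (t - z.x) * u t) ^ 4)) z.x := by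
    fun_prop
  have h2 : ContinuousAt (fun t => z.branch t ^ 2 * z.y ^ 2) z.x := by fun_prop
  refine ((h2.isBigO_one_nhdsNE.mul_one_one hE).add h1.isBigO_one_nhdsNE).congr' ?_
    EventuallyEq.rfl
  filter_upwards [nhdsWithin_le_nhds z.eventually_eval_ne_zero, self_mem_nhdsWithin,
    nhdsWithin_le_nhds hY', nhdsWithin_le_nhds hb.eventually_analyticAt] with t hp ht hY't hbt
  have hδ : t - z.x ≠ 0 := sub_ne_zero.2 ht
  have hy0 : z.branch t ≠ 0 := by rw [← lift_y hp]; exact y_ne_zero _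
  have hz0 := z.y_ne_zero
  have hκt := hκ' t
  simp only [lift_self] at hκt
  have hdp : (z.lift t).p' = 2 * z.branch t * deriv z.branch t := by
    rw [p', lift_x hp, z.eval_derivative_eq hbt.differentiableAt]
  have hdz : z.p' = 2 * z.y * β := by
    rw [p', z.eval_derivative_eq hb.differentiableAt, branch_self, hβ]
  have e1 : (z.lift t).p' ^ 2 / (z.lift t).p = 4 * deriv z.branch t ^ 2 := by
    rw [hdp, lift_p hp]; field_simp; ring
  have e2 : z.p' ^ 2 / z.p = 4 * β ^ 2 := by
    rw [hdz, p_eq]; field_simp; ring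
  rw [← double_pole_cancel hδ (hY t) hκt, ← fourth_order_pole_cancel hδ rfl (hY t) hY't,
    nreg_eq V hV, nP_eq V hV, nP_eq V hV, e1, e2, lift_p hp, z.p_eq, hE', f, lift_y hp, lift_x hp]
  ring

/-- On the conjugate sheet the numerator `y₁ + y₂` of `f` vanishes along with the denominator. -/
theorem isBigO_f_conj_lift (z : S.RegularPoint) :
    (fun t => f (z.conj.lift t) z) =O[𝓝[≠] z.x] fun _ => (1 : ℂ) := by
  obtain ⟨v, hv, hv'⟩ := (z.conj.analyticAt_branch).exists_eq_add_mul
  have cv : ContinuousAt (fun t => v t ^ 2) z.x := hv.continuousAt.pow 2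
  refine cv.isBigO_one_nhdsNE.congr' ?_ EventuallyEq.rfl
  filter_upwards [nhdsWithin_le_nhds z.eventually_eval_ne_zero, self_mem_nhdsWithin] with t hp ht
  have hδ : t - z.x ≠ 0 := sub_ne_zero.2 ht
  rw [f, lift_y hp, lift_x hp, hv' t, branch_self, conj_y, conj_x]
  congr 1
  field_simp
  ring

/-- The conjugate of `z` is a different point of the surface, so the connected two-point function is
holomorphic there, while `f` stays bounded. -/
theorem isBigO_nreg_near (hV : V.one ≠ 0) (z : S.RegularPoint) :
    (fun w => V.nreg w z) =O[near z.x] fun _ => (1 : ℂ) := by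
  refine isBigO_near_of_lift z (V.isBigO_nreg_lift hV z) ?_
  have hf := isBigO_f_conj_lift z
  have h1 := ((isTame_p (S := S)).analyticAt z.conj
    (Set.notMem_empty _)).continuousAt.isBigO_one_nhdsNE
  have h2 := ((V.isXField_conn2 hV z).analyticAt_lift (z := z.conj)
    (by simpa using z.ne_conj)).continuousAt.isBigO_one_nhdsNE
  have h3 := ((V.isTame_nP hV).analyticAt z.conj
    (Set.notMem_empty _)).continuousAt.isBigO_one_nhdsNE
  have h4 : (fun t => z.p * ((z.conj.lift t).p * V.conn2 (z.conj.lift t) z) -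
      c / 32 * (f (z.conj.lift t) z * f (z.conj.lift t) z) -
      1 / 16 * (f (z.conj.lift t) z * (V.nP (z.conj.lift t) + V.nP z)))
      =O[𝓝[≠] z.x] fun _ => (1 : ℂ) :=
    (((h1.mul_one_one h2).const_mul_left _).sub ((hf.mul_one_one hf).const_mul_left _)).sub
      ((hf.mul_one_one (h3.add (isBigO_const_one ℂ _ _))).const_mul_left _)
  refine h4.congr_left fun t => ?_
  rw [nreg_eq V hV]; ring

end VirasoroState

end

/-! ### Comparison of the three-point function with the rational part in one variable -/

noncomputable section

open HyperellipticSurface RegularPoint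

namespace VirasoroState

variable {S : HyperellipticSurface} {c : ℂ} (V : VirasoroState S c)

/-- The function `R⁽⁰⁾` in terms of the normalized functions. -/
def nR (z₁ z₂ z₃ : S.RegularPoint) : ℂ :=
  c / 64 * f z₁ z₂ * f z₁ z₃ * f z₂ z₃ +
  1 / 64 * f z₁ z₂ * f z₁ z₃ * (V.nP z₂ + V.nP z₃) +
  1 / 64 * f z₁ z₂ * f z₂ z₃ * (V.nP z₁ + V.nP z₃) +
  1 / 64 * f z₁ z₃ * f z₂ z₃ * (V.nP z₁ + V.nP z₂) +
  1 / 4 * f z₁ z₂ * (V.nreg z₁ z₃ + V.nreg z₂ z₃) +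
  1 / 4 * f z₁ z₃ * (V.nreg z₁ z₂ + V.nreg z₂ z₃) +
  1 / 4 * f z₂ z₃ * (V.nreg z₁ z₂ + V.nreg z₁ z₃)

theorem R0_eq (z : Fin 3 → S.RegularPoint) : V.R0 z = V.nR (z 0) (z 1) (z 2) := by
  simp only [R0, nR, nP, nreg]
  ring

/-- The connected three-point function as a field in the first variable. -/
def connField (w z₂ z₃ : S.RegularPoint) : ℂ :=
  V.one⁻¹ * V.npoint ![w, z₂, z₃] - V.conn2 w z₂ * V.conn1 z₃ -
    V.conn2 z₂ z₃ * V.conn1 w - V.conn2 w z₃ * V.conn1 z₂ - V.conn1 w * V.conn1 z₂ * V.conn1 z₃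

/-- The difference of `⟨T(x₁) T(x₂) T(x₃)⟩_c p₁ p₂ p₃` and `R⁽⁰⁾`. -/
def diffField (w z₂ z₃ : S.RegularPoint) : ℂ :=
  V.connField w z₂ z₃ * (w.p * z₂.p * z₃.p) - V.nR w z₂ z₃

theorem nR_comm (hV : V.one ≠ 0) {z₁ z₂ z₃ : S.RegularPoint} (h12 : z₁ ≠ z₂) :
    V.nR z₁ z₂ z₃ = V.nR z₂ z₁ z₃ := by
  unfold nR
  rw [f_comm z₂ z₁, V.nreg_comm hV h12]
  ring

theorem nR_comm' (hV : V.one ≠ 0) {z₁ z₂ z₃ : S.RegularPoint} (h23 : z₂ ≠ z₃) :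
    V.nR z₁ z₂ z₃ = V.nR z₁ z₃ z₂ := by
  unfold nR
  rw [f_comm z₃ z₂, V.nreg_comm hV h23]
  ring

theorem diffField_comm' (hV : V.one ≠ 0) {z₁ z₂ z₃ : S.RegularPoint} (h12 : z₁ ≠ z₂)
    (h13 : z₁ ≠ z₃) (h23 : z₂ ≠ z₃) : V.diffField z₁ z₂ z₃ = V.diffField z₁ z₃ z₂ := by
  unfold diffField connField
  rw [V.nR_comm' hV h23, V.npoint_three_comm' h12 h13 h23, V.conn2_comm h23]
  ring

/-- The exponent `6 n` collects generous bounds: `2 n` for `f` and for `P`, and `4 n` for `reg`. Its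
value plays no role in the final degrees, which come from the projections. -/
theorem isTame_diffField (hV : V.one ≠ 0) {z₂ z₃ : S.RegularPoint} (h : z₂.x ≠ z₃.x) :
    IsTame {z₂.x, z₃.x} (6 * S.n) fun w => V.diffField w z₂ z₃ := by
  have hne : z₂ ≠ z₃ := fun h' => h (by rw [h'])
  have hC := ((isTame_p_mul (B := {z₂.x, z₃.x}) (V.isXField_conn3 hV hne) (by simp)).const_mul
    (z₂.p * z₃.p)).mono le_rfl (show S.n ≤ 6 * S.n by omega)
  have f12 := (isTame_f (S := S) z₂).mono (B' := {z₂.x, z₃.x}) (by simp) le_rfl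
  have f13 := (isTame_f (S := S) z₃).mono (B' := {z₂.x, z₃.x}) (by simp) le_rfl
  have r12 := (V.isTame_nreg hV z₂).mono (B' := {z₂.x, z₃.x}) (by simp) le_rfl
  have r13 := (V.isTame_nreg hV z₃).mono (B' := {z₂.x, z₃.x}) (by simp) le_rfl
  have P1 := (V.isTame_nP hV).mono (B' := {z₂.x, z₃.x}) (by simp) le_rfl
  have t1 := ((f12.mul f13).const_mul (c / 64 * f z₂ z₃ + 1 / 64 * (V.nP z₂ + V.nP z₃))).mono
    le_rfl (show 2 * S.n + 2 * S.n ≤ 6 * S.n by omega)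
  have t2 := ((f12.mul (P1.add (IsTame.const (V.nP z₃)))).const_mul (1 / 64 * f z₂ z₃)).mono
    le_rfl (show 2 * S.n + 2 * S.n ≤ 6 * S.n by omega)
  have t3 := ((f13.mul (P1.add (IsTame.const (V.nP z₂)))).const_mul (1 / 64 * f z₂ z₃)).mono
    le_rfl (show 2 * S.n + 2 * S.n ≤ 6 * S.n by omega)
  have t4 := ((f12.mul (r13.add (IsTame.const (V.nreg z₂ z₃)))).const_mul (1 / 4)).mono
    le_rfl (show 2 * S.n + 4 * S.n ≤ 6 * S.n by omega)
  have t5 := ((f13.mul (r12.add (IsTame.const (V.nreg z₂ z₃)))).const_mul (1 / 4)).mono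
    le_rfl (show 2 * S.n + 4 * S.n ≤ 6 * S.n by omega)
  have t6 := ((r12.add r13).const_mul (1 / 4 * f z₂ z₃)).mono
    le_rfl (show 4 * S.n ≤ 6 * S.n by omega)
  refine (hC.sub (((((t1.add t2).add t3).add t4).add t5).add t6)).congr fun w => ?_
  rw [diffField, connField, nR]
  ring

theorem tendsto_conj_lift (z : S.RegularPoint) :
    Tendsto z.conj.lift (𝓝[≠] z.x) (near z.x) := by
  refine tendsto_comap_iff.2 (Tendsto.congr' (f₁ := id) ?_ tendsto_id)
  filter_upwards [nhdsWithin_le_nhds z.eventually_eval_ne_zero] with t hp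
  exact (lift_x (z := z.conj) hp).symm

theorem isBigO_diffField_conj_lift (hV : V.one ≠ 0) {z₂ z₃ : S.RegularPoint} (h : z₂.x ≠ z₃.x) :
    (fun t => V.diffField (z₂.conj.lift t) z₂ z₃) =O[𝓝[≠] z₂.x] fun _ => (1 : ℂ) := by
  have hne : z₂ ≠ z₃ := fun h' => h (by rw [h'])
  have hmem : z₂.conj ∉ ({z₂, z₃} : Set S.RegularPoint) := by
    rintro (h1 | h1)
    · exact z₂.ne_conj h1
    · exact h (by rw [← conj_x z₂, h1])
  have hx : z₂.conj.x ∉ ({z₃.x} : Set ℂ) := by simpa using h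
  have hC := ((V.isXField_conn3 hV hne).analyticAt_lift hmem).continuousAt.isBigO_one_nhdsNE
  have hp := ((isTame_p (S := S)).analyticAt z₂.conj
    (Set.notMem_empty _)).continuousAt.isBigO_one_nhdsNE
  have f12 := isBigO_f_conj_lift z₂
  have f13 := ((isTame_f (S := S) z₃).analyticAt z₂.conj hx).continuousAt.isBigO_one_nhdsNE
  have r12 : (fun t => V.nreg (z₂.conj.lift t) z₂) =O[𝓝[≠] z₂.x] fun _ => (1 : ℂ) :=
    (V.isBigO_nreg_near hV z₂).comp_tendsto (tendsto_conj_lift z₂)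
  have r13 := ((V.isTame_nreg hV z₃).analyticAt z₂.conj hx).continuousAt.isBigO_one_nhdsNE
  have P1 := ((V.isTame_nP hV).analyticAt z₂.conj
    (Set.notMem_empty _)).continuousAt.isBigO_one_nhdsNE
  rw [conj_x] at hC hp f13 r13 P1
  have hc : ∀ k : ℂ, (fun _ : ℂ => k) =O[𝓝[≠] z₂.x] fun _ => (1 : ℂ) :=
    fun k => isBigO_const_one ℂ k _
  have t0 := (hC.mul_one_one hp).const_mul_left (z₂.p * z₃.p)
  have t1 := (f12.mul_one_one f13).const_mul_left
    (c / 64 * f z₂ z₃ + 1 / 64 * (V.nP z₂ + V.nP z₃))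
  have t2 := (f12.mul_one_one (P1.add (hc (V.nP z₃)))).const_mul_left (1 / 64 * f z₂ z₃)
  have t3 := (f13.mul_one_one (P1.add (hc (V.nP z₂)))).const_mul_left (1 / 64 * f z₂ z₃)
  have t4 := (f12.mul_one_one (r13.add (hc (V.nreg z₂ z₃)))).const_mul_left (1 / 4)
  have t5 := (f13.mul_one_one (r12.add (hc (V.nreg z₂ z₃)))).const_mul_left (1 / 4)
  have t6 := (r12.add r13).const_mul_left (1 / 4 * f z₂ z₃)
  refine (t0.sub (((((t1.add t2).add t3).add t4).add t5).add t6)).congr_left fun t => ?_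
  rw [diffField, connField, nR]
  ring

/-- This isolates the behaviour as `z₁` approaches `z₂`. Expressing `reg` in the terms multiplied by
`f z₁ z₂` through `conn2` leaves the double pole dictated by the OPE, and products of two
differences that vanish at coincidence and so absorb the double pole of `f z₁ z₂`. -/
theorem nR_eq (hV : V.one ≠ 0) (z₁ z₂ z₃ : S.RegularPoint) :
    V.nR z₁ z₂ z₃ =
      f z₁ z₂ / 4 * (z₃.p * (z₁.p * V.conn2 z₁ z₃ + z₂.p * V.conn2 z₂ z₃)) +
      f z₁ z₂ * (-c / 128 * (f z₁ z₃ - f z₂ z₃) ^ 2 -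
        1 / 64 * ((f z₁ z₃ - f z₂ z₃) * (V.nP z₁ - V.nP z₂))) +
      1 / 4 * ((f z₁ z₃ + f z₂ z₃) * V.nreg z₁ z₂) +
      1 / 4 * (f z₁ z₃ * V.nreg z₂ z₃ + f z₂ z₃ * V.nreg z₁ z₃) +
      1 / 64 * f z₂ z₃ * (f z₁ z₃ * (V.nP z₁ + V.nP z₂)) := by
  have h₁ := nreg_eq V hV z₁ z₃
  have h₂ := nreg_eq V hV z₂ z₃
  rw [nR]
  linear_combination 1 / 4 * f z₁ z₂ * h₁ + 1 / 4 * f z₁ z₂ * h₂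

theorem isBigO_diffField_lift (hV : V.one ≠ 0) {z w : S.RegularPoint} (h : z.x ≠ w.x) :
    (fun t => V.diffField (z.lift t) z w) =O[𝓝[≠] z.x] fun _ => (1 : ℂ) := by
  have hne : z ≠ w := fun h' => h (by rw [h'])
  obtain ⟨E, hE, hE'⟩ := V.exists_conn3_lift_eq hV hne
  have hb := z.analyticAt_branch
  obtain ⟨v, hv, hv'⟩ := hb.exists_eq_add_mul
  have hC := (V.isXField_conn2 hV w).analyticAt_lift (z := z) (by simpa using hne)
  obtain ⟨κ, hκ, hκ'⟩ := hC.exists_eq_add_mul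
  have hP := (V.isTame_nP hV).analyticAt z (Set.notMem_empty _)
  obtain ⟨π, hπ, hπ'⟩ := hP.exists_eq_add_mul
  have hf := (isTame_f (S := S) w).analyticAt z (by simpa using h)
  obtain ⟨φ, hφ, hφ'⟩ := hf.exists_eq_add_mul
  have cb := hb.continuousAt
  have cv := hv.continuousAt
  have cC := hC.continuousAt
  have cκ := hκ.continuousAt
  have cP := hP.continuousAt
  have cπ := hπ.continuousAt
  have cf := hf.continuousAt
  have cr := ((V.isTame_nreg hV w).analyticAt z (by simpa using h)).continuousAt
  have cφ := hφ.continuousAt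
  -- These are the terms left after cancelling all poles: `v`, `κ`, `π`, `φ` are the difference
  -- quotients of the branch, of `conn2 · w`, of `nP` and of `f · w`.
  have h1 : ContinuousAt (fun t =>
      w.p * (-v t ^ 2 / 4 * (z.branch t ^ 2 * V.conn2 (z.lift t) w + z.y ^ 2 * V.conn2 z w) -
        z.branch t * z.y * v t * (v t * V.conn2 (z.lift t) w + z.y * κ t)) -
      (z.branch t + z.y) ^ 2 * (-c / 128 * φ t ^ 2 - 1 / 64 * (φ t * π t)) -
      1 / 4 * (f (z.lift t) w * V.nreg z w + f z w * V.nreg (z.lift t) w) -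
      1 / 64 * f z w * (f (z.lift t) w * (V.nP (z.lift t) + V.nP z))) z.x := by
    fun_prop
  have h2 : ContinuousAt (fun t => z.branch t ^ 2 * z.y ^ 2 * w.p) z.x := by fun_prop
  have h3 : ContinuousAt (fun t => -1 / 4 * (f (z.lift t) w + f z w)) z.x := by fun_prop
  have hr := V.isBigO_nreg_lift hV z
  refine (((h2.isBigO_one_nhdsNE.mul_one_one hE).add h1.isBigO_one_nhdsNE).add
    (h3.isBigO_one_nhdsNE.mul_one_one hr)).congr' ?_ EventuallyEq.rfl
  filter_upwards [nhdsWithin_le_nhds z.eventually_eval_ne_zero, self_mem_nhdsWithin, hE',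
    ne_lift_of_ne (z := z) (w := w)] with t hp ht hEt hlt
  have hδ : t - z.x ≠ 0 := sub_ne_zero.2 ht
  have hvt := hv' t
  rw [branch_self] at hvt
  have hκt := hκ' t
  have hπt := hπ' t
  have hφt := hφ' t
  simp only [lift_self] at hκt hπt hφt
  have e1 : f (z.lift t) z = ((z.branch t + z.y) / (t - z.x)) ^ 2 := by
    rw [f, lift_y hp, lift_x hp]
  have e2 : f (z.lift t) z * (-c / 128 * (f (z.lift t) w - f z w) ^ 2 -
      1 / 64 * ((f (z.lift t) w - f z w) * (V.nP (z.lift t) - V.nP z))) =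
      (z.branch t + z.y) ^ 2 * (-c / 128 * φ t ^ 2 - 1 / 64 * (φ t * π t)) := by
    rw [e1, hφt, hπt]
    field_simp
    ring
  rw [← double_pole_cancel hδ hvt hκt, diffField, nR_eq V hV, e2, connField,
    ← V.conn3_eq hlt, hEt, e1, lift_p hp, z.p_eq]
  ring

theorem isBigO_diffField_near (hV : V.one ≠ 0) {z₂ z₃ : S.RegularPoint} (h : z₂.x ≠ z₃.x) :
    (fun w => V.diffField w z₂ z₃) =O[near z₂.x] fun _ => (1 : ℂ) :=
  isBigO_near_of_lift z₂ (V.isBigO_diffField_lift hV h) (V.isBigO_diffField_conj_lift hV h)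

theorem exists_polynomials_diffField (hV : V.one ≠ 0) {z₂ z₃ : S.RegularPoint} (h : z₂.x ≠ z₃.x) :
    ∃ F G : ℂ[X], F.natDegree ≤ 6 * S.n ∧ G.natDegree ≤ 6 * S.n ∧
      ∀ w : S.RegularPoint, w.x ≠ z₂.x → w.x ≠ z₃.x →
        V.diffField w z₂ z₃ = F.eval w.x + w.y * G.eval w.x := by
  have ht := V.isTame_diffField hV h
  obtain ⟨F, G, h1, h2, h3⟩ := exists_polynomials {z₂.x, z₃.x} (by simpa using ht.analyticAt) (by
    rintro a (ha | ha)
    · simp only [Finset.mem_insert, Finset.mem_singleton] at ha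
      rcases ha with rfl | rfl
      · exact V.isBigO_diffField_near hV h
      -- The second pole follows from the first by exchanging `z₂` and `z₃`, which is allowed where
      -- the three points are distinct.
      · refine (V.isBigO_diffField_near hV h.symm).congr' ?_ EventuallyEq.rfl
        have hfin : ({z₂.x, z₃.x} : Set ℂ).Finite := by simp
        filter_upwards [(tendsto_x_near (S := S) z₃.x).eventually
          (hfin.eventually_notMem_nhdsNE z₃.x)] with w hw
        simp only [Set.mem_insert_iff, Set.mem_singleton_iff, not_or] at hw
        exact V.diffField_comm' hV (fun h' => hw.2 (by rw [h'])) (fun h' => hw.1 (by rw [h']))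
          (fun h' => h (by rw [h']))
    · exact ht.near_branch a ha) ht.atInfinity
  exact ⟨F, G, h1, h2, fun w hw hw' => h3 w (by simp [hw, hw'])⟩

theorem exists_polynomials_nreg (hV : V.one ≠ 0) (z : S.RegularPoint) :
    ∃ F G : ℂ[X], F.natDegree ≤ 4 * S.n ∧ G.natDegree ≤ 4 * S.n ∧
      ∀ w : S.RegularPoint, w.x ≠ z.x → V.nreg w z = F.eval w.x + w.y * G.eval w.x := by
  have ht := V.isTame_nreg hV z
  obtain ⟨F, G, h1, h2, h3⟩ := exists_polynomials {z.x} (by simpa using ht.analyticAt) (by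
    rintro a (ha | ha)
    · rw [Finset.mem_singleton] at ha
      rw [ha]
      exact V.isBigO_nreg_near hV z
    · exact ht.near_branch a ha) ht.atInfinity
  exact ⟨F, G, h1, h2, fun w hw => h3 w (by simp [hw])⟩

theorem exists_polynomials_nP (hV : V.one ≠ 0) :
    ∃ F G : ℂ[X], F.natDegree ≤ 2 * S.n ∧ G.natDegree ≤ 2 * S.n ∧
      ∀ w : S.RegularPoint, V.nP w = F.eval w.x + w.y * G.eval w.x := by
  have ht := V.isTame_nP hV
  obtain ⟨F, G, h1, h2, h3⟩ := exists_polynomials ∅ (by simpa using ht.analyticAt)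
    (by
      rintro a (ha | ha)
      · simp at ha
      · exact ht.near_branch a ha) ht.atInfinity
  exact ⟨F, G, h1, h2, fun w => h3 w (by simp)⟩

/-- The behaviour of the connected three-point function at infinity. -/
theorem isBigO_G3 (hV : V.one ≠ 0) (hn : Odd S.n) {z₂ z₃ : S.RegularPoint} (h : z₂ ≠ z₃) :
    (fun z₁ : S.RegularPoint => V.G3 ![z₁, z₂, z₃]) =O[RegularPoint.atInfinity]
      fun z₁ => z₁.x ^ (S.n - 3) := by
  have hdeg : S.p.natDegree = 2 * S.g + 1 := by
    rcases S.natDegree_p with h | h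
    · exact h
    · rw [n, h] at hn
      exact absurd hn (by rw [Nat.not_odd_iff_even]; exact ⟨S.g + 1, by ring⟩)
  -- The exponent `n - 3` is a subtraction of natural numbers; it is not truncated because `g ≥ 1`.
  have h3 : 3 ≤ S.n := by
    have := S.one_le_g
    unfold n; omega
  have h1 := ((isTame_p (S := S)).atInfinity.mul
    ((V.isXField_conn3 hV h).isBigO_atInfinity_of_odd hdeg)).const_mul_left (z₂.p * z₃.p)
  refine h1.congr' ?_ ?_
  · filter_upwards [eventually_atInfinity (S := S)
      (Set.finite_singleton z₃.x).eventually_notMem_cobounded] with w hw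
    have hne : w ≠ z₃ := by rintro rfl; exact hw rfl
    show _ = V.conn3 w z₂ z₃ * (w.p * z₂.p * z₃.p)
    rw [V.conn3_eq hne]
    ring
  · filter_upwards [eventually_x_ne_zero] with w hw
    obtain ⟨k, hk⟩ := Nat.exists_eq_add_of_le h3
    rw [hk, Nat.add_sub_cancel_left, pow_add]
    field_simp

end VirasoroState

end

/-! ### From separate to joint polynomiality -/

noncomputable section

open HyperellipticSurface RegularPoint

namespace HyperellipticSurface

variable {S : HyperellipticSurface}

/-- The monomial `∏ i ∈ s, y_i * ∏ i, x_i ^ m_i`. -/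
def mono {N : ℕ} (j : Finset (Fin N) × (Fin N →₀ ℕ)) (z : Fin N → S.RegularPoint) : ℂ :=
  (∏ i ∈ j.1, (z i).y) * ∏ i, (z i).x ^ j.2 i

/-- The linear combination of monomials with the given coefficients. -/
def monoSum {N : ℕ} (a : Finset (Fin N) × (Fin N →₀ ℕ) →₀ ℂ) (z : Fin N → S.RegularPoint) : ℂ :=
  a.sum fun j k => k * mono j z

/-- A function of `N` points which, at points with distinct `x`-coordinates, is a polynomial in
the coordinates. -/
def IsPolyFun {N : ℕ} (Q : (Fin N → S.RegularPoint) → ℂ) : Prop :=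
  ∃ a, ∀ z : Fin N → S.RegularPoint, (Function.Injective fun i => (z i).x) → Q z = monoSum a z

namespace IsPolyFun

variable {N : ℕ} {Q R : (Fin N → S.RegularPoint) → ℂ}

theorem congr (h : IsPolyFun Q)
    (hR : ∀ z : Fin N → S.RegularPoint, (Function.Injective fun i => (z i).x) → R z = Q z) :
    IsPolyFun R := by
  obtain ⟨a, ha⟩ := h
  exact ⟨a, fun z hz => (hR z hz).trans (ha z hz)⟩

theorem add (h : IsPolyFun Q) (h' : IsPolyFun R) : IsPolyFun fun z => Q z + R z := by
  obtain ⟨a, ha⟩ := h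
  obtain ⟨b, hb⟩ := h'
  refine ⟨a + b, fun z hz => ?_⟩
  beta_reduce
  rw [ha z hz, hb z hz, monoSum, monoSum, monoSum, Finsupp.sum_add_index' (by simp)]
  intro j k l
  ring

theorem monomial (j : Finset (Fin N) × (Fin N →₀ ℕ)) (k : ℂ) :
    IsPolyFun fun z : Fin N → S.RegularPoint => k * mono j z :=
  ⟨Finsupp.single j k, fun z _ => by simp [monoSum]⟩

theorem zero : IsPolyFun fun _ : Fin N → S.RegularPoint => 0 :=
  ⟨0, fun z _ => by simp [monoSum]⟩

theorem sum {ι : Type*} (s : Finset ι) {Q : ι → (Fin N → S.RegularPoint) → ℂ}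
    (h : ∀ i ∈ s, IsPolyFun (Q i)) : IsPolyFun fun z => ∑ i ∈ s, Q i z := by
  classical
  induction s using Finset.induction_on with
  | empty => simpa using zero
  | insert i s hi ih =>
    simp only [Finset.sum_insert hi]
    exact (h i (by simp)).add (ih fun i' hi' => h i' (by simp [hi']))

theorem tail_mul_x_pow (h : IsPolyFun Q) (m : ℕ) :
    IsPolyFun fun z : Fin (N + 1) → S.RegularPoint => Q (Fin.tail z) * (z 0).x ^ m := by
  obtain ⟨a, ha⟩ := h
  refine (sum a.support fun j _ => monomial (S := S)
    (j.1.map (Fin.succEmb N), Finsupp.cons m j.2) (a j)).congr fun z hz => ?_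
  rw [ha (Fin.tail z) (hz.comp (Fin.succ_injective N)), monoSum, Finsupp.sum, Finset.sum_mul]
  refine Finset.sum_congr rfl fun j _ => ?_
  simp [mono, Fin.prod_univ_succ, Fin.tail]
  ring

theorem tail_mul_x_pow_mul_y (h : IsPolyFun Q) (m : ℕ) :
    IsPolyFun fun z : Fin (N + 1) → S.RegularPoint =>
      Q (Fin.tail z) * (z 0).x ^ m * (z 0).y := by
  obtain ⟨a, ha⟩ := h
  refine (sum a.support fun j _ => monomial (S := S)
    (insert 0 (j.1.map (Fin.succEmb N)), Finsupp.cons m j.2) (a j)).congr fun z hz => ?_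
  rw [ha (Fin.tail z) (hz.comp (Fin.succ_injective N)), monoSum, Finsupp.sum, Finset.sum_mul,
    Finset.sum_mul]
  refine Finset.sum_congr rfl fun j _ => ?_
  have : (0 : Fin (N + 1)) ∉ j.1.map (Fin.succEmb N) := by simp [Fin.succ_ne_zero]
  simp [mono, Fin.prod_univ_succ, Fin.tail, Finset.prod_insert this]
  ring

end IsPolyFun

/-- In each of its variables, the function has the form `A x + y B x` with polynomials `A` and `B`
of degree at most `D`. -/
def IsSeparatelyPoly {N : ℕ} (D : ℕ) (Q : (Fin N → S.RegularPoint) → ℂ) : Prop :=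
  ∀ (i : Fin N) (z : Fin N → S.RegularPoint), (Function.Injective fun i => (z i).x) →
    ∃ F G : ℂ[X], F.natDegree ≤ D ∧ G.natDegree ≤ D ∧ ∀ w : S.RegularPoint,
      (Function.Injective fun j => (Function.update z i w j).x) →
        Q (Function.update z i w) = F.eval w.x + w.y * G.eval w.x

theorem infinite_x (T : Finset ℂ) : {t | t ∉ T ∧ S.p.eval t ≠ 0}.Infinite := by
  have h : ((T : Set ℂ) ∪ {t | S.p.eval t = 0}).Finite :=
    T.finite_toSet.union (finite_eval_eq_zero S)
  refine h.infinite_compl.mono fun t ht => ?_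
  simpa [not_or] using ht

theorem exists_nodes (T : Finset ℂ) (k : ℕ) : ∃ (s : Finset ℂ) (g : ℂ → S.RegularPoint),
    s.card = k ∧ (∀ t ∈ s, t ∉ T) ∧ ∀ t ∈ s, (g t).x = t := by
  obtain ⟨t₀, _, ht₀⟩ := (infinite_x (S := S) T).nonempty
  obtain ⟨w₀, _⟩ := exists_x_eq ht₀
  have h : ∀ t, ∃ w : S.RegularPoint, S.p.eval t ≠ 0 → w.x = t := by
    intro t
    by_cases ht : S.p.eval t = 0
    · exact ⟨w₀, fun h => absurd ht h⟩
    · obtain ⟨w, hw⟩ := exists_x_eq ht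
      exact ⟨w, fun _ => hw⟩
  choose g hg using h
  obtain ⟨s, hs, hs'⟩ := (infinite_x (S := S) T).exists_subset_card_eq k
  exact ⟨s, g, hs', fun t ht => (hs ht).1, fun t ht => hg t (hs ht).2⟩

/-- Comparing a point with its conjugate separates even and odd parts; each is then determined by
its values at infinitely many `x`. -/
theorem eq_of_eval_add_y_mul_eval_eq (T : Finset ℂ) {F G F' G' : ℂ[X]}
    (h : ∀ w : S.RegularPoint, w.x ∉ T →
      F.eval w.x + w.y * G.eval w.x = F'.eval w.x + w.y * G'.eval w.x) : F = F' ∧ G = G' := by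
  have key : ∀ t, t ∉ T → S.p.eval t ≠ 0 → F.eval t = F'.eval t ∧ G.eval t = G'.eval t := by
    intro t ht hp
    obtain ⟨w, rfl⟩ := exists_x_eq hp
    have h1 := h w ht
    have h2 := h w.conj ht
    simp only [conj_x, conj_y] at h2
    refine ⟨by linear_combination (h1 + h2) / 2, mul_left_cancel₀ w.y_ne_zero ?_⟩
    linear_combination (h1 - h2) / 2
  refine ⟨Polynomial.eq_of_infinite_eval_eq _ _ ((infinite_x (S := S) T).mono fun t ht =>
    (key t ht.1 ht.2).1), Polynomial.eq_of_infinite_eval_eq _ _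
    ((infinite_x (S := S) T).mono fun t ht => (key t ht.1 ht.2).2)⟩

theorem injective_x_cons {N : ℕ} {w : S.RegularPoint} {z : Fin N → S.RegularPoint} :
    (Function.Injective fun i => ((Fin.cons w z : Fin (N + 1) → S.RegularPoint) i).x) ↔
      (∀ j, (z j).x ≠ w.x) ∧ Function.Injective fun i => (z i).x := by
  have : (fun i => ((Fin.cons w z : Fin (N + 1) → S.RegularPoint) i).x) =
      Fin.cons w.x fun i => (z i).x := by
    funext i
    refine Fin.cases rfl (fun _ => rfl) i
  rw [this, Fin.cons_injective_iff]
  simp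

/-- A function that is given by finite linear combinations of values of a separately polynomial
function is separately polynomial. -/
theorem IsSeparatelyPoly.of_sum {N D : ℕ} {Q : (Fin (N + 1) → S.RegularPoint) → ℂ}
    (hQ : IsSeparatelyPoly D Q) {q : (Fin N → S.RegularPoint) → ℂ}
    (hq : ∀ T : Finset ℂ, ∃ (s : Finset ℂ) (g : ℂ → S.RegularPoint) (k k' : ℂ → ℂ),
      (∀ t ∈ s, t ∉ T ∧ (g t).x = t) ∧ ∀ z : Fin N → S.RegularPoint,
        (Function.Injective fun i => (z i).x) → (∀ j, (z j).x ∉ s) →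
        q z = ∑ t ∈ s, (k t * Q (Fin.cons (g t) z) + k' t * Q (Fin.cons (g t).conj z))) :
    IsSeparatelyPoly D q := by
  classical
  intro i z hz
  have key : ∀ T : Finset ℂ, ∃ (s : Finset ℂ) (F G : ℂ[X]), (∀ t ∈ s, t ∉ T) ∧ F.natDegree ≤ D ∧
      G.natDegree ≤ D ∧ ∀ w : S.RegularPoint, w.x ∉ s →
      (Function.Injective fun j => (Function.update z i w j).x) →
        q (Function.update z i w) = F.eval w.x + w.y * G.eval w.x := by
    intro T
    obtain ⟨s, g, k, k', hs, hsum⟩ := hq (T ∪ Finset.univ.image fun j => (z j).x)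
    have hs' : ∀ t ∈ s, ∀ j, (z j).x ≠ t := by
      intro t ht j h
      exact (hs t ht).1 (Finset.mem_union_right _ (Finset.mem_image.2 ⟨j, Finset.mem_univ _, h⟩))
    have h1 : ∀ t, ∃ F G : ℂ[X], F.natDegree ≤ D ∧ G.natDegree ≤ D ∧ (t ∈ s →
        ∀ w : S.RegularPoint, w.x ∉ s → (Function.Injective fun j => (Function.update z i w j).x) →
        k t * Q (Fin.cons (g t) (Function.update z i w)) +
          k' t * Q (Fin.cons (g t).conj (Function.update z i w)) =
          F.eval w.x + w.y * G.eval w.x) := by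
      intro t
      by_cases ht : t ∈ s
      swap
      · exact ⟨0, 0, by simp, by simp, fun h => absurd h ht⟩
      have hgt := (hs t ht).2
      obtain ⟨F, G, hF, hG, hFG⟩ := hQ i.succ (Fin.cons (g t) z)
        (injective_x_cons.2 ⟨by rw [hgt]; exact hs' t ht, hz⟩)
      obtain ⟨F', G', hF', hG', hFG'⟩ := hQ i.succ (Fin.cons (g t).conj z)
        (injective_x_cons.2 ⟨by rw [conj_x, hgt]; exact hs' t ht, hz⟩)
      refine ⟨Polynomial.C (k t) * F + Polynomial.C (k' t) * F',
        Polynomial.C (k t) * G + Polynomial.C (k' t) * G', ?_, ?_, fun _ w hw hinj => ?_⟩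
      · exact (Polynomial.natDegree_add_le _ _).trans (max_le
          ((Polynomial.natDegree_C_mul_le _ _).trans hF)
          ((Polynomial.natDegree_C_mul_le _ _).trans hF'))
      · exact (Polynomial.natDegree_add_le _ _).trans (max_le
          ((Polynomial.natDegree_C_mul_le _ _).trans hG)
          ((Polynomial.natDegree_C_mul_le _ _).trans hG'))
      · have hj : ∀ j, (Function.update z i w j).x ≠ t := by
          intro j h
          rcases eq_or_ne j i with rfl | hji
          · rw [Function.update_self] at h
            exact hw (h ▸ ht)
          · rw [Function.update_of_ne hji] at h
            exact hs' t ht j h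
        have e1 := hFG w (by
          rw [← Fin.cons_update, injective_x_cons]
          exact ⟨by rw [hgt]; exact hj, hinj⟩)
        have e2 := hFG' w (by
          rw [← Fin.cons_update, injective_x_cons]
          exact ⟨by rw [conj_x, hgt]; exact hj, hinj⟩)
        rw [← Fin.cons_update] at e1 e2
        rw [e1, e2]
        simp only [Polynomial.eval_add, Polynomial.eval_mul, Polynomial.eval_C]
        ring
    choose F G hF hG hFG using h1
    refine ⟨s, ∑ t ∈ s, F t, ∑ t ∈ s, G t, fun t ht h => (hs t ht).1 (Finset.mem_union_left _ h),
      Polynomial.natDegree_sum_le_of_forall_le _ _ fun t _ => hF t,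
      Polynomial.natDegree_sum_le_of_forall_le _ _ fun t _ => hG t, fun w hw hinj => ?_⟩
    rw [hsum _ hinj, Polynomial.eval_finsetSum, Polynomial.eval_finsetSum, Finset.mul_sum,
      ← Finset.sum_add_distrib]
    · exact Finset.sum_congr rfl fun t ht => hFG t ht w hw hinj
    · intro j
      rcases eq_or_ne j i with rfl | hji
      · rwa [Function.update_self]
      · rw [Function.update_of_ne hji]
        exact fun h => hs' _ h j rfl
  obtain ⟨s, F, G, -, hF, hG, h⟩ := key ∅
  obtain ⟨s', F', G', hs', -, -, h'⟩ := key s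
  -- The two representations agree away from both node sets and the fixed points, hence their
  -- polynomials coincide.
  have heq : F = F' ∧ G = G' := by
    refine eq_of_eval_add_y_mul_eval_eq (S := S)
      ((s ∪ s') ∪ Finset.univ.image fun j => (z j).x) fun w hw => ?_
    simp only [Finset.mem_union, not_or, Finset.mem_image, Finset.mem_univ, true_and,
      not_exists] at hw
    have hinj : Function.Injective fun j => (Function.update z i w j).x := by
      intro j l hjl
      by_contra hne
      dsimp only at hjl
      rcases eq_or_ne j i with rfl | hji
      · rw [Function.update_self, Function.update_of_ne (Ne.symm hne)] at hjl
        exact hw.2 l hjl.symm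
      · rcases eq_or_ne l i with rfl | hli
        · rw [Function.update_self, Function.update_of_ne hne] at hjl
          exact hw.2 j hjl
        · rw [Function.update_of_ne hji, Function.update_of_ne hli] at hjl
          exact hne (hz hjl)
    rw [← h w hw.1.1 hinj, ← h' w hw.1.2 hinj]
  refine ⟨F, G, hF, hG, fun w hinj => ?_⟩
  by_cases hw : w.x ∈ s
  · rw [heq.1, heq.2]
    exact h' w (fun h => hs' _ h hw) hinj
  · exact h w hw hinj

/-- Lagrange interpolation: coefficients are fixed linear combinations of values at fixed nodes.
This transfers polynomial dependence on the other variables from values to coefficients. -/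
theorem coeff_eq_sum_nodes {D : ℕ} {F : ℂ[X]} (hF : F.natDegree ≤ D) {s : Finset ℂ}
    (hs : s.card = D + 1) (m : ℕ) :
    F.coeff m = ∑ t ∈ s, (Lagrange.basis s id t).coeff m * F.eval t := by
  have h1 : F.degree < s.card := by
    rw [hs]
    exact Polynomial.degree_le_natDegree.trans_lt (by exact_mod_cast Nat.lt_succ_of_le hF)
  have h2 := Lagrange.eq_interpolate (s := s) (v := id) (f := F) (fun _ _ _ _ h => h) h1
  conv_lhs => rw [h2]
  rw [Lagrange.interpolate_apply, Polynomial.finsetSum_coeff]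
  refine Finset.sum_congr rfl fun t _ => ?_
  rw [Polynomial.coeff_C_mul, mul_comm]
  rfl

/-- A separately polynomial function is polynomial. -/
theorem IsSeparatelyPoly.isPolyFun {N : ℕ} : ∀ {D : ℕ} {Q : (Fin N → S.RegularPoint) → ℂ},
    IsSeparatelyPoly D Q → IsPolyFun Q := by
  classical
  induction N with
  | zero =>
    intro D Q _
    refine (IsPolyFun.monomial (∅, 0) (Q Fin.elim0)).congr fun z _ => ?_
    rw [Subsingleton.elim z Fin.elim0]
    simp [mono]
  | succ N ih =>
    intro D Q hQ
    have h1 : ∀ z : Fin N → S.RegularPoint, ∃ F G : ℂ[X], (Function.Injective fun i => (z i).x) →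
        F.natDegree ≤ D ∧ G.natDegree ≤ D ∧ ∀ w : S.RegularPoint, (∀ j, (z j).x ≠ w.x) →
        Q (Fin.cons w z) = F.eval w.x + w.y * G.eval w.x := by
      intro z
      by_cases hz : Function.Injective fun i => (z i).x
      swap
      · exact ⟨0, 0, fun h => absurd h hz⟩
      obtain ⟨t, ht, hp⟩ := (infinite_x (S := S) (Finset.univ.image fun j => (z j).x)).nonempty
      obtain ⟨w₀, rfl⟩ := exists_x_eq hp
      have hw₀ : ∀ j, (z j).x ≠ w₀.x := by simpa using ht
      obtain ⟨F, G, hF, hG, hFG⟩ := hQ 0 (Fin.cons w₀ z) (injective_x_cons.2 ⟨hw₀, hz⟩)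
      refine ⟨F, G, fun _ => ⟨hF, hG, fun w hw => ?_⟩⟩
      have := hFG w
      rw [Fin.update_cons_zero] at this
      exact this (injective_x_cons.2 ⟨hw, hz⟩)
    choose F G hFG using h1
    -- The value of `F z` at a node is the average of `Q` over the two conjugate points, so `of_sum`
    -- applies with fixed nodes. For `G z` below, half the difference is divided by `y`.
    have hA : ∀ m, IsSeparatelyPoly D fun z : Fin N → S.RegularPoint => (F z).coeff m := by
      intro m
      refine hQ.of_sum fun T => ?_
      obtain ⟨s, g, hs, hsT, hg⟩ := exists_nodes (S := S) T (D + 1)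
      refine ⟨s, g, fun t => (Lagrange.basis s id t).coeff m / 2,
        fun t => (Lagrange.basis s id t).coeff m / 2, fun t ht => ⟨hsT t ht, hg t ht⟩,
        fun z hz hzs => ?_⟩
      obtain ⟨hF, hG, h⟩ := hFG z hz
      rw [coeff_eq_sum_nodes hF hs]
      refine Finset.sum_congr rfl fun t ht => ?_
      have hj : ∀ j, (z j).x ≠ t := fun j hj => hzs j (hj ▸ ht)
      rw [h (g t) (by rwa [hg t ht]), h (g t).conj (by rwa [conj_x, hg t ht]), conj_x, conj_y,
        hg t ht]
      ring
    have hB : ∀ m, IsSeparatelyPoly D fun z : Fin N → S.RegularPoint => (G z).coeff m := by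
      intro m
      refine hQ.of_sum fun T => ?_
      obtain ⟨s, g, hs, hsT, hg⟩ := exists_nodes (S := S) T (D + 1)
      refine ⟨s, g, fun t => (Lagrange.basis s id t).coeff m / (2 * (g t).y),
        fun t => -(Lagrange.basis s id t).coeff m / (2 * (g t).y),
        fun t ht => ⟨hsT t ht, hg t ht⟩, fun z hz hzs => ?_⟩
      obtain ⟨hF, hG, h⟩ := hFG z hz
      rw [coeff_eq_sum_nodes hG hs]
      refine Finset.sum_congr rfl fun t ht => ?_
      have hj : ∀ j, (z j).x ≠ t := fun j hj => hzs j (hj ▸ ht)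
      have hy := (g t).y_ne_zero
      rw [h (g t) (by rwa [hg t ht]), h (g t).conj (by rwa [conj_x, hg t ht]), conj_x, conj_y,
        hg t ht]
      field_simp
      ring
    refine ((IsPolyFun.sum (Finset.range (D + 1)) fun m _ => (ih (hA m)).tail_mul_x_pow m).add
      (IsPolyFun.sum (Finset.range (D + 1)) fun m _ =>
        (ih (hB m)).tail_mul_x_pow_mul_y m)).congr fun z hz => ?_
    rw [← Fin.cons_self_tail z] at hz ⊢
    rw [injective_x_cons] at hz
    obtain ⟨hF, hG, h⟩ := hFG _ hz.2
    rw [h _ hz.1, Polynomial.eval_eq_sum_range' (Nat.lt_succ_of_le hF),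
      Polynomial.eval_eq_sum_range' (Nat.lt_succ_of_le hG), Finset.mul_sum]
    simp only [Fin.tail_cons, Fin.cons_zero]
    congr 1
    refine Finset.sum_congr rfl fun m _ => ?_
    ring

/-- For symmetric functions, it suffices to look at the first variable. -/
theorem IsSeparatelyPoly.of_symmetric {N D : ℕ} {Q : (Fin (N + 1) → S.RegularPoint) → ℂ}
    (hsymm : ∀ (i : Fin (N + 1)) (z : Fin (N + 1) → S.RegularPoint),
      (Function.Injective fun i => (z i).x) → Q (z ∘ Equiv.swap 0 i) = Q z)
    (h : ∀ z : Fin N → S.RegularPoint, (Function.Injective fun i => (z i).x) →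
      ∃ F G : ℂ[X], F.natDegree ≤ D ∧ G.natDegree ≤ D ∧ ∀ w : S.RegularPoint,
        (∀ j, (z j).x ≠ w.x) → Q (Fin.cons w z) = F.eval w.x + w.y * G.eval w.x) :
    IsSeparatelyPoly D Q := by
  intro i z hz
  set σ := Equiv.swap 0 i
  have hz' : Function.Injective fun j => ((z ∘ σ) j).x := hz.comp σ.injective
  obtain ⟨F, G, hF, hG, hFG⟩ := h (Fin.tail (z ∘ σ)) (hz'.comp (Fin.succ_injective N))
  refine ⟨F, G, hF, hG, fun w hw => ?_⟩
  have e : Function.update z i w ∘ σ = Fin.cons w (Fin.tail (z ∘ σ)) := by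
    funext j
    refine Fin.cases ?_ (fun l => ?_) j
    · simp [σ]
    · have : σ l.succ ≠ i := by
        intro h
        have h2 : l.succ = σ i := by rw [← h, Equiv.swap_apply_self]
        rw [Equiv.swap_apply_right] at h2
        exact Fin.succ_ne_zero l h2
      simp [Function.update_of_ne this, Fin.tail]
  have hw' : Function.Injective fun j => ((Function.update z i w ∘ σ) j).x := hw.comp σ.injective
  rw [← hsymm i _ hw, show Equiv.swap 0 i = σ from rfl, e]
  rw [e, injective_x_cons] at hw'
  exact hFG w hw'.1

end HyperellipticSurface

end

/-! ### Parts of high order at infinity, and projections of monomials -/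

noncomputable section

open HyperellipticSurface RegularPoint

namespace HyperellipticSurface

variable {S : HyperellipticSurface}

theorem laurentEval_add (h h' : ℤ →₀ ℂ) (x : ℂ) :
    laurentEval (h + h') x = laurentEval h x + laurentEval h' x :=
  Finsupp.sum_add_index' (by simp) fun _ _ _ => add_mul _ _ _

theorem laurentEval_smul (c : ℂ) (h : ℤ →₀ ℂ) (x : ℂ) :
    laurentEval (c • h) x = c * laurentEval h x := by
  unfold laurentEval
  rw [Finsupp.sum_smul_index (by simp), Finsupp.sum, Finsupp.sum, Finset.mul_sum]
  simp only [mul_assoc]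

@[simp] theorem laurentEval_zero (x : ℂ) : laurentEval 0 x = 0 := by simp [laurentEval]

theorem tendsto_norm_x : Tendsto (fun w : S.RegularPoint => ‖w.x‖) atInfinity atTop :=
  (tendsto_norm_cobounded_atTop (E := ℂ)).comp tendsto_x_atInfinity

/-- Otherwise divide by `x ^ M` with `M` the largest exponent: the quotient tends to the nonzero top
coefficient, yet it is `O(‖x‖ ^ (k - M))` with `k < M`. This gives uniqueness of the high part, so
the choice in `highPart` is harmless. -/
theorem eq_zero_of_laurentEval_isBigO {k : ℝ} {d : ℤ →₀ ℂ} (hd : ∀ m ∈ d.support, k < (m : ℝ))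
    (hO : (fun w : S.RegularPoint => laurentEval d w.x) =O[atInfinity] fun w => ‖w.x‖ ^ k) :
    d = 0 := by
  by_contra hne
  have hs : d.support.Nonempty := Finsupp.support_nonempty_iff.2 hne
  set M := d.support.max' hs with hM
  have hMs : M ∈ d.support := Finset.max'_mem _ _
  have h1 : Tendsto (fun w : S.RegularPoint => laurentEval d w.x * w.x ^ (-M)) atInfinity
      (𝓝 (∑ m ∈ d.support, if m = M then d M else 0)) := by
    have h2 : ∀ᶠ w : S.RegularPoint in atInfinity,
        ∑ m ∈ d.support, d m * w.x ^ (m - M) = laurentEval d w.x * w.x ^ (-M) := by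
      filter_upwards [eventually_x_ne_zero] with w hw
      rw [laurentEval, Finsupp.sum, Finset.sum_mul]
      refine Finset.sum_congr rfl fun m _ => ?_
      rw [mul_assoc, ← zpow_add₀ hw, sub_eq_add_neg]
    refine Tendsto.congr' h2 (tendsto_finsetSum _ fun m hm => ?_)
    split_ifs with hmM
    · subst hmM
      simp
    · have hlt : m < M := lt_of_le_of_ne (Finset.le_max' _ _ hm) hmM
      obtain ⟨l, hl⟩ := Int.eq_ofNat_of_zero_le (show 0 ≤ M - m by omega)
      have hl0 : l ≠ 0 := by omega
      have h3 : Tendsto (fun w : S.RegularPoint => d m * w.x⁻¹ ^ l) atInfinity (𝓝 (d m * 0 ^ l)) :=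
        (tendsto_inv_x_atInfinity.pow l).const_mul _
      rw [zero_pow hl0, mul_zero] at h3
      refine h3.congr fun w => ?_
      rw [show m - M = -(l : ℤ) by omega, zpow_neg, zpow_natCast, inv_pow]
  rw [Finset.sum_ite_eq' d.support M, if_pos hMs] at h1
  have h4 : Tendsto (fun w : S.RegularPoint => laurentEval d w.x * w.x ^ (-M)) atInfinity (𝓝 0) := by
    have h5 := hO.mul (isBigO_refl (fun w : S.RegularPoint => w.x ^ (-M)) atInfinity).norm_right
    refine IsBigO.trans_tendsto (g'' := fun w : S.RegularPoint => ‖w.x‖ ^ (k - M)) ?_ ?_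
    · refine h5.trans (IsBigO.of_bound 1 ?_)
      filter_upwards [eventually_x_ne_zero] with w hw
      have hpos : 0 < ‖w.x‖ := norm_pos_iff.2 hw
      rw [Real.rpow_sub hpos, one_mul, norm_zpow, zpow_neg, Real.rpow_intCast, div_eq_mul_inv]
    · have h6 : 0 < (M : ℝ) - k := sub_pos.2 (hd M hMs)
      have := (tendsto_rpow_neg_atTop h6).comp (tendsto_norm_x (S := S))
      simpa [Function.comp_def] using this
  exact (Finsupp.mem_support_iff.1 hMs) (tendsto_nhds_unique h1 h4)

namespace IsHighPart

variable {k : ℝ} {E E' : S.RegularPoint → ℂ} {h h' : ℤ →₀ ℂ}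

theorem add (hE : IsHighPart k E h) (hE' : IsHighPart k E' h') :
    IsHighPart k (fun w => E w + E' w) (h + h') := by
  classical
  refine ⟨fun m hm => ?_, (hE.2.add hE'.2).congr_left fun w => ?_⟩
  · rcases Finset.mem_union.1 (Finsupp.support_add hm) with h | h
    · exact hE.1 m h
    · exact hE'.1 m h
  · rw [laurentEval_add]; ring

theorem const_mul (c : ℂ) (hE : IsHighPart k E h) :
    IsHighPart k (fun w => c * E w) (c • h) := by
  refine ⟨fun m hm => hE.1 m (Finsupp.support_smul hm), (hE.2.const_mul_left c).congr_left
    fun w => ?_⟩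
  rw [laurentEval_smul]; ring

theorem congr (hE : IsHighPart k E h) (hEE' : E' =ᶠ[atInfinity] E) : IsHighPart k E' h := by
  refine ⟨hE.1, hE.2.congr' ?_ EventuallyEq.rfl⟩
  filter_upwards [hEE'] with w hw
  rw [hw]

theorem unique (hE : IsHighPart k E h) (hE' : IsHighPart k E h') : h = h' := by
  have h1 := (hE'.const_mul (-1)).add hE
  have h2 : (-1 : ℂ) • h' + h = 0 := by
    refine eq_zero_of_laurentEval_isBigO h1.1 (h1.2.neg_left.congr_left fun w => ?_)
    ring
  rw [neg_one_smul, neg_add_eq_zero] at h2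
  exact h2.symm

theorem highPart_eq (hE : IsHighPart k E h) : highPart k E = h := by
  have hex : ∃ h, IsHighPart k E h := ⟨h, hE⟩
  rw [highPart, dif_pos hex]
  exact hex.choose_spec.unique hE

theorem of_isBigO (hE : E =O[atInfinity] fun w => ‖w.x‖ ^ k) : IsHighPart k E 0 :=
  ⟨by simp, by simpa using hE⟩

theorem zero : IsHighPart k (fun _ : S.RegularPoint => 0) 0 :=
  of_isBigO (isBigO_zero _ _)

open Classical in
theorem monomial (c : ℂ) (m : ℕ) : IsHighPart k (fun w : S.RegularPoint => c * w.x ^ m)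
    (if k < m then Finsupp.single (m : ℤ) c else 0) := by
  split_ifs with hk
  · refine ⟨fun l hl => ?_, ?_⟩
    · rw [Finset.mem_singleton.1 (Finsupp.support_single_subset hl)]
      exact_mod_cast hk
    · simp [laurentEval, isBigO_zero]
  · refine of_isBigO (IsBigO.const_mul_left (IsBigO.of_bound 1 ?_) c)
    filter_upwards [eventually_one_le_norm_x] with w hw
    rw [norm_pow, one_mul, Real.norm_of_nonneg (Real.rpow_nonneg (norm_nonneg _) _),
      ← Real.rpow_natCast]
    exact Real.rpow_le_rpow_of_exponent_le hw (not_lt.1 hk)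

end IsHighPart

/-- Far out a moving point avoids the other two, so projections at generic points depend only on
generic values of `Q`. This permits replacing an iterated projection by a formula valid only
generically. -/
theorem eventually_generic_update (i : Fin 3) {z : Fin 3 → S.RegularPoint} (hz : Generic z) :
    ∀ᶠ w : S.RegularPoint in atInfinity, Generic (Function.update z i w) := by
  have hfin : (Set.range fun j => (z j).x).Finite := Set.finite_range _
  filter_upwards [eventually_atInfinity (S := S) hfin.eventually_notMem_cobounded] with w hw
  intro j l hjl
  by_contra hne
  dsimp only at hjl
  rcases eq_or_ne j i with rfl | hji
  · rw [Function.update_self, Function.update_of_ne (Ne.symm hne)] at hjl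
    exact hw ⟨l, hjl.symm⟩
  · rcases eq_or_ne l i with rfl | hli
    · rw [Function.update_self, Function.update_of_ne hne] at hjl
      exact hw ⟨j, hjl⟩
    · rw [Function.update_of_ne hji, Function.update_of_ne hli] at hjl
      exact hne (hz hjl)

/-- At generic points, the projection of `Q` with respect to the `i`-th point exists and is `R`. -/
def HasProjTo (i : Fin 3) (Q R : (Fin 3 → S.RegularPoint) → ℂ) : Prop :=
  ∀ z, Generic z → ∃ h h',
    IsHighPart ((S.n : ℝ) - 3) (evenPart i Q z) h ∧
    IsHighPart ((S.n : ℝ) / 2 - 3) (oddPart i Q z) h' ∧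
    R z = laurentEval h (z i).x + (z i).y * laurentEval h' (z i).x

namespace HasProjTo

variable {i : Fin 3} {Q Q' R R' : (Fin 3 → S.RegularPoint) → ℂ}

theorem hasProj (h : HasProjTo i Q R) : HasProj i Q := by
  intro z hz
  obtain ⟨h1, h2, h3, h4, _⟩ := h z hz
  exact ⟨⟨h1, h3⟩, ⟨h2, h4⟩⟩

theorem proj_eq (h : HasProjTo i Q R) {z : Fin 3 → S.RegularPoint} (hz : Generic z) :
    proj i Q z = R z := by
  obtain ⟨h1, h2, h3, h4, h5⟩ := h z hz
  rw [proj, h3.highPart_eq, h4.highPart_eq, h5]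

theorem congr (h : HasProjTo i Q R) (hQ : ∀ z, Generic z → Q' z = Q z)
    (hR : ∀ z, Generic z → R' z = R z) : HasProjTo i Q' R' := by
  intro z hz
  obtain ⟨h1, h2, h3, h4, h5⟩ := h z hz
  have e := eventually_generic_update i hz
  have e' : ∀ᶠ w : S.RegularPoint in atInfinity, Generic (Function.update z i w.conj) :=
    tendsto_conj_atInfinity.eventually e
  refine ⟨h1, h2, h3.congr ?_, h4.congr ?_, (hR z hz).trans h5⟩
  · filter_upwards [e, e'] with w hw hw'
    rw [evenPart, evenPart, hQ _ hw, hQ _ hw']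
  · filter_upwards [e, e'] with w hw hw'
    rw [oddPart, oddPart, hQ _ hw, hQ _ hw']

theorem add (h : HasProjTo i Q R) (h' : HasProjTo i Q' R') :
    HasProjTo i (fun z => Q z + Q' z) fun z => R z + R' z := by
  intro z hz
  obtain ⟨h1, h2, h3, h4, h5⟩ := h z hz
  obtain ⟨h1', h2', h3', h4', h5'⟩ := h' z hz
  refine ⟨_, _, (h3.add h3').congr ?_, (h4.add h4').congr ?_, ?_⟩
  · exact Eventually.of_forall fun w => by simp only [evenPart]; ring
  · exact Eventually.of_forall fun w => by simp only [oddPart]; ring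
  · beta_reduce
    rw [h5, h5', laurentEval_add, laurentEval_add]; ring

theorem const_mul (c : ℂ) (h : HasProjTo i Q R) :
    HasProjTo i (fun z => c * Q z) fun z => c * R z := by
  intro z hz
  obtain ⟨h1, h2, h3, h4, h5⟩ := h z hz
  refine ⟨_, _, (h3.const_mul c).congr ?_, (h4.const_mul c).congr ?_, ?_⟩
  · exact Eventually.of_forall fun w => by simp only [evenPart]; ring
  · exact Eventually.of_forall fun w => by simp only [oddPart]; ring
  · beta_reduce
    rw [h5, laurentEval_smul, laurentEval_smul]; ring

theorem zero : HasProjTo i (fun _ : Fin 3 → S.RegularPoint => 0) fun _ => 0 := by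
  intro z _
  refine ⟨0, 0, IsHighPart.zero.congr ?_, IsHighPart.zero.congr ?_, by simp⟩
  · exact Eventually.of_forall fun w => by simp [evenPart]
  · exact Eventually.of_forall fun w => by simp [oddPart]

theorem sum {ι : Type*} (s : Finset ι) {Q R : ι → (Fin 3 → S.RegularPoint) → ℂ}
    (h : ∀ j ∈ s, HasProjTo i (Q j) (R j)) :
    HasProjTo i (fun z => ∑ j ∈ s, Q j z) fun z => ∑ j ∈ s, R j z := by
  classical
  induction s using Finset.induction_on with
  | empty => simpa using zero
  | insert j s hj ih =>
    simp only [Finset.sum_insert hj]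
    exact (h j (by simp)).add (ih fun l hl => h l (by simp [hl]))

end HasProjTo

/-- The monomial is annihilated by `1 - π`, where `π` is the projection with respect to the `i`-th
point. -/
def IsHigh (S : HyperellipticSurface) (i : Fin 3) (j : Finset (Fin 3) × (Fin 3 →₀ ℕ)) : Prop :=
  if i ∈ j.1 then (S.n : ℝ) / 2 - 3 < j.2 i else (S.n : ℝ) - 3 < j.2 i

open Classical in
-- A monomial is odd in the `i`-th point if it contains `y_i` and even otherwise. One of its two
-- parts is thus zero and the other a single power of `x_i`, which is kept or dropped as a whole.
theorem hasProjTo_mono (i : Fin 3) (j : Finset (Fin 3) × (Fin 3 →₀ ℕ)) :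
    HasProjTo (S := S) i (mono j) fun z => if IsHigh S i j then mono j z else 0 := by
  intro z _
  set s := j.1
  set m := j.2
  have hx : ∀ w : S.RegularPoint, ∏ l, (Function.update z i w l).x ^ m l =
      (∏ l ∈ Finset.univ.erase i, (z l).x ^ m l) * w.x ^ m i := by
    intro w
    rw [← Finset.prod_erase_mul _ _ (Finset.mem_univ i), Function.update_self]
    congr 1
    refine Finset.prod_congr rfl fun l hl => ?_
    rw [Function.update_of_ne (Finset.ne_of_mem_erase hl)]
  have hlaurent : ∀ (k : ℝ) (C x : ℂ), laurentEval
      (if k < m i then Finsupp.single (m i : ℤ) C else 0) x = if k < m i then C * x ^ m i else 0 := by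
    intro k C x
    split_ifs <;> simp [laurentEval]
  by_cases hi : i ∈ s
  · have hhigh : IsHigh S i j ↔ (S.n : ℝ) / 2 - 3 < m i := by rw [IsHigh, if_pos hi]
    set C := (∏ l ∈ s.erase i, (z l).y) * ∏ l ∈ Finset.univ.erase i, (z l).x ^ m l with hC
    have hmono : ∀ w : S.RegularPoint, mono j (Function.update z i w) = w.y * (C * w.x ^ m i) := by
      intro w
      have hy : ∏ l ∈ s, (Function.update z i w l).y = (∏ l ∈ s.erase i, (z l).y) * w.y := by
        rw [← Finset.prod_erase_mul _ _ hi, Function.update_self]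
        congr 1
        refine Finset.prod_congr rfl fun l hl => ?_
        rw [Function.update_of_ne (Finset.ne_of_mem_erase hl)]
      rw [mono, hx w, hy, hC]
      ring
    have hz := hmono (z i)
    rw [Function.update_eq_self] at hz
    refine ⟨0, _, IsHighPart.zero.congr ?_, (IsHighPart.monomial C (m i)).congr ?_, ?_⟩
    · refine Eventually.of_forall fun w => ?_
      rw [evenPart, hmono, hmono, conj_x, conj_y]; ring
    · refine Eventually.of_forall fun w => ?_
      have := w.y_ne_zero
      rw [oddPart, hmono, hmono, conj_x, conj_y]
      field_simp
      ring
    · rw [hlaurent]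
      simp only [hhigh, laurentEval_zero, zero_add]
      split_ifs with h1
      · exact hz
      · simp
  · have hhigh : IsHigh S i j ↔ (S.n : ℝ) - 3 < m i := by rw [IsHigh, if_neg hi]
    set C := (∏ l ∈ s, (z l).y) * ∏ l ∈ Finset.univ.erase i, (z l).x ^ m l with hC
    have hmono : ∀ w : S.RegularPoint, mono j (Function.update z i w) = C * w.x ^ m i := by
      intro w
      have hy : ∏ l ∈ s, (Function.update z i w l).y = ∏ l ∈ s, (z l).y := by
        refine Finset.prod_congr rfl fun l hl => ?_
        rw [Function.update_of_ne (by rintro rfl; exact hi hl)]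
      rw [mono, hx w, hy, hC]
      ring
    have hz := hmono (z i)
    rw [Function.update_eq_self] at hz
    refine ⟨_, 0, (IsHighPart.monomial C (m i)).congr ?_, IsHighPart.zero.congr ?_, ?_⟩
    · refine Eventually.of_forall fun w => ?_
      rw [evenPart, hmono, hmono, conj_x]; ring
    · refine Eventually.of_forall fun w => ?_
      rw [oddPart, hmono, hmono, conj_x]; simp
    · rw [hlaurent]
      simp only [hhigh, laurentEval_zero, mul_zero, add_zero]
      split_ifs with h1
      · exact hz
      · rfl

open Classical in
/-- The sum of the terms of a linear combination of monomials whose exponents satisfy `p`. -/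
def partialSum (a : Finset (Fin 3) × (Fin 3 →₀ ℕ) →₀ ℂ)
    (p : Finset (Fin 3) × (Fin 3 →₀ ℕ) → Prop) (z : Fin 3 → S.RegularPoint) : ℂ :=
  ∑ j ∈ a.support, a j * if p j then mono j z else 0

/-- Projecting conjoins the condition of being high in `x_i` to the selection, so iterated
projections are again partial sums. -/
theorem hasProjTo_partialSum (i : Fin 3) (a : Finset (Fin 3) × (Fin 3 →₀ ℕ) →₀ ℂ)
    (p : Finset (Fin 3) × (Fin 3 →₀ ℕ) → Prop) :
    HasProjTo (S := S) i (partialSum a p) (partialSum a fun j => p j ∧ IsHigh S i j) := by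
  classical
  refine HasProjTo.sum a.support fun j _ => HasProjTo.const_mul (a j) ?_
  by_cases hp : p j
  · simpa [hp] using hasProjTo_mono i j
  · simpa [hp] using HasProjTo.zero

/-- The sharp rate is needed here: division by `y` lowers the order by exactly `n / 2` and carries
the threshold `n - 3` of even parts to the threshold `n / 2 - 3` of odd parts. It follows from `p x
= x ^ n * p.reverse (1 / x)`, where `p.reverse` does not vanish at `0`. -/
theorem isBigO_inv_y : (fun w : S.RegularPoint => w.y⁻¹) =O[atInfinity]
    fun w => ‖w.x‖ ^ (-(S.n : ℝ) / 2) := by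
  have h0 : S.p.reverse.eval 0 ≠ 0 := by
    rw [← Polynomial.coeff_zero_eq_eval_zero, Polynomial.coeff_zero_reverse]
    exact Polynomial.leadingCoeff_ne_zero.2 S.p_ne_zero
  have h1 : Tendsto (fun w : S.RegularPoint => (S.p.reverse.eval w.x⁻¹)⁻¹) atInfinity
      (𝓝 (S.p.reverse.eval 0)⁻¹) :=
    ((S.p.reverse.continuous.tendsto 0).comp tendsto_inv_x_atInfinity).inv₀ h0
  obtain ⟨M, hM⟩ := (h1.isBigO_one ℂ).bound
  refine IsBigO.of_bound (Real.sqrt M) ?_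
  filter_upwards [hM, eventually_x_ne_zero] with w hw hx
  have hpos : 0 < ‖w.x‖ := norm_pos_iff.2 hx
  let _ : Invertible w.x := invertibleOfNonzero hx
  have h2 := Polynomial.eval₂_reverse_mul_pow (RingHom.id ℂ) w.x S.p
  rw [invOf_eq_inv] at h2
  change S.p.reverse.eval w.x⁻¹ * w.x ^ S.n = w.p at h2
  have h3 : ‖w.y⁻¹‖ ^ 2 ≤ M * (‖w.x‖ ^ (-(S.n : ℝ) / 2)) ^ 2 := by
    rw [← norm_pow, inv_pow, ← p_eq, ← h2, mul_inv, norm_mul, ← Real.rpow_natCast,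
      ← Real.rpow_mul hpos.le]
    simp only [norm_one, mul_one] at hw
    rw [show -(S.n : ℝ) / 2 * (2 : ℕ) = -(S.n : ℝ) by push_cast; ring, Real.rpow_neg hpos.le,
      Real.rpow_natCast, norm_inv (w.x ^ S.n), norm_pow]
    exact mul_le_mul_of_nonneg_right hw (by positivity)
  have hM0 : 0 ≤ M := by
    simp only [norm_one, mul_one] at hw
    exact (norm_nonneg _).trans hw
  rw [Real.norm_of_nonneg (Real.rpow_nonneg hpos.le _)]
  refine (sq_le_sq₀ (norm_nonneg _) (by positivity)).1 ?_
  rwa [mul_pow, Real.sq_sqrt hM0]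

end HyperellipticSurface

end

/-! ### Permutation symmetry, polynomiality and rationality in three variables -/

noncomputable section

open HyperellipticSurface RegularPoint

namespace HyperellipticSurface

variable {S : HyperellipticSurface}

theorem Generic.comp_perm {z : Fin 3 → S.RegularPoint} (hz : Generic z)
    (σ : Equiv.Perm (Fin 3)) : Generic (z ∘ σ) :=
  Function.Injective.comp (g := fun i => (z i).x) hz σ.injective

/-- Invariance under the two adjacent transpositions suffices, since these generate all
permutations. -/
theorem apply_comp_perm {F : S.RegularPoint → S.RegularPoint → S.RegularPoint → ℂ}
    (h : ∀ a b d : S.RegularPoint, a.x ≠ b.x → a.x ≠ d.x → b.x ≠ d.x → F a b d = F b a d)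
    (h' : ∀ a b d : S.RegularPoint, a.x ≠ b.x → a.x ≠ d.x → b.x ≠ d.x → F a b d = F a d b)
    (σ : Equiv.Perm (Fin 3)) {z : Fin 3 → S.RegularPoint} (hz : Generic z) :
    F ((z ∘ σ) 0) ((z ∘ σ) 1) ((z ∘ σ) 2) = F (z 0) (z 1) (z 2) := by
  have hne : ∀ {i j : Fin 3}, i ≠ j → (z i).x ≠ (z j).x := fun hij h => hij (hz h)
  have h01 : (z 0).x ≠ (z 1).x := hne (by decide)
  have h02 : (z 0).x ≠ (z 2).x := hne (by decide)
  have h12 : (z 1).x ≠ (z 2).x := hne (by decide)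
  have e01 : σ 0 ≠ σ 1 := σ.injective.ne (by decide)
  have e02 : σ 0 ≠ σ 2 := σ.injective.ne (by decide)
  have e12 : σ 1 ≠ σ 2 := σ.injective.ne (by decide)
  have key : ∀ i j k : Fin 3, i ≠ j → i ≠ k → j ≠ k →
      i = 0 ∧ j = 1 ∧ k = 2 ∨ i = 0 ∧ j = 2 ∧ k = 1 ∨ i = 1 ∧ j = 0 ∧ k = 2 ∨
      i = 1 ∧ j = 2 ∧ k = 0 ∨ i = 2 ∧ j = 0 ∧ k = 1 ∨ i = 2 ∧ j = 1 ∧ k = 0 := by decide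
  simp only [Function.comp_apply]
  rcases key _ _ _ e01 e02 e12 with ⟨h0, h1, h2⟩ | ⟨h0, h1, h2⟩ | ⟨h0, h1, h2⟩ | ⟨h0, h1, h2⟩ |
    ⟨h0, h1, h2⟩ | ⟨h0, h1, h2⟩ <;> rw [h0, h1, h2]
  · exact (h' _ _ _ h01 h02 h12).symm
  · exact (h _ _ _ h01 h02 h12).symm
  · rw [h' _ _ _ h12 h01.symm h02.symm, ← h _ _ _ h01 h02 h12]
  · rw [h _ _ _ h02.symm h12.symm h01, ← h' _ _ _ h01 h02 h12]
  · rw [h _ _ _ h12.symm h02.symm h01.symm, h' _ _ _ h12 h01.symm h02.symm, ← h _ _ _ h01 h02 h12]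

theorem IsPolyFun.exists_evalXY {N : ℕ} {Q : (Fin N → S.RegularPoint) → ℂ} (hQ : IsPolyFun Q)
    (e : Fin N → Fin 3) (he : Function.Injective e) : ∃ F : MvPolynomial (Fin 3 ⊕ Fin 3) ℂ,
      ∀ z : Fin 3 → S.RegularPoint, Generic z → Q (z ∘ e) = evalXY F z := by
  obtain ⟨a, ha⟩ := hQ
  refine ⟨∑ j ∈ a.support, MvPolynomial.C (a j) *
    ((∏ i ∈ j.1, MvPolynomial.X (Sum.inr (e i))) *
      ∏ i, MvPolynomial.X (Sum.inl (e i)) ^ j.2 i), fun z hz => ?_⟩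
  rw [ha (z ∘ e) (Function.Injective.comp (g := fun i => (z i).x) hz he)]
  simp [monoSum, Finsupp.sum, evalXY, mono]

end HyperellipticSurface

namespace VirasoroState

variable {S : HyperellipticSurface} {c : ℂ} (V : VirasoroState S c)

theorem R0_comp_perm (hV : V.one ≠ 0) (σ : Equiv.Perm (Fin 3)) {z : Fin 3 → S.RegularPoint}
    (hz : Generic z) : V.R0 (z ∘ σ) = V.R0 z := by
  rw [R0_eq, R0_eq]
  exact apply_comp_perm (F := V.nR) (fun a b d hab _ _ => V.nR_comm hV fun h => hab (by rw [h]))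
    (fun a b d _ _ hbd => V.nR_comm' hV fun h => hbd (by rw [h])) σ hz

theorem G3_comp_perm (σ : Equiv.Perm (Fin 3)) {z : Fin 3 → S.RegularPoint}
    (hz : Generic z) : V.G3 (z ∘ σ) = V.G3 z := by
  refine apply_comp_perm (F := fun a b d => V.conn3 a b d * (a.p * b.p * d.p))
    (fun a b d hab had hbd => ?_) (fun a b d hab had hbd => ?_) σ hz
  · rw [V.conn3_comm (fun h => hab (by rw [h])) (fun h => had (by rw [h]))
      (fun h => hbd (by rw [h]))]
    ring
  · rw [V.conn3_comm' (fun h => hab (by rw [h])) (fun h => had (by rw [h]))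
      (fun h => hbd (by rw [h]))]
    ring

theorem diffField_eq {z : Fin 3 → S.RegularPoint} (hz : Generic z) :
    V.diffField (z 0) (z 1) (z 2) = V.G3 z - V.R0 z := by
  have h02 : z 0 ≠ z 2 := fun h => absurd (hz (congrArg RegularPoint.x h)) (by decide)
  rw [R0_eq, G3, V.conn3_eq h02]
  rfl

theorem isPolyFun_nP (hV : V.one ≠ 0) :
    IsPolyFun fun z : Fin 1 → S.RegularPoint => V.nP (z 0) := by
  obtain ⟨F, G, hF, hG, h⟩ := V.exists_polynomials_nP hV
  refine (IsSeparatelyPoly.of_symmetric (D := 2 * S.n) (fun i z _ => ?_)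
    fun z _ => ⟨F, G, hF, hG, fun w _ => h w⟩).isPolyFun
  obtain rfl : i = 0 := by omega
  simp

theorem isPolyFun_nreg (hV : V.one ≠ 0) :
    IsPolyFun fun z : Fin 2 → S.RegularPoint => V.nreg (z 0) (z 1) := by
  refine (IsSeparatelyPoly.of_symmetric (D := 4 * S.n) (fun i z hz => ?_)
    fun z _ => ?_).isPolyFun
  · have h01 : z 0 ≠ z 1 := fun h => absurd (hz (congrArg RegularPoint.x h)) (by decide)
    fin_cases i
    · simp
    · simpa using (V.nreg_comm hV h01).symm
  · obtain ⟨F, G, hF, hG, h⟩ := V.exists_polynomials_nreg hV (z 0)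
    exact ⟨F, G, hF, hG, fun w hw => h w (hw 0).symm⟩

theorem isPolyFun_G3_sub_R0 (hV : V.one ≠ 0) :
    IsPolyFun fun z : Fin 3 → S.RegularPoint => V.G3 z - V.R0 z := by
  refine (IsSeparatelyPoly.of_symmetric (D := 6 * S.n) (fun i z hz => ?_)
    fun z hz => ?_).isPolyFun
  · rw [V.G3_comp_perm _ hz, V.R0_comp_perm hV _ hz]
  · have h01 : (z 0).x ≠ (z 1).x := fun h => absurd (hz h) (by decide)
    obtain ⟨F, G, hF, hG, h⟩ := V.exists_polynomials_diffField hV h01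
    refine ⟨F, G, hF, hG, fun w hw => ?_⟩
    rw [← V.diffField_eq (injective_x_cons.2 ⟨hw, hz⟩), ← h w (hw 0).symm (hw 1).symm]
    rfl

/-- `P` and `reg` are themselves polynomial in the coordinates, by the same Liouville and
interpolation argument. The only denominators are therefore those of the `f`, and `∏ (x_i - x_j) ^
2` is a common one. -/
theorem exists_R0_eq_div (hV : V.one ≠ 0) : ∃ num den : MvPolynomial (Fin 3 ⊕ Fin 3) ℂ,
    ∀ z : Fin 3 → S.RegularPoint, Generic z →
      evalXY den z ≠ 0 ∧ V.R0 z = evalXY num z / evalXY den z := by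
  have hP : ∀ i : Fin 3, ∃ F : MvPolynomial (Fin 3 ⊕ Fin 3) ℂ,
      ∀ z : Fin 3 → S.RegularPoint, Generic z → V.nP (z i) = evalXY F z := fun i =>
    (V.isPolyFun_nP hV).exists_evalXY (fun _ => i) (Function.injective_of_subsingleton _)
  have hr : ∀ i j : Fin 3, i ≠ j → ∃ F : MvPolynomial (Fin 3 ⊕ Fin 3) ℂ,
      ∀ z : Fin 3 → S.RegularPoint, Generic z → V.nreg (z i) (z j) = evalXY F z := by
    intro i j hij
    refine (V.isPolyFun_nreg hV).exists_evalXY ![i, j] fun k l hkl => ?_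
    fin_cases k <;> fin_cases l <;> simp_all [eq_comm]
  choose P hP using hP
  obtain ⟨r01, hr01⟩ := hr 0 1 (by decide)
  obtain ⟨r02, hr02⟩ := hr 0 2 (by decide)
  obtain ⟨r12, hr12⟩ := hr 1 2 (by decide)
  let s : Fin 3 → Fin 3 → MvPolynomial (Fin 3 ⊕ Fin 3) ℂ := fun i j =>
    (MvPolynomial.X (Sum.inr i) + MvPolynomial.X (Sum.inr j)) ^ 2
  let d : Fin 3 → Fin 3 → MvPolynomial (Fin 3 ⊕ Fin 3) ℂ := fun i j =>
    (MvPolynomial.X (Sum.inl i) - MvPolynomial.X (Sum.inl j)) ^ 2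
  have hs : ∀ i j z, evalXY (S := S) (s i j) z = ((z i).y + (z j).y) ^ 2 := by
    intro i j z; simp [evalXY, s]
  have hd : ∀ i j z, evalXY (S := S) (d i j) z = ((z i).x - (z j).x) ^ 2 := by
    intro i j z; simp [evalXY, d]
  have hadd : ∀ A B z, evalXY (S := S) (A + B) z = evalXY A z + evalXY B z := by
    intro A B z; simp [evalXY]
  have hmul : ∀ A B z, evalXY (S := S) (A * B) z = evalXY A z * evalXY B z := by
    intro A B z; simp [evalXY]
  have hC : ∀ k z, evalXY (S := S) (MvPolynomial.C k) z = k := by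
    intro k z; simp [evalXY]
  refine ⟨MvPolynomial.C (c / 64) * s 0 1 * s 0 2 * s 1 2 +
    MvPolynomial.C (1 / 64) * s 0 1 * s 0 2 * d 1 2 * (P 1 + P 2) +
    MvPolynomial.C (1 / 64) * s 0 1 * s 1 2 * d 0 2 * (P 0 + P 2) +
    MvPolynomial.C (1 / 64) * s 0 2 * s 1 2 * d 0 1 * (P 0 + P 1) +
    MvPolynomial.C (1 / 4) * s 0 1 * d 0 2 * d 1 2 * (r02 + r12) +
    MvPolynomial.C (1 / 4) * s 0 2 * d 0 1 * d 1 2 * (r01 + r12) +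
    MvPolynomial.C (1 / 4) * s 1 2 * d 0 1 * d 0 2 * (r01 + r02),
    d 0 1 * d 0 2 * d 1 2, fun z hz => ?_⟩
  have hne : ∀ {i j : Fin 3}, i ≠ j → (z i).x - (z j).x ≠ 0 :=
    fun hij h => hij (hz (sub_eq_zero.1 h))
  have h01 : (z 0).x - (z 1).x ≠ 0 := hne (by decide)
  have h02 : (z 0).x - (z 2).x ≠ 0 := hne (by decide)
  have h12 : (z 1).x - (z 2).x ≠ 0 := hne (by decide)
  simp only [hadd, hmul, hC, hs, hd, ← hP _ z hz, ← hr01 z hz, ← hr02 z hz, ← hr12 z hz]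
  refine ⟨by positivity, ?_⟩
  rw [R0_eq, nR]
  simp only [f]
  field_simp

end VirasoroState

end

/-! ### Symmetric coefficients and the low-order polynomial part -/

noncomputable section

open HyperellipticSurface RegularPoint

namespace HyperellipticSurface

variable {S : HyperellipticSurface}

/-- The action of permutations of the three points on the exponents of monomials. -/
def permExponent (σ : Equiv.Perm (Fin 3)) :
    Finset (Fin 3) × (Fin 3 →₀ ℕ) ≃ Finset (Fin 3) × (Fin 3 →₀ ℕ) :=
  (Equiv.finsetCongr σ).prodCongr (Finsupp.domCongr σ).toEquiv

theorem permExponent_fst (σ : Equiv.Perm (Fin 3)) (j : Finset (Fin 3) × (Fin 3 →₀ ℕ)) :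
    (permExponent σ j).1 = j.1.map σ.toEmbedding := rfl

theorem permExponent_snd_apply (σ : Equiv.Perm (Fin 3)) (j : Finset (Fin 3) × (Fin 3 →₀ ℕ))
    (i : Fin 3) : (permExponent σ j).2 (σ i) = j.2 i := by
  change j.2 (σ.symm (σ i)) = j.2 i
  rw [Equiv.symm_apply_apply]

theorem permExponent_mul (σ τ : Equiv.Perm (Fin 3)) (j : Finset (Fin 3) × (Fin 3 →₀ ℕ)) :
    permExponent (σ * τ) j = permExponent σ (permExponent τ j) := by
  refine Prod.ext ?_ (Finsupp.ext fun i => rfl)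
  rw [permExponent_fst, permExponent_fst, permExponent_fst, Finset.map_map]
  rfl

theorem mono_permExponent (σ : Equiv.Perm (Fin 3)) (j : Finset (Fin 3) × (Fin 3 →₀ ℕ))
    (z : Fin 3 → S.RegularPoint) : mono (permExponent σ j) z = mono j (z ∘ σ) := by
  rw [mono, mono, permExponent_fst, Finset.prod_map, ← Equiv.prod_comp σ fun i =>
    (z i).x ^ (permExponent σ j).2 i]
  simp only [permExponent_snd_apply]
  rfl

theorem isHigh_permExponent (σ : Equiv.Perm (Fin 3)) (j : Finset (Fin 3) × (Fin 3 →₀ ℕ))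
    (i : Fin 3) : IsHigh S (σ i) (permExponent σ j) ↔ IsHigh S i j := by
  have h : σ i ∈ (permExponent σ j).1 ↔ i ∈ j.1 := by
    rw [permExponent_fst]
    exact Finset.mem_map' σ.toEmbedding
  simp only [IsHigh, permExponent_snd_apply, h]

theorem monoSum_add {N : ℕ} (a b : Finset (Fin N) × (Fin N →₀ ℕ) →₀ ℂ)
    (z : Fin N → S.RegularPoint) : monoSum (a + b) z = monoSum a z + monoSum b z :=
  Finsupp.sum_add_index' (by simp) fun _ _ _ => add_mul _ _ _

theorem monoSum_smul {N : ℕ} (k : ℂ) (a : Finset (Fin N) × (Fin N →₀ ℕ) →₀ ℂ)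
    (z : Fin N → S.RegularPoint) : monoSum (k • a) z = k * monoSum a z := by
  unfold monoSum
  rw [Finsupp.sum_smul_index (by simp), Finsupp.sum, Finsupp.sum, Finset.mul_sum]
  simp only [mul_assoc]

theorem monoSum_sum {N : ℕ} {ι : Type*} (s : Finset ι)
    (a : ι → Finset (Fin N) × (Fin N →₀ ℕ) →₀ ℂ) (z : Fin N → S.RegularPoint) :
    monoSum (∑ i ∈ s, a i) z = ∑ i ∈ s, monoSum (a i) z := by
  classical
  induction s using Finset.induction_on with
  | empty => simp [monoSum]
  | insert i s hi ih => rw [Finset.sum_insert hi, Finset.sum_insert hi, monoSum_add, ih]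

theorem monoSum_equivMapDomain (σ : Equiv.Perm (Fin 3))
    (a : Finset (Fin 3) × (Fin 3 →₀ ℕ) →₀ ℂ) (z : Fin 3 → S.RegularPoint) :
    monoSum (a.equivMapDomain (permExponent σ)) z = monoSum a (z ∘ σ) := by
  rw [monoSum, Finsupp.equivMapDomain_eq_mapDomain,
    Finsupp.sum_mapDomain_index (by simp) (fun _ _ _ => add_mul _ _ _)]
  simp only [mono_permExponent]
  rfl

/-- A symmetric polynomial function has symmetric coefficients. -/
theorem IsPolyFun.exists_symmetric {Q : (Fin 3 → S.RegularPoint) → ℂ} (hQ : IsPolyFun Q)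
    (hsymm : ∀ (σ : Equiv.Perm (Fin 3)) (z : Fin 3 → S.RegularPoint), Generic z →
      Q (z ∘ σ) = Q z) :
    ∃ a : Finset (Fin 3) × (Fin 3 →₀ ℕ) →₀ ℂ,
      (∀ z : Fin 3 → S.RegularPoint, Generic z → Q z = monoSum a z) ∧
      ∀ σ j, a (permExponent σ j) = a j := by
  obtain ⟨a, ha⟩ := hQ
  -- Averaging over the six permutations yields invariant coefficients directly, without any
  -- uniqueness of the expansion.
  refine ⟨(6 : ℂ)⁻¹ • ∑ σ, a.equivMapDomain (permExponent σ), fun z hz => ?_, fun τ j => ?_⟩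
  · rw [monoSum_smul, monoSum_sum]
    have h : ∀ σ ∈ (Finset.univ : Finset (Equiv.Perm (Fin 3))),
        monoSum (a.equivMapDomain (permExponent σ)) z = Q z := by
      intro σ _
      rw [monoSum_equivMapDomain, ← ha _ (hz.comp_perm σ), hsymm σ z hz]
    rw [Finset.sum_congr rfl h, Finset.sum_const, Finset.card_univ, Fintype.card_perm,
      Fintype.card_fin]
    norm_num [Nat.factorial]
    ring
  · simp only [Finsupp.smul_apply, Finsupp.finsetSum_apply, Finsupp.equivMapDomain_apply]
    congr 1
    refine Fintype.sum_equiv (Equiv.mulLeft τ⁻¹) _ _ fun σ => congrArg a ?_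
    rw [Equiv.symm_apply_eq, Equiv.coe_mulLeft, ← Equiv.apply_symm_apply (permExponent (τ⁻¹ * σ)) j,
      ← permExponent_mul]
    simp

/-- The exponent is of low order with respect to all points. -/
def IsLow (S : HyperellipticSurface) (j : Finset (Fin 3) × (Fin 3 →₀ ℕ)) : Prop :=
  ∀ i, ¬ IsHigh S i j

theorem isLow_permExponent (σ : Equiv.Perm (Fin 3)) (j : Finset (Fin 3) × (Fin 3 →₀ ℕ)) :
    IsLow S (permExponent σ j) ↔ IsLow S j := by
  rw [IsLow, ← σ.forall_congr_right]
  simp only [isHigh_permExponent]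
  rfl

open Classical in
/-- The polynomial in `x₁, x₂, x₃` by which the product of the `y_i` with `i ∈ s` is multiplied in
the low order part of a linear combination of monomials. -/
def lowPart (S : HyperellipticSurface) (a : Finset (Fin 3) × (Fin 3 →₀ ℕ) →₀ ℂ)
    (s : Finset (Fin 3)) : MvPolynomial (Fin 3) ℂ :=
  ∑ j ∈ a.support, if IsLow S j ∧ j.1 = s then MvPolynomial.monomial j.2 (a j) else 0

open Classical in
theorem coeff_lowPart (a : Finset (Fin 3) × (Fin 3 →₀ ℕ) →₀ ℂ) (s : Finset (Fin 3))
    (m : Fin 3 →₀ ℕ) : (lowPart S a s).coeff m = if IsLow S (s, m) then a (s, m) else 0 := by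
  have h : ∀ j ∈ a.support, MvPolynomial.coeff m
      (if IsLow S j ∧ j.1 = s then MvPolynomial.monomial j.2 (a j) else 0) =
      if j = (s, m) then (if IsLow S (s, m) then a (s, m) else 0) else 0 := by
    intro j _
    by_cases hj : j = (s, m)
    · subst hj
      by_cases hl : IsLow S (s, m) <;> simp [hl]
    · rw [if_neg hj]
      split_ifs with h1
      · rw [MvPolynomial.coeff_monomial, if_neg fun h2 => hj (Prod.ext h1.2 h2)]
      · simp
  rw [lowPart, MvPolynomial.coeff_sum, Finset.sum_congr rfl h, Finset.sum_ite_eq']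
  split_ifs with h1 h2 h2
  · rfl
  · rfl
  · exact (Finsupp.notMem_support_iff.1 h1).symm
  · rfl

/-- Being low is a permutation-invariant condition, so invariance of the coefficients passes to the
low part. The sets `∅` and `Finset.univ` are fixed by all permutations, whence the symmetry of the
corresponding polynomials. -/
theorem rename_lowPart {a : Finset (Fin 3) × (Fin 3 →₀ ℕ) →₀ ℂ}
    (ha : ∀ σ j, a (permExponent σ j) = a j) (σ : Equiv.Perm (Fin 3)) (s : Finset (Fin 3)) :
    MvPolynomial.rename σ (lowPart S a s) = lowPart S a (s.map σ.toEmbedding) := by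
  classical
  ext m
  obtain ⟨m, rfl⟩ := (Finsupp.domCongr (M := ℕ) σ).surjective m
  have h : (s.map σ.toEmbedding, Finsupp.domCongr (M := ℕ) σ m) = permExponent σ (s, m) := rfl
  rw [coeff_lowPart, h, ha]
  simp only [isLow_permExponent]
  rw [← coeff_lowPart, Finsupp.domCongr_apply, Finsupp.equivMapDomain_eq_mapDomain,
    MvPolynomial.coeff_rename_mapDomain _ σ.injective]

theorem galoisSum_lowPart_comp_perm {a : Finset (Fin 3) × (Fin 3 →₀ ℕ) →₀ ℂ}
    (ha : ∀ σ j, a (permExponent σ j) = a j) (σ : Equiv.Perm (Fin 3)) (k : ℕ)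
    (z : Fin 3 → S.RegularPoint) :
    galoisSum (lowPart S a) k (z ∘ σ) = galoisSum (lowPart S a) k z := by
  refine Finset.sum_equiv (Equiv.finsetCongr σ) (fun s => ?_) fun s _ => ?_
  · simp [Finset.mem_powersetCard]
  · rw [Equiv.finsetCongr_apply, Finset.prod_map, ← rename_lowPart ha, evalX, evalX,
      MvPolynomial.eval_rename]
    rfl

theorem galoisSum_lowPart (a : Finset (Fin 3) × (Fin 3 →₀ ℕ) →₀ ℂ)
    (z : Fin 3 → S.RegularPoint) :
    galoisSum (lowPart S a) 0 z + galoisSum (lowPart S a) 1 z + galoisSum (lowPart S a) 2 z +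
      galoisSum (lowPart S a) 3 z = partialSum a (IsLow S) z := by
  classical
  have h := Finset.sum_powerset (Finset.univ : Finset (Fin 3))
    fun s => (∏ i ∈ s, (z i).y) * evalX (lowPart S a s) z
  simp only [Finset.card_univ, Fintype.card_fin, Finset.sum_range_succ, Finset.sum_range_zero,
    zero_add] at h
  refine h.symm.trans ?_
  rw [Finset.powerset_univ]
  have h1 : ∀ s : Finset (Fin 3), (∏ i ∈ s, (z i).y) * evalX (lowPart S a s) z =
      ∑ j ∈ a.support, if j.1 = s then a j * (if IsLow S j then mono j z else 0) else 0 := by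
    intro s
    rw [evalX, lowPart, map_sum, Finset.mul_sum]
    refine Finset.sum_congr rfl fun j _ => ?_
    by_cases hs : j.1 = s
    · subst hs
      by_cases hl : IsLow S j
      · simp only [hl, and_self, if_true, mono, MvPolynomial.eval_monomial,
          Finsupp.prod_fintype _ _ fun i => pow_zero _]
        ring
      · simp [hl]
    · simp [hs]
  rw [Finset.sum_congr rfl fun s _ => h1 s, Finset.sum_comm, partialSum]
  refine Finset.sum_congr rfl fun j _ => ?_
  rw [Finset.sum_ite_eq, if_pos (Finset.mem_univ _)]

theorem degree_le_of_mem_support_lowPart (hn : Odd S.n)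
    {a : Finset (Fin 3) × (Fin 3 →₀ ℕ) →₀ ℂ} {s : Finset (Fin 3)} {m : Fin 3 →₀ ℕ}
    (hm : m ∈ (lowPart S a s).support) (k : Fin 3) :
    (k ∈ s → (m k : ℤ) ≤ ((S.n : ℤ) - 1) / 2 - 3) ∧ (k ∉ s → (m k : ℤ) ≤ (S.n : ℤ) - 3) := by
  classical
  rw [MvPolynomial.mem_support_iff, coeff_lowPart] at hm
  have hlow : IsLow S (s, m) := by
    by_contra h
    exact hm (if_neg h)
  have h := hlow k
  obtain ⟨r, hr⟩ := hn
  refine ⟨fun hk => ?_, fun hk => ?_⟩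
  · rw [IsHigh, if_pos hk, not_lt] at h
    -- Clearing the half gives `2 m + 6 ≤ n`; oddness of `n` improves this to `m ≤ (n - 1) / 2 - 3`.
    -- The integer bound may be negative, and then there are no such exponents.
    have h2 : ((2 * m k + 6 : ℕ) : ℝ) ≤ (S.n : ℝ) := by push_cast; linarith
    have := Nat.cast_le.1 h2
    omega
  · rw [IsHigh, if_neg hk, not_lt] at h
    have h2 : ((m k + 3 : ℕ) : ℝ) ≤ (S.n : ℝ) := by push_cast; linarith
    have := Nat.cast_le.1 h2
    omega

theorem partialSum_true (a : Finset (Fin 3) × (Fin 3 →₀ ℕ) →₀ ℂ) (z : Fin 3 → S.RegularPoint) :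
    partialSum a (fun _ => True) z = monoSum a z := by
  simp [partialSum, monoSum, Finsupp.sum]

/-- Each monomial is either low in all variables or counted exactly once by inclusion-exclusion over
the three conditions `IsHigh`. -/
theorem partialSum_inclusion_exclusion (a : Finset (Fin 3) × (Fin 3 →₀ ℕ) →₀ ℂ)
    (z : Fin 3 → S.RegularPoint) :
    monoSum a z = partialSum a (IsHigh S 0) z
      - partialSum a (fun j => IsHigh S 0 j ∧ IsHigh S 1 j) z
      + partialSum a (IsHigh S 1) z
      - partialSum a (fun j => IsHigh S 1 j ∧ IsHigh S 2 j) z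
      + partialSum a (IsHigh S 2) z
      - partialSum a (fun j => IsHigh S 0 j ∧ IsHigh S 2 j) z
      + partialSum a (fun j => (IsHigh S 0 j ∧ IsHigh S 1 j) ∧ IsHigh S 2 j) z
      + partialSum a (IsLow S) z := by
  classical
  simp only [partialSum, monoSum, Finsupp.sum, ← Finset.sum_add_distrib, ← Finset.sum_sub_distrib]
  refine Finset.sum_congr rfl fun j _ => ?_
  have hlow : IsLow S j ↔ ¬ IsHigh S 0 j ∧ ¬ IsHigh S 1 j ∧ ¬ IsHigh S 2 j := by
    simp [IsLow, Fin.forall_fin_succ]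
  by_cases h0 : IsHigh S 0 j <;> by_cases h1 : IsHigh S 1 j <;> by_cases h2 : IsHigh S 2 j <;>
    simp [hlow, h0, h1, h2]

end HyperellipticSurface

/-! ### Projections of the three-point function and of its rational part -/

namespace VirasoroState

variable {S : HyperellipticSurface} {c : ℂ} (V : VirasoroState S c)

theorem isBigO_G3_update (hV : V.one ≠ 0) (hn : Odd S.n) (i : Fin 3)
    {z : Fin 3 → S.RegularPoint} (hz : Generic z) :
    (fun w => V.G3 (Function.update z i w)) =O[atInfinity] fun w => ‖w.x‖ ^ ((S.n : ℝ) - 3) := by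
  have h3 : 3 ≤ S.n := by
    have := S.one_le_g
    rcases S.natDegree_p with h | h <;> (unfold n; omega)
  set σ := Equiv.swap 0 i
  have hne : z (σ 1) ≠ z (σ 2) := fun h =>
    absurd (σ.injective (hz (congrArg RegularPoint.x h))) (by decide)
  refine (V.isBigO_G3 hV hn hne).norm_right.congr' ?_ ?_
  · filter_upwards [eventually_generic_update i hz] with w hw
    rw [← V.G3_comp_perm σ hw]
    congr 1
    funext l
    have hl : ∀ l, l ≠ 0 → σ l ≠ i := by
      intro l hl h
      exact hl (σ.injective (h.trans (Equiv.swap_apply_left 0 i).symm))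
    fin_cases l
    · simp [σ]
    · exact (Function.update_of_ne (hl 1 (by decide)) _ _).symm
    · exact (Function.update_of_ne (hl 2 (by decide)) _ _).symm
  · filter_upwards [eventually_x_ne_zero] with w hw
    rw [norm_pow, ← Real.rpow_natCast, Nat.cast_sub h3]
    norm_num

/-- The decay `O(x ^ (n - 3))` puts the even part at the threshold `n - 3`; dividing by `y` puts the
odd part at `n / 2 - 3`. Neither has a part of strictly larger order. -/
theorem hasProjTo_G3 (hV : V.one ≠ 0) (hn : Odd S.n) (i : Fin 3) :
    HasProjTo i V.G3 fun _ => 0 := by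
  intro z hz
  have h1 := V.isBigO_G3_update hV hn i hz
  have h2 : (fun w : S.RegularPoint => V.G3 (Function.update z i w.conj)) =O[atInfinity]
      fun w => ‖w.x‖ ^ ((S.n : ℝ) - 3) := h1.comp_tendsto tendsto_conj_atInfinity
  refine ⟨0, 0, .of_isBigO ?_, .of_isBigO ?_, by simp⟩
  · refine ((h1.add h2).const_mul_left (1 / 2)).congr_left fun w => ?_
    rw [evenPart]; ring
  · refine (((h1.sub h2).mul isBigO_inv_y).const_mul_left (1 / 2)).congr' ?_ ?_
    · refine Eventually.of_forall fun w => ?_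
      have := w.y_ne_zero
      simp only [oddPart]
      field_simp
    · filter_upwards [eventually_x_ne_zero] with w hw
      rw [← Real.rpow_add (norm_pos_iff.2 hw)]
      congr 1
      ring

/-- `R0` is `G3` minus a polynomial and `G3` projects to zero. So the projection exists although
`R0` has denominators, and it is minus the high part of that polynomial. -/
theorem hasProjTo_R0 (hV : V.one ≠ 0) (hn : Odd S.n)
    {a : Finset (Fin 3) × (Fin 3 →₀ ℕ) →₀ ℂ}
    (ha : ∀ z : Fin 3 → S.RegularPoint, Generic z → V.G3 z - V.R0 z = monoSum a z) (i : Fin 3) :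
    HasProjTo i V.R0 fun z => -1 * partialSum a (IsHigh S i) z := by
  refine ((V.hasProjTo_G3 hV hn i).add
    ((hasProjTo_partialSum i a fun _ => True).const_mul (-1))).congr
    (fun z hz => ?_) fun z _ => ?_
  · rw [partialSum_true, ← ha z hz]
    ring
  · simp

theorem hasProjTo_proj_R0 (hV : V.one ≠ 0) (hn : Odd S.n)
    {a : Finset (Fin 3) × (Fin 3 →₀ ℕ) →₀ ℂ}
    (ha : ∀ z : Fin 3 → S.RegularPoint, Generic z → V.G3 z - V.R0 z = monoSum a z)
    (i j : Fin 3) :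
    HasProjTo j (proj i V.R0) fun z =>
      -1 * partialSum a (fun e => IsHigh S i e ∧ IsHigh S j e) z :=
  ((hasProjTo_partialSum j a _).const_mul (-1)).congr
    (fun _ hz => (V.hasProjTo_R0 hV hn ha i).proj_eq hz) fun _ _ => rfl

theorem hasProjTo_proj_proj_R0 (hV : V.one ≠ 0) (hn : Odd S.n)
    {a : Finset (Fin 3) × (Fin 3 →₀ ℕ) →₀ ℂ}
    (ha : ∀ z : Fin 3 → S.RegularPoint, Generic z → V.G3 z - V.R0 z = monoSum a z)
    (i j k : Fin 3) :
    HasProjTo k (proj j (proj i V.R0)) fun z =>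
      -1 * partialSum a (fun e => (IsHigh S i e ∧ IsHigh S j e) ∧ IsHigh S k e) z :=
  ((hasProjTo_partialSum k a _).const_mul (-1)).congr
    (fun _ hz => (V.hasProjTo_proj_R0 hV hn ha i j).proj_eq hz) fun _ _ => rfl

end VirasoroState

end

/-! ### Assembly of the three statements -/

theorem theorem4 (S : HyperellipticSurface) (c : ℂ) (V : VirasoroState S c) (hV : V.one ≠ 0) :
    -- behaviour at infinity
    (Odd S.n → ∀ z₂ z₃ : S.RegularPoint, z₂ ≠ z₃ →
      (fun z₁ : S.RegularPoint => V.G3 ![z₁, z₂, z₃])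
        =O[HyperellipticSurface.RegularPoint.atInfinity] fun z₁ => z₁.x ^ (S.n - 3)) ∧
    -- the finite region
    ((∃ num den : MvPolynomial (Fin 3 ⊕ Fin 3) ℂ,
        ∀ z : Fin 3 → S.RegularPoint, HyperellipticSurface.Generic z →
          HyperellipticSurface.evalXY den z ≠ 0 ∧
          V.R0 z = HyperellipticSurface.evalXY num z / HyperellipticSurface.evalXY den z) ∧
      (∀ (σ : Equiv.Perm (Fin 3)) (z : Fin 3 → S.RegularPoint), HyperellipticSurface.Generic z →
        V.R0 (z ∘ σ) = V.R0 z) ∧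
      ∃ F : MvPolynomial (Fin 3 ⊕ Fin 3) ℂ,
        ∀ z : Fin 3 → S.RegularPoint, HyperellipticSurface.Generic z →
          V.G3 z = V.R0 z + HyperellipticSurface.evalXY F z) ∧
    -- the full formula for odd degree
    (Odd S.n →
      ((∀ i, HyperellipticSurface.HasProj i V.R0) ∧
        (∀ i j, i ≠ j →
          HyperellipticSurface.HasProj j (HyperellipticSurface.proj i V.R0)) ∧
        (∀ i j k, i ≠ j → i ≠ k → j ≠ k →
          HyperellipticSurface.HasProj k
            (HyperellipticSurface.proj j (HyperellipticSurface.proj i V.R0)))) ∧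
      (∀ z : Fin 3 → S.RegularPoint, HyperellipticSurface.Generic z →
        (∀ i j, i ≠ j →
          HyperellipticSurface.proj j (HyperellipticSurface.proj i V.R0) z =
            HyperellipticSurface.proj i (HyperellipticSurface.proj j V.R0) z) ∧
        (∀ i j k, i ≠ j → i ≠ k → j ≠ k →
          HyperellipticSurface.proj k
              (HyperellipticSurface.proj j (HyperellipticSurface.proj i V.R0)) z =
            HyperellipticSurface.proj 2
              (HyperellipticSurface.proj 1 (HyperellipticSurface.proj 0 V.R0)) z)) ∧
      ∃ F : Finset (Fin 3) → MvPolynomial (Fin 3) ℂ,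
        (∀ z : Fin 3 → S.RegularPoint, HyperellipticSurface.Generic z →
          V.G3 z =
            V.R0 z
            - HyperellipticSurface.proj 0 V.R0 z
            + HyperellipticSurface.proj 1 (HyperellipticSurface.proj 0 V.R0) z
            - HyperellipticSurface.proj 1 V.R0 z
            + HyperellipticSurface.proj 2 (HyperellipticSurface.proj 1 V.R0) z
            - HyperellipticSurface.proj 2 V.R0 z
            + HyperellipticSurface.proj 2 (HyperellipticSurface.proj 0 V.R0) z
            - HyperellipticSurface.proj 2
                (HyperellipticSurface.proj 1 (HyperellipticSurface.proj 0 V.R0)) z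
            + HyperellipticSurface.galoisSum F 0 z
            + HyperellipticSurface.galoisSum F 1 z
            + HyperellipticSurface.galoisSum F 2 z
            + HyperellipticSurface.galoisSum F 3 z) ∧
        (∀ s, ∀ m ∈ (F s).support, ∀ k,
          (k ∈ s → (m k : ℤ) ≤ ((S.n : ℤ) - 1) / 2 - 3) ∧
          (k ∉ s → (m k : ℤ) ≤ (S.n : ℤ) - 3)) ∧
        (F ∅).IsSymmetric ∧ (F Finset.univ).IsSymmetric ∧
        (∀ (σ : Equiv.Perm (Fin 3)) (z : Fin 3 → S.RegularPoint),
          HyperellipticSurface.galoisSum F 1 (z ∘ σ) = HyperellipticSurface.galoisSum F 1 z ∧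
          HyperellipticSurface.galoisSum F 2 (z ∘ σ) =
            HyperellipticSurface.galoisSum F 2 z)) := by
  classical
  obtain ⟨a, ha, hperm⟩ := (V.isPolyFun_G3_sub_R0 hV).exists_symmetric fun σ z hz => by
    rw [V.G3_comp_perm σ hz, V.R0_comp_perm hV σ hz]
  refine ⟨fun hn z₂ z₃ h => V.isBigO_G3 hV hn h, ⟨V.exists_R0_eq_div hV,
    fun σ z hz => V.R0_comp_perm hV σ hz, ?_⟩, fun hn => ?_⟩
  · obtain ⟨F, hF⟩ := (V.isPolyFun_G3_sub_R0 hV).exists_evalXY id Function.injective_id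
    exact ⟨F, fun z hz => eq_add_of_sub_eq' (hF z hz)⟩
  have h1 := V.hasProjTo_R0 hV hn ha
  have h2 := V.hasProjTo_proj_R0 hV hn ha
  have h3 := V.hasProjTo_proj_proj_R0 hV hn ha
  refine ⟨⟨fun i => (h1 i).hasProj, fun i j _ => (h2 i j).hasProj,
    fun i j k _ _ _ => (h3 i j k).hasProj⟩, fun z hz => ⟨fun i j _ => ?_, fun i j k hij hik hjk => ?_⟩,
    HyperellipticSurface.lowPart S a, fun z hz => ?_, fun s m hm k =>
      HyperellipticSurface.degree_le_of_mem_support_lowPart hn hm k,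
    fun σ => HyperellipticSurface.rename_lowPart hperm σ ∅, fun σ => ?_, fun σ z =>
      ⟨HyperellipticSurface.galoisSum_lowPart_comp_perm hperm σ 1 z,
        HyperellipticSurface.galoisSum_lowPart_comp_perm hperm σ 2 z⟩⟩
  · rw [(h2 i j).proj_eq hz, (h2 j i).proj_eq hz]
    simp only [and_comm]
  · rw [(h3 i j k).proj_eq hz, (h3 0 1 2).proj_eq hz]
    congr 2
    funext e
    -- Three distinct indices exhaust `Fin 3`, so each order of projection selects the monomials
    -- that are high in all three variables.
    have key : ∀ i j k : Fin 3, i ≠ j → i ≠ k → j ≠ k → ∀ l, l = i ∨ l = j ∨ l = k := by decide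
    refine propext ⟨fun h => ?_, fun h => ?_⟩
    · have hall : ∀ l, HyperellipticSurface.IsHigh S l e := by
        intro l
        rcases key i j k hij hik hjk l with rfl | rfl | rfl
        exacts [h.1.1, h.1.2, h.2]
      exact ⟨⟨hall 0, hall 1⟩, hall 2⟩
    · have hall : ∀ l, HyperellipticSurface.IsHigh S l e := by
        intro l
        rcases key 0 1 2 (by decide) (by decide) (by decide) l with rfl | rfl | rfl
        exacts [h.1.1, h.1.2, h.2]
      exact ⟨⟨hall i, hall j⟩, hall k⟩
  -- Each projection of `R0` is minus a partial sum, so the alternating signs of the formula match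
  -- those of the inclusion-exclusion identity for `G3 - R0`.
  · rw [(h1 0).proj_eq hz, (h1 1).proj_eq hz, (h1 2).proj_eq hz, (h2 0 1).proj_eq hz,
      (h2 1 2).proj_eq hz, (h2 0 2).proj_eq hz, (h3 0 1 2).proj_eq hz]
    have e1 := HyperellipticSurface.galoisSum_lowPart a z
    have e2 := HyperellipticSurface.partialSum_inclusion_exclusion a z
    linear_combination ha z hz + e2 - e1
  · refine (HyperellipticSurface.rename_lowPart hperm σ Finset.univ).trans ?_
    rw [Finset.map_univ_equiv]
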